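/- **Population.** Let $(\mathcal F,d)$ be a semi-metric (pseudo-metric) space with a $\sigma$-algebra containing its open sets, and let $\boldsymbol\chi\in\mathcal F$ and the real variables $Y,T,S$ be defined on a probability space with probability $\mathbb P$. Put $Z=\min(Y,S)$, $\delta=\mathbf 1_{\{Y\le S\}}$, and let $F,G,L,H$ be the distribution functions of $Y,S,T,Z$. For a distribution function $W$ let $a_W=\inf\{y:W(y)>0\}$ and $b_W=\sup\{y:W(y)<1\}$. Assume that $Y>0$ and $S>0$ almost surely, that $F$ and $G$ are continuous and $L$ is continuous on $(a_H,\infty)$, that $T$ and $S$ are independent and $(T,S)$ is independent of $(\boldsymbol\chi,Y)$, that $\mathbb P(Z\ge T)>0$, and that $a_L<a_H$ and $b_L\le b_H$. **Sample.** Let $(\boldsymbol\chi_i,Z_i,T_i,\delta_i)_{i\ge1}$ be i.i.d. with the conditional law of $(\boldsymbol\chi,Z,T,\delta)$ given $\{Z\ge T\}$; write $\mathbf P$ for their probability. Put $$C_n(y)=\frac1n\sum_{i=1}^n\mathbf 1_{\{T_i\le y\le Z_i\}},\qquad L_n(y)=\prod_{i\le n:\,T_i>y}\Big(1-\frac1{nC_n(T_i)}\Big),\qquad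 \bar G_n(y)=\prod_{i\le n:\,Z_i\le y}\Big(1-\frac1{nC_n(Z_i)}\Big)^{1-\delta_i}$$ (the Lynden-Bell and TJW product-limit estimators). For $\chi\in\mathcal F$, a kernel $K$ and bandwidths $h=h_n>0$ let $$\hat r_n(\chi)=\frac{\sum_{i=1}^n \delta_iK\big(d(\chi,\boldsymbol\chi_i)/h\big)Z_i^{-1}\big/\big(L_n(Z_i)\bar G_n(Z_i)\big)}{\sum_{i=1}^n \delta_iK\big(d(\chi,\boldsymbol\chi_i)/h\big)Z_i^{-2}\big/\big(L_n(Z_i)\bar G_n(Z_i)\big)} .$$ **Assumptions at a fixed point** $\chi\in\mathcal F$ with a neighbourhood $\mathcal N_\chi$. Let $r_\ell(\cdot)=\mathbb E[Y^{-\ell}\mid\boldsymbol\chi=\cdot\,]$, $\ell=1,2$ (finite versions), and $r=r_1/r_2$. Write $\phi_\chi(\rho)=\mathbb P(d(\chi,\boldsymbol\chi)\le\rho)$. - (A0) There is $b>0$ with $b<b_H$ such that $Y\le b$ almost surely on $\{\boldsymbol\chi\in\mathcal N_\chi\}$. - (A1) $\phi_\chi(\rho)>0$ for all $\rho>0$,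 and $\phi_\chi(\rho)\to0$ as $\rho\to0$. - (A2) For $\ell=1,2$ there are $k_\ell>0$ and $C$ with $|r_\ell(\chi_1)-r_\ell(\chi_2)|\le C\,d(\chi_1,\chi_2)^{k_\ell}$ for all $\chi_1,\chi_2\in\mathcal N_\chi$. - (A3) $K$ is measurable and $C\mathbf 1_{[0,1]}\le K\le C'\mathbf 1_{[0,1]}$ for some constants $0<C\le C'<\infty$. - (A4) $h_n\to0$ and $\log n/(n\phi_\chi(h_n))\to0$. - (A5) For every integer $m\ge2$, (a version of) $\mathbb E[Y^{-m}\mid\boldsymbol\chi=\cdot\,]$ is bounded on $\mathcal N_\chi$ by a finite constant, which may depend on $m$. **Theorem.** Under these assumptions $$|\hat r_n(\chi)-r(\chi)|=O\big(h_n^{k_1}\big)+O\big(h_n^{k_2}\big)+O\Big(\sqrt{\tfrac{\log n}{n\,\phi_\chi(h_n)}}\Big)\qquad\text{almost surely.}$$ That is, there is a non-random constant $c$ such that $\mathbf P$-almost surely, for all sufficiently large $n$, $|\hat r_n(\chi)-r(\chi)|\le c\big(h_n^{k_1}+h_n^{k_2}+\sqrt{\log n/(n\phi_\chi(h_n))}\big)$.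 -/

import Mathlib

open MeasureTheory ProbabilityTheory Filter Topology
open scoped ENNReal NNReal

noncomputable section

namespace LTRC

/-- Left endpoint of the support of a distribution function, `inf {y | 0 < W y}`, which may be
infinite. -/
def lowerEndpoint (W : ℝ → ℝ) : EReal :=
  sInf ((fun y : ℝ => (y : EReal)) '' {y | 0 < W y})

/-- Right endpoint of the support of a distribution function, `sup {y | W y < 1}`, which may be
infinite. -/
def upperEndpoint (W : ℝ → ℝ) : EReal :=
  sSup ((fun y : ℝ => (y : EReal)) '' {y | W y < 1})

section Population

variable {F Ω₀ : Type*} [MeasurableSpace F] [MeasurableSpace Ω₀]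

/-- Distribution function of a real random variable. -/
def distFun (P : Measure Ω₀) (V : Ω₀ → ℝ) : ℝ → ℝ := fun y => cdf (P.map V) y

/-- The possibly censored response `Z = min (Y, S)`. -/
def censored (Y S : Ω₀ → ℝ) : Ω₀ → ℝ := fun ω => min (Y ω) (S ω)

open Classical in
/-- The indicator `δ = 1_{Y ≤ S}` of non-censoring. -/
def uncensored (Y S : Ω₀ → ℝ) : Ω₀ → ℕ := fun ω => if Y ω ≤ S ω then 1 else 0

/-- The event `{Z ≥ T}` that a subject is not truncated. -/
def retained (Y T S : Ω₀ → ℝ) : Set Ω₀ := {ω | T ω ≤ censored Y S ω}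

/-- What is recorded about a retained subject: `(χ, Z, T, δ)`. -/
def record (X : Ω₀ → F) (Y T S : Ω₀ → ℝ) : Ω₀ → F × ℝ × ℝ × ℕ :=
  fun ω => (X ω, censored Y S ω, T ω, uncensored Y S ω)

/-- The left-truncated right-censored model for the covariate `X`, the response `Y`, the truncation
variable `T` and the censoring variable `S`. -/
structure IsModel (P : Measure Ω₀) (X : Ω₀ → F) (Y T S : Ω₀ → ℝ) : Prop where
  measurable_X : Measurable X
  measurable_Y : Measurable Y
  measurable_T : Measurable T
  measurable_S : Measurable S
  pos_Y : ∀ᵐ ω ∂P, 0 < Y ω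
  pos_S : ∀ᵐ ω ∂P, 0 < S ω
  continuous_Y : Continuous (distFun P Y)
  continuous_S : Continuous (distFun P S)
  /-- The distribution function of `T` is continuous to the right of the left endpoint of `Z`. -/
  continuousAt_T : ∀ y : ℝ, lowerEndpoint (distFun P (censored Y S)) < (y : EReal) →
    ContinuousAt (distFun P T) y
  indep_T_S : IndepFun T S P
  indep_TS_XY : IndepFun (fun ω => (T ω, S ω)) (fun ω => (X ω, Y ω)) P
  pos_retained : 0 < P (retained Y T S)
  lower_lt : lowerEndpoint (distFun P T) < lowerEndpoint (distFun P (censored Y S))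
  upper_le : upperEndpoint (distFun P T) ≤ upperEndpoint (distFun P (censored Y S))

/-- `g` is a version of the conditional moment `x ↦ E[Y⁻ᵐ | X = x]` of the (almost surely) positive
variable `Y`, in the sense of nonnegative extended-real conditional expectations: no integrability
of `Y⁻ᵐ` is presupposed. -/
def IsCondInvMoment (P : Measure Ω₀) (X : Ω₀ → F) (Y : Ω₀ → ℝ) (m : ℕ) (g : F → ℝ≥0∞) : Prop :=
  Measurable g ∧ ∀ B : Set F, MeasurableSet B →
    ∫⁻ ω in X ⁻¹' B, ENNReal.ofReal ((Y ω)⁻¹ ^ m) ∂P = ∫⁻ x in B, g x ∂(P.map X)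

end Population

/-- Small-ball probability `φ_x(ρ) = P(X ∈ B(x, ρ))`, with closed balls. -/
def smallBall {F Ω₀ : Type*} [PseudoMetricSpace F] [MeasurableSpace Ω₀]
    (P : Measure Ω₀) (X : Ω₀ → F) (x : F) (ρ : ℝ) : ℝ :=
  P.real (X ⁻¹' Metric.closedBall x ρ)

/-- The records form an i.i.d. sequence from the law of `(χ, Z, T, δ)` conditional on the event
`{Z ≥ T}`. -/
structure IsObservedSample {F Ω₀ Ω : Type*} [MeasurableSpace F] [MeasurableSpace Ω₀]
    [MeasurableSpace Ω] (P : Measure Ω₀) (X : Ω₀ → F) (Y T S : Ω₀ → ℝ)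
    (Q : Measure Ω) (obs : ℕ → Ω → F × ℝ × ℝ × ℕ) : Prop where
  indep : iIndepFun obs Q
  identDistrib : ∀ i, IdentDistrib (obs i) (record X Y T S) Q
    (ProbabilityTheory.cond P (retained Y T S))

section Estimator

/-! In this section `Z`, `T`, `δ` and `x` are the recorded values, and the sample consists of the
subjects with indices `0, …, n - 1`. -/

open Classical in
/-- `C_n(y) = n⁻¹ ∑ 1_{T_i ≤ y ≤ Z_i}`. -/
def empC (n : ℕ) (Z T : ℕ → ℝ) (y : ℝ) : ℝ :=
  (1 / (n : ℝ)) * ∑ i ∈ Finset.range n, (if T i ≤ y ∧ y ≤ Z i then (1 : ℝ) else 0)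

open Classical in
/-- The Lynden-Bell product-limit estimator `L_n(y) = ∏_{T_i > y} (1 - 1 / (n C_n(T_i)))`. -/
def lyndenBell (n : ℕ) (Z T : ℕ → ℝ) (y : ℝ) : ℝ :=
  ∏ i ∈ (Finset.range n).filter (fun i => y < T i), (1 - 1 / ((n : ℝ) * empC n Z T (T i)))

open Classical in
/-- The TJW product-limit estimator of the censoring distribution function,
`G_n(y) = 1 - ∏_{Z_i ≤ y} (1 - 1 / (n C_n(Z_i))) ^ (1 - δ_i)`. -/
def tjwG (n : ℕ) (Z T : ℕ → ℝ) (δ : ℕ → ℕ) (y : ℝ) : ℝ :=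
  1 - ∏ i ∈ (Finset.range n).filter (fun i => Z i ≤ y),
    (1 - 1 / ((n : ℝ) * empC n Z T (Z i))) ^ (1 - δ i)

/-- `∑ δ_i K(d(x₀, χ_i) / h) Z_i^{-ℓ} / (L_n(Z_i) (1 - G_n(Z_i)))`. -/
def weightedSum {F : Type*} [PseudoMetricSpace F] (K : ℝ → ℝ) (h : ℝ) (x₀ : F) (ℓ n : ℕ)
    (x : ℕ → F) (Z T : ℕ → ℝ) (δ : ℕ → ℕ) : ℝ :=
  ∑ i ∈ Finset.range n, ((δ i : ℝ) * K (dist x₀ (x i) / h) * (Z i)⁻¹ ^ ℓ) /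
    (lyndenBell n Z T (Z i) * (1 - tjwG n Z T δ (Z i)))

/-- The relative-error regression estimator computed from the first `n` records. -/
def estimator {F : Type*} [PseudoMetricSpace F] (K : ℝ → ℝ) (h : ℝ) (x₀ : F) (n : ℕ)
    (o : ℕ → F × ℝ × ℝ × ℕ) : ℝ :=
  weightedSum K h x₀ 1 n (fun i => (o i).1) (fun i => (o i).2.1) (fun i => (o i).2.2.1)
      (fun i => (o i).2.2.2) /
    weightedSum K h x₀ 2 n (fun i => (o i).1) (fun i => (o i).2.1) (fun i => (o i).2.2.1)
      (fun i => (o i).2.2.2)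

end Estimator

end LTRC

end

/-!
# Rate of a relative-error regression estimator under truncation and censoring

Write `L` and `G` for the distribution functions of `T` and `S`. Under the law of an observation, an
uncensored pair `(χ, Y) = (x, y)` has density `L(y) (1 - G(y)) / P(Z ≥ T)` relative to its
population law (`IsModel.lintegral_uncensored`). If the product-limit estimators in the weights were
replaced by `L` and `G`, the numerator and the denominator of the estimator, divided by the total
kernel mass, would therefore have means close to `r₁(x₀)` and `r₂(x₀)`, with a bias bounded through
Hölder continuity (`IsCondInvMoment.abs_toReal_sub_le`). Three facts make this a proof.

*Weights.* By assumption only responses in `[a, b]` matter, where `a` is the left endpoint of the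
law of `Z` and `b` is below the right one. Nothing is assumed that controls the Lynden-Bell
estimator near the right endpoint of the law of `T`, but the regression estimator is a ratio and
does not change when all weights are multiplied by a common factor. So `L_n(y)` may be replaced by
`L_n(y) / L_n(b)`, a product over truncation times in `(y, b]`, as soon as `L_n(b) ≠ 0`. This holds
eventually: `L_n(b) = 0` would require a truncation time `T_i > b` at which nobody else is at risk,
and by Borel–Cantelli there are finitely many subjects that start as such a hole, each of which is
covered later (`IsIID.ae_eventually_covered`). Up to sign and terms of second order, the logarithms
of `L_n(y) / L_n(b)` and of `1 - G_n(y)` are sums of reciprocal risk-set sizes. At the observations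
themselves, the risk-set proportions and the sums of their reciprocals are within `O(√(log n / n))`
of their means, by Bernstein's inequality conditionally on the evaluation point
(`IsIID.ae_eventually_kernel_average`), and the means are the cumulative hazards `log (L(b) / L(y))`
and `-log (1 - G(y))`, by transporting the laws of `T` and `S` to Lebesgue measure through their
distribution functions. The result is `IsModel.ae_eventually_weights`.

*Fluctuations.* The sums with the true weights are sums over `n` variables that live on the ball of
radius `h n`, with moments of all orders but no bound. Cut at the level `√(n φ(h n) / log n)`, they
obey Bernstein's inequality with deviation `O(√(n φ(h n) log n))`. What is cut off is at most
`√(log n / (n φ(h n)))` times a sum of squares, for which a crude bound `O(n φ(h n))` suffices; since the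
bandwidths need not be monotone, it is proved over dyadic blocks of sample sizes and small-ball
masses (`IsIID.ae_eventually_sum_le`, `IsIID.ae_eventually_abs_sum_sub_le`).

*Ratio.* `r₂(x₀) ≥ b⁻²` because `Y ≤ b` near `x₀` (`IsCondInvMoment.inv_pow_le`), so errors in the
numerator and in the denominator carry over to the ratio.
-/

namespace LTRC

/-! ### Exponential inequalities for i.i.d. sequences -/

/-- `o` is a sequence of independent measurable random elements with common law `μ`. -/
structure IsIID {Ω E : Type*} [MeasurableSpace Ω] [MeasurableSpace E] (Q : Measure Ω)
    (μ : Measure E) (o : ℕ → Ω → E) : Prop where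
  measurable : ∀ i, Measurable (o i)
  indep : iIndepFun o Q
  map_eq : ∀ i, Q.map (o i) = μ

/-- Borel–Cantelli for probabilities that are eventually bounded by a summable real sequence. -/
lemma ae_eventually_of_summable {Ω : Type*} [MeasurableSpace Ω] {Q : Measure Ω}
    [IsProbabilityMeasure Q] (p : ℕ → Ω → Prop) (u : ℕ → ℝ) (hu : Summable u)
    (h : ∀ᶠ n in atTop, Q {ω | ¬ p n ω} ≤ ENNReal.ofReal (u n)) :
    ∀ᵐ ω ∂Q, ∀ᶠ n in atTop, p n ω := by
  obtain ⟨n₀, hn₀⟩ := eventually_atTop.1 h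
  have h1 : ∑' n, Q {ω | ¬ p (n + n₀) ω} ≠ ∞ := by
    have h2 : Summable fun n => |u (n + n₀)| := ((summable_nat_add_iff n₀).2 hu).abs
    refine ne_top_of_le_ne_top ?_ (ENNReal.tsum_le_tsum fun n =>
      (hn₀ (n + n₀) (by omega)).trans (ENNReal.ofReal_le_ofReal (le_abs_self _)))
    rw [← ENNReal.ofReal_tsum_of_nonneg (fun _ => abs_nonneg _) h2]
    exact ENNReal.ofReal_ne_top
  filter_upwards [ae_eventually_notMem h1] with ω hω
  rw [eventually_atTop] at hω ⊢
  obtain ⟨a, ha⟩ := hω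
  refine ⟨a + n₀, fun n hn => ?_⟩
  have := ha (n - n₀) (by omega)
  rw [Nat.sub_add_cancel (by omega)] at this
  simpa using this

section IID

variable {Ω E : Type*} [MeasurableSpace Ω] [MeasurableSpace E] {Q : Measure Ω}
  {μ : Measure E} {o : ℕ → Ω → E}

lemma IsIID.lintegral_comp (ho : IsIID Q μ o) (i : ℕ) {f : E → ℝ≥0∞} (hf : Measurable f) :
    ∫⁻ ω, f (o i ω) ∂Q = ∫⁻ x, f x ∂μ := by
  rw [← ho.map_eq i, lintegral_map hf (ho.measurable i)]

lemma IsIID.measure_preimage (ho : IsIID Q μ o) (i : ℕ) {A : Set E} (hA : MeasurableSet A) :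
    Q (o i ⁻¹' A) = μ A := by
  rw [← ho.map_eq i, Measure.map_apply (ho.measurable i) hA]

lemma IsIID.ae_forall (ho : IsIID Q μ o) {p : E → Prop} (hp : ∀ᵐ x ∂μ, p x) :
    ∀ᵐ ω ∂Q, ∀ i, p (o i ω) := by
  rw [ae_all_iff]
  intro i
  rw [← ho.map_eq i] at hp
  exact ae_of_ae_map (ho.measurable i).aemeasurable hp

/-- Chernoff's bound for a sum of functions of an i.i.d. sequence. -/
lemma IsIID.chernoff (ho : IsIID Q μ o) (s : Finset ℕ) {f : E → ℝ} (hf : Measurable f)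
    {κ : ℝ} (t : ℝ)
    (hκ : ∫⁻ x, ENNReal.ofReal (Real.exp (f x)) ∂μ ≤ ENNReal.ofReal (Real.exp κ)) :
    Q {ω | t ≤ ∑ i ∈ s, f (o i ω)} ≤ ENNReal.ofReal (Real.exp (s.card * κ - t)) := by
  have hg : Measurable fun x => ENNReal.ofReal (Real.exp (f x)) := by fun_prop
  have h1 : ∫⁻ ω, ∏ i ∈ s, ENNReal.ofReal (Real.exp (f (o i ω))) ∂Q
      ≤ ENNReal.ofReal (Real.exp (s.card * κ)) := by
    rw [lintegral_prod_eq_prod_lintegral_of_indepFun s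
      (fun i ω => ENNReal.ofReal (Real.exp (f (o i ω)))) (ho.indep.comp _ fun _ => hg)
      (fun i => hg.comp (ho.measurable i))]
    calc ∏ i ∈ s, ∫⁻ ω, ENNReal.ofReal (Real.exp (f (o i ω))) ∂Q
        = ∏ _i ∈ s, ∫⁻ x, ENNReal.ofReal (Real.exp (f x)) ∂μ :=
          Finset.prod_congr rfl fun i _ => ho.lintegral_comp i hg
      _ ≤ ∏ _i ∈ s, ENNReal.ofReal (Real.exp κ) := Finset.prod_le_prod' fun _ _ => hκ
      _ = ENNReal.ofReal (Real.exp (s.card * κ)) := by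
          rw [Finset.prod_const, ← ENNReal.ofReal_pow (Real.exp_pos _).le, ← Real.exp_nat_mul]
  have h2 := meas_ge_le_lintegral_div (μ := Q)
    (f := fun ω => ∏ i ∈ s, ENNReal.ofReal (Real.exp (f (o i ω))))
    (Finset.measurable_prod _ fun i _ => hg.comp (ho.measurable i)).aemeasurable
    (ε := ENNReal.ofReal (Real.exp t)) (by simp [Real.exp_pos]) ENNReal.ofReal_ne_top
  have h3 : {ω | t ≤ ∑ i ∈ s, f (o i ω)} =
      {ω | ENNReal.ofReal (Real.exp t) ≤ ∏ i ∈ s, ENNReal.ofReal (Real.exp (f (o i ω)))} := by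
    ext ω
    simp only [Set.mem_ofPred_eq]
    rw [← ENNReal.ofReal_prod_of_nonneg (fun _ _ => (Real.exp_pos _).le), ← Real.exp_sum,
      ENNReal.ofReal_le_ofReal_iff (Real.exp_pos _).le, Real.exp_le_exp]
  rw [h3]
  refine h2.trans ?_
  rw [Real.exp_sub, ENNReal.ofReal_div_of_pos (Real.exp_pos _)]
  exact ENNReal.div_le_div_right h1 _

/-- The second-order bound on the moment generating function of a bounded variable, for small
parameters of either sign. -/
lemma lintegral_exp_le [IsProbabilityMeasure μ] {f : E → ℝ} (hf : Measurable f) {M v l : ℝ}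
    (hM : ∀ x, |f x| ≤ M) (hv : ∫ x, f x ^ 2 ∂μ ≤ v) (hl : |l| * M ≤ 1) :
    ∫⁻ x, ENNReal.ofReal (Real.exp (l * (f x - ∫ y, f y ∂μ))) ∂μ
      ≤ ENNReal.ofReal (Real.exp (l ^ 2 * v)) := by
  have hfi : Integrable f μ := Integrable.of_bound hf.aestronglyMeasurable M (ae_of_all _ hM)
  have hfi2 : Integrable (fun x => f x ^ 2) μ :=
    Integrable.of_bound (hf.pow_const 2).aestronglyMeasurable (M ^ 2) (ae_of_all _ fun x => by
      rw [Real.norm_eq_abs, abs_pow]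
      exact pow_le_pow_left₀ (abs_nonneg _) (hM x) 2)
  set m := ∫ y, f y ∂μ with hm
  have hpt : ∀ x, Real.exp (l * (f x - m)) ≤
      Real.exp (-(l * m)) * (1 + l * f x + l ^ 2 * f x ^ 2) := by
    intro x
    have h1 : |l * f x| ≤ 1 := by
      rw [abs_mul]
      exact (mul_le_mul_of_nonneg_left (hM x) (abs_nonneg _)).trans hl
    have h2 := (abs_le.1 (Real.abs_exp_sub_one_sub_id_le h1)).2
    rw [mul_sub, sub_eq_add_neg, add_comm, Real.exp_add]
    gcongr
    nlinarith
  have hint1 : Integrable (fun x => 1 + l * f x) μ := (integrable_const _).add (hfi.const_mul _)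
  have hint : Integrable (fun x => 1 + l * f x + l ^ 2 * f x ^ 2) μ :=
    hint1.add (hfi2.const_mul _)
  have hval : ∫ x, (1 + l * f x + l ^ 2 * f x ^ 2) ∂μ = 1 + l * m + l ^ 2 * ∫ x, f x ^ 2 ∂μ := by
    rw [integral_add hint1 (hfi2.const_mul _),
      integral_add (integrable_const _) (hfi.const_mul _), integral_const_mul, integral_const_mul]
    simp [hm]
  calc ∫⁻ x, ENNReal.ofReal (Real.exp (l * (f x - m))) ∂μ
      ≤ ∫⁻ x, ENNReal.ofReal (Real.exp (-(l * m)) * (1 + l * f x + l ^ 2 * f x ^ 2)) ∂μ :=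
        lintegral_mono fun x => ENNReal.ofReal_le_ofReal (hpt x)
    _ = ENNReal.ofReal (∫ x, Real.exp (-(l * m)) * (1 + l * f x + l ^ 2 * f x ^ 2) ∂μ) := by
        rw [ofReal_integral_eq_lintegral_ofReal (hint.const_mul _)]
        exact ae_of_all _ fun x => (Real.exp_pos _).le.trans (hpt x)
    _ ≤ ENNReal.ofReal (Real.exp (l ^ 2 * v)) := by
        apply ENNReal.ofReal_le_ofReal
        rw [integral_const_mul, hval]
        have h3 : 1 + l * m + l ^ 2 * ∫ x, f x ^ 2 ∂μ ≤ Real.exp (l * m + l ^ 2 * v) := by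
          have := Real.add_one_le_exp (l * m + l ^ 2 * v)
          have := mul_le_mul_of_nonneg_left hv (sq_nonneg l)
          linarith
        calc _ ≤ Real.exp (-(l * m)) * Real.exp (l * m + l ^ 2 * v) := by gcongr
          _ = _ := by rw [← Real.exp_add]; ring_nf

/-- A Bernstein inequality with a free parameter `l`, which has to be small compared with the
reciprocal of the bound of `f`. -/
lemma IsIID.bernstein [IsProbabilityMeasure μ] (ho : IsIID Q μ o) (s : Finset ℕ) {f : E → ℝ}
    (hf : Measurable f) {M v l : ℝ} (t : ℝ) (hM : ∀ x, |f x| ≤ M) (hv : ∫ x, f x ^ 2 ∂μ ≤ v)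
    (hl0 : 0 ≤ l) (hl : l * M ≤ 1) :
    Q {ω | l * t ≤ l * |∑ i ∈ s, f (o i ω) - s.card * ∫ x, f x ∂μ|}
      ≤ ENNReal.ofReal (2 * Real.exp (s.card * (l ^ 2 * v) - l * t)) := by
  set m := ∫ y, f y ∂μ with hm
  have key : ∀ σ : ℝ, |σ| = l → Q {ω | l * t ≤ ∑ i ∈ s, σ * (f (o i ω) - m)}
      ≤ ENNReal.ofReal (Real.exp (s.card * (l ^ 2 * v) - l * t)) := by
    intro σ hσ
    have h1 := lintegral_exp_le (μ := μ) hf hM hv (l := σ) (by rw [hσ]; exact hl)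
    rw [← sq_abs, hσ] at h1
    exact ho.chernoff s (f := fun x => σ * (f x - m)) (by fun_prop) (l * t) h1
  have hsub : {ω | l * t ≤ l * |∑ i ∈ s, f (o i ω) - s.card * m|} ⊆
      {ω | l * t ≤ ∑ i ∈ s, l * (f (o i ω) - m)} ∪
        {ω | l * t ≤ ∑ i ∈ s, (-l) * (f (o i ω) - m)} := by
    intro ω hω
    simp only [Set.mem_ofPred_eq, Set.mem_union] at hω ⊢
    rw [← Finset.mul_sum, ← Finset.mul_sum, Finset.sum_sub_distrib, Finset.sum_const, nsmul_eq_mul]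
    rcases abs_cases (∑ i ∈ s, f (o i ω) - s.card * m) with h | h
    · left; rw [h.1] at hω; exact hω
    · right; rw [h.1] at hω; linarith
  refine (measure_mono hsub).trans ((measure_union_le _ _).trans ?_)
  rw [two_mul, ENNReal.ofReal_add (Real.exp_pos _).le (Real.exp_pos _).le]
  exact add_le_add (key l (abs_of_nonneg hl0)) (key (-l) (by rw [abs_neg, abs_of_nonneg hl0]))

/-- Conditioning on one observation: the others keep their joint law. -/
lemma IsIID.measure_eq_lintegral [IsProbabilityMeasure Q] (ho : IsIID Q μ o) {j : ℕ}
    {s : Finset ℕ} (hj : j ∉ s) {A : Set (E × (s → E))} (hA : MeasurableSet A) :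
    Q {ω | (o j ω, fun i : s => o i ω) ∈ A} = ∫⁻ x, Q {ω | (x, fun i : s => o i ω) ∈ A} ∂μ := by
  have hW : Measurable fun ω => fun i : s => o i ω := measurable_pi_lambda _ fun i =>
    ho.measurable i
  have hind : IndepFun (o j) (fun ω => fun i : s => o i ω) Q := by
    have h := ho.indep.indepFun_finset {j} s (by simpa using hj) ho.measurable
    exact h.comp (φ := fun u : (({j} : Finset ℕ) → E) => u ⟨j, by simp⟩) (ψ := id)
      (measurable_pi_apply _) measurable_id
  have h2 := (indepFun_iff_map_prod_eq_prod_map_map (ho.measurable j).aemeasurable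
    hW.aemeasurable).1 hind
  have : IsProbabilityMeasure (Q.map fun ω => fun i : s => o i ω) :=
    Measure.isProbabilityMeasure_map hW.aemeasurable
  calc Q {ω | (o j ω, fun i : s => o i ω) ∈ A}
      = Q.map (fun ω => (o j ω, fun i : s => o i ω)) A := by
        rw [Measure.map_apply ((ho.measurable j).prodMk hW) hA]; rfl
    _ = ∫⁻ x, Q.map (fun ω => fun i : s => o i ω) (Prod.mk x ⁻¹' A) ∂μ := by
        rw [h2, Measure.prod_apply hA, ho.map_eq]
    _ = _ := by
        refine lintegral_congr fun x => ?_
        rw [Measure.map_apply hW (measurable_prodMk_left hA)]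
        rfl

end IID

/-! ### Averages evaluated at the observations themselves -/

section LeaveOneOut

variable {Ω E : Type*} [MeasurableSpace Ω] [MeasurableSpace E] {Q : Measure Ω}
  {μ : Measure E} {o : ℕ → Ω → E} [IsProbabilityMeasure Q] [IsProbabilityMeasure μ]

lemma tendsto_log_div_self : Tendsto (fun n : ℕ => Real.log n / n) atTop (𝓝 0) :=
  (Real.isLittleO_log_id_atTop.tendsto_div_nhds_zero).comp tendsto_natCast_atTop_atTop

lemma eventually_one_le_log : ∀ᶠ n : ℕ in atTop, 1 ≤ Real.log n :=
  (Real.tendsto_log_atTop.comp tendsto_natCast_atTop_atTop).eventually_ge_atTop 1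

/-- An average `n⁻¹ ∑ g (o j) (o i)` of a bounded kernel is within `O(√(log n / n))` of its
conditional mean given `o j`, uniformly over the evaluation points `o j`, `j < n`. Evaluating at the
observations instead of at arbitrary points makes a union bound over `n` events sufficient. -/
lemma IsIID.ae_eventually_kernel_average (ho : IsIID Q μ o) {g : E → E → ℝ}
    (hg : Measurable (Function.uncurry g)) {M : ℝ} (hM : ∀ x y, |g x y| ≤ M) :
    ∃ c : ℝ, ∀ᵐ ω ∂Q, ∀ᶠ n : ℕ in atTop, ∀ j < n,
      |∑ i ∈ Finset.range n, g (o j ω) (o i ω) - n * ∫ y, g (o j ω) y ∂μ|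
        ≤ c * √(n * Real.log n) := by
  have hM0 : 0 ≤ M := by
    obtain ⟨x⟩ : Nonempty E := nonempty_of_isProbabilityMeasure μ
    exact (abs_nonneg _).trans (hM x x)
  set G : E → ℝ := fun x => ∫ y, g x y ∂μ with hG
  have hGm : Measurable G := hg.stronglyMeasurable.integral_prod_right.measurable
  have hGM : ∀ x, |G x| ≤ M := by
    intro x
    have := norm_integral_le_of_norm_le_const (μ := μ) (f := g x) (C := M) (ae_of_all _ (hM x))
    simpa using this
  have hgx : ∀ x, Measurable (g x) := fun x => hg.comp measurable_prodMk_left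
  refine ⟨M ^ 2 + 3 + 2 * M, ae_eventually_of_summable _ (fun n : ℕ => 2 * (1 / (n : ℝ) ^ 2))
    ((Real.summable_one_div_nat_pow.2 one_lt_two).mul_left 2) ?_⟩
  have hsmall : ∀ᶠ n : ℕ in atTop, √(Real.log n / n) * M ≤ 1 := by
    have : Tendsto (fun n : ℕ => √(Real.log n / n) * M) atTop (𝓝 (√0 * M)) :=
      ((Real.continuous_sqrt.tendsto _).comp tendsto_log_div_self).mul_const M
    exact this.eventually (Iic_mem_nhds (by simp))
  filter_upwards [hsmall, eventually_one_le_log, eventually_ge_atTop 1] with n hn1 hn2 hn3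
  have hn0 : (0 : ℝ) < n := by exact_mod_cast hn3
  have hn1' : (1 : ℝ) ≤ n := by exact_mod_cast hn3
  -- `M² log n` is the variance term of Bernstein's bound and `3 log n` leaves `n⁻³`, which is still
  -- summable after the union bound over `n` evaluation points.
  set l := √(Real.log n / n) with hl
  set t := (M ^ 2 + 3) * √(n * Real.log n) with ht
  have hl2 : l ^ 2 = Real.log n / n := Real.sq_sqrt (by positivity)
  have hlt : l * t = (M ^ 2 + 3) * Real.log n := by
    have : l * √(n * Real.log n) = Real.log n := by
      rw [hl, ← Real.sqrt_mul (by positivity), show Real.log n / n * (n * Real.log n)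
        = Real.log n ^ 2 by field_simp, Real.sqrt_sq (by linarith)]
    rw [ht, mul_left_comm, this]
  have hlpos : 0 < l := Real.sqrt_pos.2 (by positivity)
  have hone : 1 ≤ √(n * Real.log n) := Real.one_le_sqrt.2 (by nlinarith)
  -- the probability that a fixed evaluation point is bad, by conditioning on it
  have key : ∀ j ∈ Finset.range n, Q {ω | l * t ≤ l * |∑ i ∈ (Finset.range n).erase j,
      g (o j ω) (o i ω) - ((n : ℝ) - 1) * G (o j ω)|}
      ≤ ENNReal.ofReal (2 * (1 / (n : ℝ) ^ 3)) := by
    intro j hj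
    have hcard : (((Finset.range n).erase j).card : ℝ) = n - 1 := by
      rw [Finset.card_erase_of_mem hj, Finset.card_range, Nat.cast_sub hn3]; simp
    set s := (Finset.range n).erase j with hs
    let A : Set (E × (s → E)) := {p | l * t ≤ l * |∑ i : s, g p.1 (p.2 i) - ((n : ℝ) - 1) * G p.1|}
    have hA : MeasurableSet A := by
      refine measurableSet_le measurable_const (Measurable.const_mul ?_ _)
      refine Measurable.abs (Measurable.sub ?_ ((hGm.comp measurable_fst).const_mul _))
      refine Finset.measurable_sum _ fun i _ => ?_
      exact hg.comp (measurable_fst.prodMk ((measurable_pi_apply i).comp measurable_snd))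
    have h1 := ho.measure_eq_lintegral (j := j) (s := s) (by simp [hs]) hA
    have h2 : ∀ ω x, ((x, fun i : s => o i ω) ∈ A ↔
        l * t ≤ l * |∑ i ∈ s, g x (o i ω) - ((n : ℝ) - 1) * G x|) := by
      intro ω x
      simp only [A, Set.mem_ofPred_eq]
      rw [Finset.sum_coe_sort s (fun i => g x (o i ω))]
    simp only [h2] at h1
    rw [h1]
    calc _ ≤ ∫⁻ _, ENNReal.ofReal (2 * (1 / (n : ℝ) ^ 3)) ∂μ := by
          refine lintegral_mono fun x => ?_
          have h3 := ho.bernstein s (hgx x) t (v := M ^ 2) (hM x) ?_ hlpos.le hn1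
          · rw [hcard] at h3
            refine h3.trans (ENNReal.ofReal_le_ofReal ?_)
            rw [hlt, hl2]
            have h4 : ((n : ℝ) - 1) * (Real.log n / n * M ^ 2) ≤ M ^ 2 * Real.log n := by
              rw [show ((n : ℝ) - 1) * (Real.log n / n * M ^ 2) =
                M ^ 2 * Real.log n - Real.log n / n * M ^ 2 by field_simp]
              have : 0 ≤ Real.log n / n * M ^ 2 := by positivity
              linarith
            have h5 : Real.exp (((n : ℝ) - 1) * (Real.log n / n * M ^ 2)
                - (M ^ 2 + 3) * Real.log n) ≤ Real.exp (-(3 * Real.log n)) :=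
              Real.exp_le_exp.2 (by linarith)
            have h6 : Real.exp (-(3 * Real.log n)) = 1 / (n : ℝ) ^ 3 := by
              rw [Real.exp_neg, show (3 : ℝ) * Real.log n = ((3 : ℕ) : ℝ) * Real.log n by norm_num,
                Real.exp_nat_mul, Real.exp_log hn0, one_div]
            rw [h6] at h5
            linarith
          · calc ∫ y, g x y ^ 2 ∂μ ≤ ∫ _, M ^ 2 ∂μ := by
                  refine integral_mono_of_nonneg (ae_of_all _ fun y => sq_nonneg _)
                    (integrable_const _) (ae_of_all _ fun y => ?_)
                  exact sq_le_sq' (abs_le.1 (hM x y)).1 (abs_le.1 (hM x y)).2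
              _ = M ^ 2 := by simp
      _ = _ := by simp
  have hsub : {ω | ¬ ∀ j < n, |∑ i ∈ Finset.range n, g (o j ω) (o i ω) - n * G (o j ω)|
      ≤ (M ^ 2 + 3 + 2 * M) * √(n * Real.log n)} ⊆ ⋃ j ∈ Finset.range n,
      {ω | l * t ≤ l * |∑ i ∈ (Finset.range n).erase j,
        g (o j ω) (o i ω) - ((n : ℝ) - 1) * G (o j ω)|} := by
    intro ω hω
    simp only [Set.mem_ofPred_eq, not_forall, not_le, Set.mem_iUnion] at hω ⊢
    obtain ⟨j, hj, h⟩ := hω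
    have hj' : j ∈ Finset.range n := Finset.mem_range.2 hj
    refine ⟨j, hj', mul_le_mul_of_nonneg_left ?_ hlpos.le⟩
    rw [← Finset.add_sum_erase _ _ hj'] at h
    set S := ∑ i ∈ (Finset.range n).erase j, g (o j ω) (o i ω)
    have h1 : |g (o j ω) (o j ω) + S - n * G (o j ω)| ≤
        |S - ((n : ℝ) - 1) * G (o j ω)| + |g (o j ω) (o j ω) - G (o j ω)| := by
      rw [show g (o j ω) (o j ω) + S - n * G (o j ω) = (S - ((n : ℝ) - 1) * G (o j ω)) +
        (g (o j ω) (o j ω) - G (o j ω)) by ring]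
      exact abs_add_le _ _
    have h2 : |g (o j ω) (o j ω) - G (o j ω)| ≤ 2 * M := by
      have := abs_sub (g (o j ω) (o j ω)) (G (o j ω))
      linarith [hM (o j ω) (o j ω), hGM (o j ω)]
    have h3 : 2 * M ≤ 2 * M * √(n * Real.log n) := le_mul_of_one_le_right (by linarith) hone
    rw [ht]
    linarith
  calc _ ≤ ∑ j ∈ Finset.range n, ENNReal.ofReal (2 * (1 / (n : ℝ) ^ 3)) :=
        (measure_mono hsub).trans ((measure_biUnion_finset_le _ _).trans (Finset.sum_le_sum key))
    _ = ENNReal.ofReal (2 * (1 / (n : ℝ) ^ 2)) := by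
        rw [Finset.sum_const, Finset.card_range, nsmul_eq_mul, ← ENNReal.ofReal_natCast,
          ← ENNReal.ofReal_mul hn0.le]
        congr 1
        field_simp

/-- If `1 / μ (V x)` is integrable over `A`, then almost surely, for all large `n`, each of the
first `n` observations that lies in `A` is covered by another one. The expected number of
observations in `A` which are not covered at their time of arrival by an earlier one is at most
`∫_A ∑ₙ (1 - μ (V x))ⁿ = ∫_A 1 / μ (V x)`, hence finite, and each single observation is covered
at some later time. -/
lemma IsIID.ae_eventually_covered (ho : IsIID Q μ o) {V : Set (E × E)} (hV : MeasurableSet V)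
    {A : Set E} (hA : MeasurableSet A)
    (hfin : ∫⁻ x in A, (μ (Prod.mk x ⁻¹' V))⁻¹ ∂μ ≠ ∞) :
    ∀ᵐ ω ∂Q, ∀ᶠ n : ℕ in atTop, ∀ i < n, o i ω ∈ A → ∃ j < n, j ≠ i ∧ (o i ω, o j ω) ∈ V := by
  set p : ℕ → ℝ≥0∞ := fun m => ∫⁻ x in A, (1 - μ (Prod.mk x ⁻¹' V)) ^ m ∂μ with hp
  have hVm : Measurable fun x => μ (Prod.mk x ⁻¹' V) := measurable_measure_prodMk_left hV
  have hpow : ∀ m : ℕ, Measurable fun x => (1 - μ (Prod.mk x ⁻¹' V)) ^ m := fun m =>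
    (measurable_const.sub hVm).pow_const m
  have hsum : ∑' m, p m ≠ ∞ := by
    simp only [hp]
    rw [← lintegral_tsum fun m => (hpow m).aemeasurable]
    simp_rw [ENNReal.tsum_geometric]
    convert hfin using 4 with x
    exact ENNReal.sub_sub_cancel ENNReal.one_ne_top prob_le_one
  have hprob : ∀ (i : ℕ) (s : Finset ℕ), i ∉ s →
      Q {ω | o i ω ∈ A ∧ ∀ j ∈ s, (o i ω, o j ω) ∉ V} = p s.card := by
    intro i s hi
    let B : Set (E × (s → E)) := Prod.fst ⁻¹' A ∩ ⋂ j : s, (fun q => (q.1, q.2 j)) ⁻¹' Vᶜ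
    have hB : MeasurableSet B := by
      refine (measurable_fst hA).inter (MeasurableSet.iInter fun j => ?_)
      exact (measurable_fst.prodMk ((measurable_pi_apply j).comp measurable_snd)) hV.compl
    have h1 := ho.measure_eq_lintegral hi hB
    have h2 : ∀ ω x, ((x, fun j : s => o j ω) ∈ B ↔ x ∈ A ∧ ∀ j ∈ s, (x, o j ω) ∉ V) := by
      intro ω x
      simp [B]
    simp only [h2] at h1
    rw [h1]
    simp only [hp]
    rw [← lintegral_indicator hA]
    refine lintegral_congr fun x => ?_
    by_cases hx : x ∈ A
    · rw [Set.indicator_of_mem hx]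
      have h3 : {ω | x ∈ A ∧ ∀ j ∈ s, (x, o j ω) ∉ V} =
          ⋂ j ∈ s, o j ⁻¹' (Prod.mk x ⁻¹' V)ᶜ := by
        ext ω; simp [hx]
      have hm := (measurable_prodMk_left (x := x) hV).compl
      rw [h3, ho.indep.measure_inter_preimage_eq_mul s (fun _ _ => hm)]
      rw [Finset.prod_congr rfl fun j _ => ho.measure_preimage j hm, Finset.prod_const,
        prob_compl_eq_one_sub (measurable_prodMk_left hV)]
    · rw [Set.indicator_of_notMem hx]; simp [hx]
  have hbirth : ∀ᵐ ω ∂Q, ∀ᶠ i : ℕ in atTop,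
      ω ∉ {ω | o i ω ∈ A ∧ ∀ j ∈ Finset.range i, (o i ω, o j ω) ∉ V} := by
    refine ae_eventually_notMem (ne_of_eq_of_ne ?_ hsum)
    exact tsum_congr fun i => by rw [hprob i _ (by simp), Finset.card_range]
  have hdeath : ∀ᵐ ω ∂Q, ∀ i : ℕ,
      ω ∉ ⋂ n : ℕ, {ω | o i ω ∈ A ∧ ∀ j ∈ (Finset.range (n + 1)).erase i, (o i ω, o j ω) ∉ V} := by
    rw [ae_all_iff]
    intro i
    have h0 : Tendsto p atTop (𝓝 0) := ENNReal.tendsto_atTop_zero_of_tsum_ne_top hsum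
    rw [← measure_eq_zero_iff_ae_notMem]
    refine le_antisymm (ge_of_tendsto h0 ?_) zero_le
    filter_upwards [eventually_ge_atTop i] with n hn
    refine (measure_mono (Set.iInter_subset _ n)).trans ?_
    rw [hprob i _ (by simp), Finset.card_erase_of_mem (by simp; omega), Finset.card_range]
    simp
  filter_upwards [hbirth, hdeath] with ω h1 h2
  obtain ⟨i₀, hi₀⟩ := eventually_atTop.1 h1
  have h3 : ∀ i, ∀ᶠ n : ℕ in atTop, o i ω ∈ A → ∃ j < n, j ≠ i ∧ (o i ω, o j ω) ∈ V := by
    intro i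
    have := h2 i
    simp only [Set.mem_iInter, Set.mem_ofPred_eq, not_forall, not_and, Finset.mem_erase,
      Finset.mem_range, exists_prop, not_not] at this
    obtain ⟨n, hn⟩ := this
    filter_upwards [eventually_ge_atTop (n + 1)] with m hm hA
    obtain ⟨j, ⟨hj1, hj2⟩, hj3⟩ := hn hA
    exact ⟨j, by omega, hj1, hj3⟩
  have h4 : ∀ᶠ n : ℕ in atTop, ∀ i ∈ Finset.range i₀,
      o i ω ∈ A → ∃ j < n, j ≠ i ∧ (o i ω, o j ω) ∈ V :=
    (Filter.eventually_all_finset _).2 fun i _ => h3 i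
  filter_upwards [h4] with n hn i hi hA
  by_cases hii : i < i₀
  · exact hn i (Finset.mem_range.2 hii) hA
  · have := hi₀ i (by omega)
    simp only [not_and, not_forall, Finset.mem_range, not_not, exists_prop] at this
    obtain ⟨j, hj, hj2⟩ := this hA
    exact ⟨j, by omega, by omega, hj2⟩

end LeaveOneOut

/-! ### Sums over shrinking sets -/

/-- If a measure on the line is dominated by a multiple `C φ` of a monotone function on half-lines,
then it is dominated by `C u` on the sublevel set `{φ ≤ u}`; continuity of `φ` is not
needed, because a compact part of the sublevel set lies in the half-line ending at its largest
element. -/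
lemma measure_sublevel_le {ν : Measure ℝ} [IsFiniteMeasure ν] {φ : ℝ → ℝ} (hφ : Monotone φ)
    {C : ℝ} (hC : 0 ≤ C) (hν : ∀ s, ν (Set.Iic s) ≤ ENNReal.ofReal (C * φ s)) (u : ℝ) :
    ν {s | φ s ≤ u} ≤ ENNReal.ofReal (C * u) := by
  by_contra! hlt
  obtain ⟨K, hKs, hK, hlt⟩ := MeasurableSet.exists_lt_isCompact
    (measurableSet_le hφ.measurable measurable_const) hlt
  rcases K.eq_empty_or_nonempty with rfl | hne
  · simp at hlt
  · obtain ⟨m, hmK, hm⟩ := hK.exists_isGreatest hne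
    refine absurd hlt (not_lt.2 ?_)
    calc ν K ≤ ν (Set.Iic m) := measure_mono hm
      _ ≤ ENNReal.ofReal (C * φ m) := hν m
      _ ≤ ENNReal.ofReal (C * u) :=
        ENNReal.ofReal_le_ofReal (mul_le_mul_of_nonneg_left (hKs hmK) hC)

section Shrinking

variable {Ω E : Type*} [MeasurableSpace Ω] [MeasurableSpace E] {Q : Measure Ω}
  {μ : Measure E} {o : ℕ → Ω → E}

/-- Bounds of moments on the sets `{ρ ≤ s}` by the value of `φ` at `s` become bounds on the level
sets of `φ ∘ ρ` by the level itself. -/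
lemma lintegral_sublevel_le {W ρ : E → ℝ} (hρ : Measurable ρ) {φ : ℝ → ℝ}
    (hφ : Monotone φ) (hφ1 : ∀ s, φ s ≤ 1) {C : ℝ} (hC : 0 ≤ C)
    (h : ∀ s, ∫⁻ x in {x | ρ x ≤ s}, ENNReal.ofReal (W x) ∂μ ≤ ENNReal.ofReal (C * φ s)) (u : ℝ) :
    ∫⁻ x in {x | φ (ρ x) ≤ u}, ENNReal.ofReal (W x) ∂μ ≤ ENNReal.ofReal (C * u) := by
  set ν := (μ.withDensity fun x => ENNReal.ofReal (W x)).map ρ with hν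
  have hval : ∀ B : Set ℝ, MeasurableSet B →
      ν B = ∫⁻ x in ρ ⁻¹' B, ENNReal.ofReal (W x) ∂μ := by
    intro B hB
    rw [hν, Measure.map_apply hρ hB, withDensity_apply _ (hρ hB)]
  have hIic : ∀ s, ν (Set.Iic s) ≤ ENNReal.ofReal (C * φ s) := fun s => by
    rw [hval _ measurableSet_Iic]; exact h s
  have hfin : IsFiniteMeasure ν := by
    refine ⟨lt_of_le_of_lt (le_of_tendsto (tendsto_measure_Iic_atTop ν) (Eventually.of_forall
      fun s => (hIic s).trans (ENNReal.ofReal_le_ofReal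
        (mul_le_mul_of_nonneg_left (hφ1 s) hC)))) ENNReal.ofReal_lt_top⟩
  have := measure_sublevel_le hφ hC hIic u
  rwa [hval _ (measurableSet_le hφ.measurable measurable_const)] at this

/-- A polynomial tail bound for sums of nonnegative variables with small first and eighth
moments: the summands are cut at the square root of the scale `n * u` of the sum. -/
lemma IsIID.measure_le_sum_le (ho : IsIID Q μ o) [IsProbabilityMeasure μ] (n : ℕ) {f : E → ℝ}
    (hf : Measurable f)
    (hf0 : ∀ x, 0 ≤ f x) {C u : ℝ} (hC : 0 ≤ C) (hu : 0 < n * u)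
    (h1 : ∫⁻ x, ENNReal.ofReal (f x) ∂μ ≤ ENNReal.ofReal (C * u))
    (h8 : ∫⁻ x, ENNReal.ofReal (f x ^ 8) ∂μ ≤ ENNReal.ofReal (C * u)) :
    Q {ω | (2 * C + 1) * (n * u) ≤ ∑ i ∈ Finset.range n, f (o i ω)}
      ≤ ENNReal.ofReal ((C + 720) * (1 / (n * u) ^ 3)) := by
  have hn : (0 : ℝ) < n := by
    rcases Nat.eq_zero_or_pos n with rfl | h
    · simp at hu
    · exact_mod_cast h
  have hu0 : 0 < u := (mul_pos_iff_of_pos_left hn).1 hu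
  set a := n * u with ha
  set v := √a with hv
  have hv0 : 0 < v := Real.sqrt_pos.2 hu
  have hv2 : v ^ 2 = a := Real.sq_sqrt hu.le
  have hv6 : v ^ 6 = a ^ 3 := by rw [← hv2]; ring
  have hv8 : v ^ 8 = a ^ 4 := by rw [← hv2]; ring
  -- a single summand exceeds `v`
  have hbig : ∀ i ∈ Finset.range n, Q {ω | v ≤ f (o i ω)} ≤ ENNReal.ofReal (C * u / a ^ 4) := by
    intro i _
    have hA : MeasurableSet {x | v ≤ f x} := measurableSet_le measurable_const hf
    calc Q {ω | v ≤ f (o i ω)} = μ {x | v ≤ f x} := ho.measure_preimage i hA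
      _ ≤ μ {x | ENNReal.ofReal (v ^ 8) ≤ ENNReal.ofReal (f x ^ 8)} :=
          measure_mono fun x (hx : v ≤ f x) =>
            ENNReal.ofReal_le_ofReal (pow_le_pow_left₀ hv0.le hx 8)
      _ ≤ (∫⁻ x, ENNReal.ofReal (f x ^ 8) ∂μ) / ENNReal.ofReal (v ^ 8) :=
          meas_ge_le_lintegral_div (by fun_prop)
            (ENNReal.ofReal_pos.2 (by positivity)).ne' ENNReal.ofReal_ne_top
      _ ≤ ENNReal.ofReal (C * u) / ENNReal.ofReal (v ^ 8) := ENNReal.div_le_div_right h8 _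
      _ = ENNReal.ofReal (C * u / a ^ 4) := by
          rw [hv8, ENNReal.ofReal_div_of_pos (by positivity)]
  -- the sum of the summands cut at `v` is large
  have hcut : Q {ω | (2 * C + 1) * v ≤ ∑ i ∈ Finset.range n, min (f (o i ω)) v / v}
      ≤ ENNReal.ofReal (720 / a ^ 3) := by
    have hκ : ∫⁻ x, ENNReal.ofReal (Real.exp (min (f x) v / v)) ∂μ
        ≤ ENNReal.ofReal (Real.exp (2 * C * u / v)) := by
      calc ∫⁻ x, ENNReal.ofReal (Real.exp (min (f x) v / v)) ∂μ
          ≤ ∫⁻ x, (1 + ENNReal.ofReal (2 / v) * ENNReal.ofReal (f x)) ∂μ := by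
            refine lintegral_mono fun x => ?_
            rw [← ENNReal.ofReal_mul (by positivity), ← ENNReal.ofReal_one,
              ← ENNReal.ofReal_add zero_le_one (mul_nonneg (by positivity) (hf0 x))]
            apply ENNReal.ofReal_le_ofReal
            have hy0 : 0 ≤ min (f x) v / v := div_nonneg (le_min (hf0 x) hv0.le) hv0.le
            have hy1 : min (f x) v / v ≤ 1 := (div_le_one hv0).2 (min_le_right _ _)
            have hy2 : min (f x) v / v ≤ f x / v := by gcongr; exact min_le_left _ _
            have h3 := (abs_le.1 (Real.abs_exp_sub_one_sub_id_le
              (abs_le.2 ⟨by linarith, hy1⟩))).2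
            rw [div_mul_eq_mul_div, mul_div_assoc]
            nlinarith
        _ = 1 + ENNReal.ofReal (2 / v) * ∫⁻ x, ENNReal.ofReal (f x) ∂μ := by
            rw [lintegral_add_left measurable_const, lintegral_const_mul _ (by fun_prop)]
            simp
        _ ≤ 1 + ENNReal.ofReal (2 / v) * ENNReal.ofReal (C * u) := by gcongr
        _ = ENNReal.ofReal (2 * C * u / v + 1) := by
            rw [← ENNReal.ofReal_mul (by positivity), add_comm,
              ENNReal.ofReal_add (by positivity) zero_le_one, ENNReal.ofReal_one]
            congr 2
            ring
        _ ≤ _ := ENNReal.ofReal_le_ofReal (Real.add_one_le_exp _)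
    refine (ho.chernoff (Finset.range n) (f := fun x => min (f x) v / v) (by fun_prop) _ hκ).trans
      (ENNReal.ofReal_le_ofReal ?_)
    have h4 : (((Finset.range n).card : ℝ) * (2 * C * u / v) - (2 * C + 1) * v) = -v := by
      rw [Finset.card_range, show (n : ℝ) * (2 * C * u / v) = 2 * C * (n * u) / v by ring, ← ha,
        ← hv2]
      field_simp
      ring
    rw [h4, Real.exp_neg, ← hv6, show (720 : ℝ) / v ^ 6 = (v ^ 6 / 720)⁻¹ by rw [inv_div]]
    refine inv_anti₀ (by positivity) ?_
    have := Real.pow_div_factorial_le_exp v hv0.le 6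
    norm_num [Nat.factorial] at this
    exact this
  have hsub : {ω | (2 * C + 1) * a ≤ ∑ i ∈ Finset.range n, f (o i ω)} ⊆
      (⋃ i ∈ Finset.range n, {ω | v ≤ f (o i ω)}) ∪
        {ω | (2 * C + 1) * v ≤ ∑ i ∈ Finset.range n, min (f (o i ω)) v / v} := by
    intro ω hω
    by_cases hb : ∃ i ∈ Finset.range n, v ≤ f (o i ω)
    · left; simpa using hb
    · right
      push Not at hb
      simp only [Set.mem_ofPred_eq] at hω ⊢
      rw [Finset.sum_congr rfl fun i hi => by rw [min_eq_left (hb i hi).le], ← Finset.sum_div,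
        le_div_iff₀ hv0, mul_assoc, ← sq, hv2]
      exact hω
  calc _ ≤ ∑ i ∈ Finset.range n, ENNReal.ofReal (C * u / a ^ 4) + ENNReal.ofReal (720 / a ^ 3) :=
        (measure_mono hsub).trans ((measure_union_le _ _).trans (add_le_add
          ((measure_biUnion_finset_le _ _).trans (Finset.sum_le_sum hbig)) hcut))
    _ = ENNReal.ofReal ((C + 720) * (1 / a ^ 3)) := by
        rw [Finset.sum_const, Finset.card_range, nsmul_eq_mul, ← ENNReal.ofReal_natCast,
          ← ENNReal.ofReal_mul hn.le, ← ENNReal.ofReal_add (by positivity) (by positivity)]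
        congr 1
        rw [ha]
        field_simp

variable [IsProbabilityMeasure Q] [IsProbabilityMeasure μ]

/-- Sums over the dyadic blocks given by the sample size `2 ^ k` and the mass `2 ^ (-j)`, as long
as their scale `2 ^ (k - j)` is at least `k`: then each of the at most `k + 1` blocks of sample
size `2 ^ k` fails with probability `O(k⁻³)`. -/
lemma IsIID.ae_eventually_dyadic_sum_le (ho : IsIID Q μ o) {W ρ : E → ℝ} (hW : Measurable W)
    (hW0 : ∀ x, 0 ≤ W x) (hρ : Measurable ρ) {φ : ℝ → ℝ} (hφ : Monotone φ) (hφ1 : ∀ s, φ s ≤ 1)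
    {C : ℝ} (hC : 0 ≤ C)
    (h1 : ∀ s, ∫⁻ x in {x | ρ x ≤ s}, ENNReal.ofReal (W x) ∂μ ≤ ENNReal.ofReal (C * φ s))
    (h8 : ∀ s, ∫⁻ x in {x | ρ x ≤ s}, ENNReal.ofReal (W x ^ 8) ∂μ ≤ ENNReal.ofReal (C * φ s)) :
    ∀ᵐ ω ∂Q, ∀ᶠ k : ℕ in atTop, ∀ j ≤ k, (k : ℝ) ≤ ((2 ^ k : ℕ) : ℝ) * (1 / 2) ^ j →
      ∑ i ∈ Finset.range (2 ^ k), {x | φ (ρ x) ≤ (1 / 2) ^ j}.indicator W (o i ω) <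
        (2 * C + 1) * (((2 ^ k : ℕ) : ℝ) * (1 / 2) ^ j) := by
  set B : ℕ → Set E := fun j => {x | φ (ρ x) ≤ (1 / 2) ^ j} with hB
  have hBm : ∀ j, MeasurableSet (B j) := fun j =>
    measurableSet_le (hφ.measurable.comp hρ) measurable_const
  have hind0 : ∀ (A : Set E) x, 0 ≤ A.indicator W x := fun A x =>
    Set.indicator_nonneg (fun _ _ => hW0 _) x
  set bad : ℕ → ℕ → Set Ω := fun k j => {ω | (2 * C + 1) * (((2 ^ k : ℕ) : ℝ) * (1 / 2) ^ j) ≤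
    ∑ i ∈ Finset.range (2 ^ k), (B j).indicator W (o i ω)} with hbad
  have hblock : ∀ᵐ ω ∂Q, ∀ᶠ k : ℕ in atTop,
      ∀ j ∈ (Finset.range (k + 1)).filter (fun j => (k : ℝ) ≤ ((2 ^ k : ℕ) : ℝ) * (1 / 2) ^ j),
        ω ∉ bad k j := by
    refine ae_eventually_of_summable _ (fun k : ℕ => 2 * (C + 720) * (1 / (k : ℝ) ^ 2))
      ((Real.summable_one_div_nat_pow.2 one_lt_two).mul_left _) ?_
    filter_upwards [eventually_ge_atTop 1] with k hk
    have hk0 : (1 : ℝ) ≤ k := by exact_mod_cast hk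
    set J := (Finset.range (k + 1)).filter (fun j => (k : ℝ) ≤ ((2 ^ k : ℕ) : ℝ) * (1 / 2) ^ j)
      with hJ
    have hsub : {ω | ¬ ∀ j ∈ J, ω ∉ bad k j} ⊆ ⋃ j ∈ J, bad k j := by
      intro ω hω
      simpa using hω
    have hone : ∀ j ∈ J, Q (bad k j) ≤ ENNReal.ofReal ((C + 720) * (1 / (k : ℝ) ^ 3)) := by
      intro j hj
      have hjk := (Finset.mem_filter.1 hj).2
      refine (ho.measure_le_sum_le (2 ^ k) (hW.indicator (hBm j)) (hind0 _) hC (by positivity)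
        ?_ ?_).trans (ENNReal.ofReal_le_ofReal ?_)
      · have := lintegral_sublevel_le hρ hφ hφ1 hC h1 ((1 / 2) ^ j)
        rw [← lintegral_indicator (hBm j)] at this
        refine le_of_eq_of_le (lintegral_congr fun x => ?_) this
        by_cases hx : x ∈ B j
        · rw [Set.indicator_of_mem hx, Set.indicator_of_mem hx]
        · rw [Set.indicator_of_notMem hx, Set.indicator_of_notMem hx, ENNReal.ofReal_zero]
      · have := lintegral_sublevel_le (W := fun x => W x ^ 8) hρ hφ hφ1 hC h8 ((1 / 2) ^ j)
        rw [← lintegral_indicator (hBm j)] at this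
        refine le_of_eq_of_le (lintegral_congr fun x => ?_) this
        by_cases hx : x ∈ B j
        · rw [Set.indicator_of_mem hx, Set.indicator_of_mem hx]
        · rw [Set.indicator_of_notMem hx, Set.indicator_of_notMem hx]; simp
      · gcongr
    calc _ ≤ ∑ j ∈ J, ENNReal.ofReal ((C + 720) * (1 / (k : ℝ) ^ 3)) :=
          (measure_mono hsub).trans ((measure_biUnion_finset_le _ _).trans
            (Finset.sum_le_sum hone))
      _ ≤ ENNReal.ofReal (2 * (C + 720) * (1 / (k : ℝ) ^ 2)) := by
          rw [Finset.sum_const, nsmul_eq_mul, ← ENNReal.ofReal_natCast,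
            ← ENNReal.ofReal_mul (Nat.cast_nonneg _)]
          apply ENNReal.ofReal_le_ofReal
          have hcard : (J.card : ℝ) ≤ k + 1 := by
            have h3 : J.card ≤ (Finset.range (k + 1)).card := Finset.card_filter_le _ _
            rw [Finset.card_range] at h3
            exact_mod_cast h3
          calc (J.card : ℝ) * ((C + 720) * (1 / (k : ℝ) ^ 3))
              ≤ (2 * k) * ((C + 720) * (1 / (k : ℝ) ^ 3)) := by gcongr; linarith
            _ = _ := by field_simp
  filter_upwards [hblock] with ω hω
  filter_upwards [hω] with k hk j hj hjk
  exact not_le.1 (hk j (Finset.mem_filter.2 ⟨Finset.mem_range.2 (by omega), hjk⟩))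

/-- A crude almost sure upper bound, of the right order, for sums over the shrinking sets
`{ρ ≤ h n}`. The bandwidths need not be monotone; all of them are dominated simultaneously by
dyadic blocks, in the sample size `2 ^ k` and in the mass `2 ^ (-j)` of the set. -/
lemma IsIID.ae_eventually_sum_le (ho : IsIID Q μ o) {W ρ : E → ℝ} (hW : Measurable W)
    (hW0 : ∀ x, 0 ≤ W x) (hρ : Measurable ρ) {φ : ℝ → ℝ} (hφ : Monotone φ) (hφ1 : ∀ s, φ s ≤ 1)
    {C : ℝ} (hC : 0 ≤ C)
    (h1 : ∀ s, ∫⁻ x in {x | ρ x ≤ s}, ENNReal.ofReal (W x) ∂μ ≤ ENNReal.ofReal (C * φ s))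
    (h8 : ∀ s, ∫⁻ x in {x | ρ x ≤ s}, ENNReal.ofReal (W x ^ 8) ∂μ ≤ ENNReal.ofReal (C * φ s))
    {h : ℕ → ℝ} (hpos : ∀ n, 0 < φ (h n))
    (hrate : Tendsto (fun n : ℕ => Real.log n / (n * φ (h n))) atTop (𝓝 0)) :
    ∃ c : ℝ, ∀ᵐ ω ∂Q, ∀ᶠ n : ℕ in atTop,
      ∑ i ∈ Finset.range n, {x | ρ x ≤ h n}.indicator W (o i ω) ≤ c * (n * φ (h n)) := by
  refine ⟨(2 * C + 1) * 4, ?_⟩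
  have hklim : Tendsto (fun n : ℕ => Nat.log 2 n + 1) atTop atTop := by
    refine tendsto_atTop.2 fun m => ?_
    filter_upwards [eventually_ge_atTop (2 ^ m)] with n hn
    exact (Nat.le_log_of_pow_le (by norm_num) hn).trans (Nat.le_succ _)
  filter_upwards [ho.ae_eventually_dyadic_sum_le hW hW0 hρ hφ hφ1 hC h1 h8] with ω hω
  filter_upwards [hklim.eventually hω, hrate.eventually (gt_mem_nhds (show (0 : ℝ) < 1 / 4 by
    norm_num)), eventually_one_le_log, eventually_ge_atTop 1] with n hn hr hlog hn1
  have hn0 : (0 : ℝ) < n := by exact_mod_cast hn1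
  set k := Nat.log 2 n + 1 with hk
  have hk1 : n < 2 ^ k := Nat.lt_pow_succ_log_self (by norm_num) n
  have hk2 : 2 ^ k ≤ 2 * n := by
    rw [hk, pow_succ, mul_comm]
    exact Nat.mul_le_mul_left _ (Nat.pow_log_le_self 2 (by omega))
  obtain ⟨j, hj1, hj2⟩ := exists_nat_pow_near_of_lt_one (hpos n) (hφ1 _)
    (show (0 : ℝ) < 1 / 2 by norm_num) (by norm_num)
  have hk1' : (n : ℝ) ≤ ((2 ^ k : ℕ) : ℝ) := by exact_mod_cast hk1.le
  have hk2' : ((2 ^ k : ℕ) : ℝ) ≤ 2 * n := by exact_mod_cast hk2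
  have hφ0 := (hpos n).le
  have ha1 : n * φ (h n) ≤ ((2 ^ k : ℕ) : ℝ) * (1 / 2) ^ j := by gcongr
  have ha2 : ((2 ^ k : ℕ) : ℝ) * (1 / 2) ^ j ≤ 4 * (n * φ (h n)) := by
    have : (1 / 2 : ℝ) ^ j ≤ 2 * φ (h n) := by rw [pow_succ] at hj1; linarith
    calc ((2 ^ k : ℕ) : ℝ) * (1 / 2) ^ j ≤ (2 * n) * (2 * φ (h n)) := by gcongr
      _ = _ := by ring
  -- the block is large enough because `log n` is small compared with `n φ(h n)`
  have hka : (k : ℝ) ≤ ((2 ^ k : ℕ) : ℝ) * (1 / 2) ^ j := by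
    refine le_trans ?_ ha1
    rw [div_lt_iff₀ (mul_pos hn0 (hpos n))] at hr
    have h2 : ((k : ℝ) - 1) * Real.log 2 ≤ Real.log n := by
      have h3 : ((2 ^ (k - 1) : ℕ) : ℝ) ≤ n := by
        exact_mod_cast (by simpa [hk] using Nat.pow_log_le_self 2 (by omega : n ≠ 0))
      have h4 := Real.log_le_log (by positivity) h3
      rw [Nat.cast_pow, Real.log_pow, Nat.cast_sub (by omega)] at h4
      exact_mod_cast h4
    have h5 : (1 : ℝ) ≤ k := by exact_mod_cast (by omega : 1 ≤ k)
    have h6 := Real.log_two_gt_d9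
    nlinarith
  have hjk : j ≤ k := by
    by_contra! hkj
    have h5 : (1 : ℝ) ≤ k := by exact_mod_cast (by omega : 1 ≤ k)
    have h6 : ((2 ^ k : ℕ) : ℝ) * (1 / 2) ^ j ≤ ((2 ^ k : ℕ) : ℝ) * (1 / 2) ^ (k + 1) := by
      gcongr ?_ * ?_
      exact pow_le_pow_of_le_one (by norm_num) (by norm_num) (by omega)
    have h7 : ((2 ^ k : ℕ) : ℝ) * (1 / 2) ^ (k + 1) = 1 / 2 := by
      rw [Nat.cast_pow, Nat.cast_ofNat, pow_succ (1 / 2 : ℝ), ← mul_assoc, ← mul_pow]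
      norm_num
    linarith
  have hgood := hn j hjk hka
  calc ∑ i ∈ Finset.range n, {x | ρ x ≤ h n}.indicator W (o i ω)
      ≤ ∑ i ∈ Finset.range n, {x | φ (ρ x) ≤ (1 / 2) ^ j}.indicator W (o i ω) := by
        refine Finset.sum_le_sum fun i _ => Set.indicator_le_indicator_of_subset ?_ hW0 _
        exact fun x (hx : ρ x ≤ h n) => (hφ hx).trans hj2
    _ ≤ ∑ i ∈ Finset.range (2 ^ k), {x | φ (ρ x) ≤ (1 / 2) ^ j}.indicator W (o i ω) :=
        Finset.sum_le_sum_of_subset_of_nonneg (Finset.range_mono hk1.le)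
          fun _ _ _ => Set.indicator_nonneg (fun _ _ => hW0 _) _
    _ ≤ (2 * C + 1) * (((2 ^ k : ℕ) : ℝ) * (1 / 2) ^ j) := hgood.le
    _ ≤ (2 * C + 1) * (4 * (n * φ (h n))) := by gcongr
    _ = _ := by ring

/-- Sums of variables that live on the shrinking sets `{ρ ≤ h n}`, with an envelope `G` of which
only the moments of orders 2 and 16 on these sets are controlled, are within
`O(√(n φ(h n) log n))` of their means almost surely. The variables are cut at the level
`√(n φ(h n) / log n)`, which Bernstein's inequality tolerates. An exponential inequality is not
available for the part above this level, but it is at most `√(log n / (n φ(h n))) ∑ G²`, so that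
a crude bound of the sum of `G²` takes care of it. -/
lemma IsIID.ae_eventually_abs_sum_sub_le (ho : IsIID Q μ o) {f : ℕ → E → ℝ}
    (hf : ∀ n, Measurable (f n)) (hf0 : ∀ n x, 0 ≤ f n x) {G ρ : E → ℝ} (hG : Measurable G)
    (hρ : Measurable ρ) {φ : ℝ → ℝ} (hφ : Monotone φ) (hφ1 : ∀ s, φ s ≤ 1)
    {C : ℝ} (hC : 0 ≤ C)
    (h2 : ∀ s, ∫⁻ x in {x | ρ x ≤ s}, ENNReal.ofReal (G x ^ 2) ∂μ ≤ ENNReal.ofReal (C * φ s))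
    (h16 : ∀ s, ∫⁻ x in {x | ρ x ≤ s}, ENNReal.ofReal (G x ^ 16) ∂μ ≤ ENNReal.ofReal (C * φ s))
    {h : ℕ → ℝ} (hfG : ∀ n x, f n x ≤ {x | ρ x ≤ h n}.indicator G x) (hpos : ∀ n, 0 < φ (h n))
    (hrate : Tendsto (fun n : ℕ => Real.log n / (n * φ (h n))) atTop (𝓝 0)) :
    ∃ c : ℝ, ∀ᵐ ω ∂Q, ∀ᶠ n : ℕ in atTop,
      |∑ i ∈ Finset.range n, f n (o i ω) - n * ∫ x, f n x ∂μ|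
        ≤ c * √(n * φ (h n) * Real.log n) := by
  obtain ⟨c, hc⟩ := ho.ae_eventually_sum_le (W := fun x => G x ^ 2) (hG.pow_const 2)
    (fun x => sq_nonneg _) hρ hφ hφ1 hC h2 (by simpa only [← pow_mul] using h16) hpos hrate
  have hset : ∀ n, MeasurableSet {x | ρ x ≤ h n} := fun n => measurableSet_le hρ measurable_const
  have hf2 : ∀ n x, f n x ^ 2 ≤ {x | ρ x ≤ h n}.indicator (fun x => G x ^ 2) x := by
    intro n x
    have := hfG n x
    by_cases hx : x ∈ {x | ρ x ≤ h n}
    · rw [Set.indicator_of_mem hx] at this ⊢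
      exact pow_le_pow_left₀ (hf0 n x) this 2
    · rw [Set.indicator_of_notMem hx] at this ⊢
      rw [le_antisymm this (hf0 n x)]
      simp
  have hlint : ∀ n, ∫⁻ x, ENNReal.ofReal (f n x ^ 2) ∂μ ≤ ENNReal.ofReal (C * φ (h n)) := by
    intro n
    refine le_trans ?_ (h2 (h n))
    rw [← lintegral_indicator (hset n)]
    refine lintegral_mono fun x => ?_
    refine (ENNReal.ofReal_le_ofReal (hf2 n x)).trans_eq ?_
    by_cases hx : x ∈ {x | ρ x ≤ h n}
    · rw [Set.indicator_of_mem hx, Set.indicator_of_mem hx]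
    · rw [Set.indicator_of_notMem hx, Set.indicator_of_notMem hx, ENNReal.ofReal_zero]
  have hint2 : ∀ n, Integrable (fun x => f n x ^ 2) μ := by
    intro n
    refine (lintegral_ofReal_ne_top_iff_integrable ((hf n).pow_const 2).aestronglyMeasurable
      (ae_of_all _ fun x => sq_nonneg _)).1 (ne_top_of_le_ne_top ENNReal.ofReal_ne_top (hlint n))
  have hval2 : ∀ n, ∫ x, f n x ^ 2 ∂μ ≤ C * φ (h n) := by
    intro n
    rw [integral_eq_lintegral_of_nonneg_ae (ae_of_all _ fun x => sq_nonneg _)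
      ((hf n).pow_const 2).aestronglyMeasurable]
    exact ENNReal.toReal_le_of_le_ofReal (mul_nonneg hC (hpos n).le) (hlint n)
  have hint : ∀ n, Integrable (f n) μ := by
    intro n
    refine ((integrable_const (1 : ℝ)).add (hint2 n)).mono' (hf n).aestronglyMeasurable
      (ae_of_all _ fun x => ?_)
    rw [Real.norm_eq_abs, abs_of_nonneg (hf0 n x), Pi.add_apply]
    nlinarith [sq_nonneg (f n x - 1), hf0 n x]
  -- the reciprocal of the level at which the variables are cut
  set l : ℕ → ℝ := fun n => √(Real.log n / (n * φ (h n))) with hl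
  set f₁ : ℕ → E → ℝ := fun n => {x | l n * f n x ≤ 1}.indicator (f n) with hf₁
  have hset₁ : ∀ n, MeasurableSet {x | l n * f n x ≤ 1} := fun n =>
    measurableSet_le ((hf n).const_mul _) measurable_const
  have hf₁m : ∀ n, Measurable (f₁ n) := fun n => (hf n).indicator (hset₁ n)
  have hf₁0 : ∀ n x, 0 ≤ f₁ n x := fun n x => Set.indicator_nonneg (fun x _ => hf0 n x) x
  have hf₁le : ∀ n x, f₁ n x ≤ f n x := fun n x => Set.indicator_le_self' (fun _ _ => hf0 n _) x
  have hrem : ∀ n x, f n x - f₁ n x ≤ l n * f n x ^ 2 := by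
    intro n x
    have hl0 : 0 ≤ l n := Real.sqrt_nonneg _
    by_cases hx : x ∈ {x | l n * f n x ≤ 1}
    · simp only [hf₁, Set.indicator_of_mem hx, sub_self]
      positivity
    · simp only [hf₁, Set.indicator_of_notMem hx, sub_zero]
      have : 1 < l n * f n x := not_le.1 hx
      nlinarith [hf0 n x]
  have hint₁ : ∀ n, Integrable (f₁ n) μ := fun n => (hint n).indicator (hset₁ n)
  have hbern : ∀ᵐ ω ∂Q, ∀ᶠ n : ℕ in atTop,
      |∑ i ∈ Finset.range n, f₁ n (o i ω) - n * ∫ x, f₁ n x ∂μ|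
        ≤ (C + 2) * √(n * φ (h n) * Real.log n) := by
    refine ae_eventually_of_summable _ (fun n : ℕ => 2 * (1 / (n : ℝ) ^ 2))
      ((Real.summable_one_div_nat_pow.2 one_lt_two).mul_left 2) ?_
    filter_upwards [eventually_one_le_log, eventually_ge_atTop 1] with n hlog hn1
    have hn0 : (0 : ℝ) < n := by exact_mod_cast hn1
    have hN : 0 < n * φ (h n) := mul_pos hn0 (hpos n)
    have hl0 : 0 < l n := Real.sqrt_pos.2 (by positivity)
    have hφ0 := (hpos n).ne'
    have hl2 : l n ^ 2 = Real.log n / (n * φ (h n)) := Real.sq_sqrt (by positivity)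
    have hlt : l n * √(n * φ (h n) * Real.log n) = Real.log n := by
      simp only [hl]
      rw [← Real.sqrt_mul (by positivity), show Real.log n / (n * φ (h n)) *
        (n * φ (h n) * Real.log n) = Real.log n ^ 2 by field_simp, Real.sqrt_sq (by linarith)]
    have hb := ho.bernstein (Finset.range n) (hf₁m n) (M := 1 / l n) (v := C * φ (h n))
      (l := l n) ((C + 2) * √(n * φ (h n) * Real.log n)) ?_ ?_ hl0.le (by field_simp; simp)
    · refine (measure_mono ?_).trans (hb.trans_eq ?_)
      · intro ω hω
        rw [Set.mem_ofPred_eq, not_le] at hω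
        rw [Set.mem_ofPred_eq, Finset.card_range]
        exact mul_le_mul_of_nonneg_left hω.le hl0.le
      · have h4 : ((Finset.range n).card : ℝ) * (l n ^ 2 * (C * φ (h n))) -
            l n * ((C + 2) * √(n * φ (h n) * Real.log n)) = -(((2 : ℕ) : ℝ) * Real.log n) := by
          rw [Finset.card_range, mul_left_comm (l n), hlt, hl2]
          field_simp
          push_cast
          ring
        rw [h4, Real.exp_neg, Real.exp_nat_mul, Real.exp_log hn0, one_div]
    · intro x
      rw [abs_of_nonneg (hf₁0 n x), le_div_iff₀ hl0, mul_comm]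
      by_cases hx : x ∈ {x | l n * f n x ≤ 1}
      · simp only [hf₁, Set.indicator_of_mem hx]
        exact hx
      · simp [hf₁, Set.indicator_of_notMem hx]
    · refine (integral_mono_of_nonneg (ae_of_all _ fun x => sq_nonneg _) (hint2 n)
        (ae_of_all _ fun x => ?_)).trans (hval2 n)
      exact pow_le_pow_left₀ (hf₁0 n x) (hf₁le n x) 2
  refine ⟨(C + 2) + c + C, ?_⟩
  filter_upwards [hc, hbern] with ω h3 h4
  filter_upwards [h3, h4, eventually_one_le_log, eventually_ge_atTop 1] with n h3 h4 hlog hn1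
  have hn0 : (0 : ℝ) < n := by exact_mod_cast hn1
  have hN : 0 < n * φ (h n) := mul_pos hn0 (hpos n)
  have hl0 : 0 < l n := Real.sqrt_pos.2 (by positivity)
  have hlN : l n * (n * φ (h n)) = √(n * φ (h n) * Real.log n) := by
    simp only [hl]
    rw [← Real.sqrt_sq hN.le, ← Real.sqrt_mul (by positivity), Real.sqrt_sq hN.le]
    congr 1
    field_simp
  have hsum : ∑ i ∈ Finset.range n, (f n (o i ω) - f₁ n (o i ω))
      ≤ c * √(n * φ (h n) * Real.log n) := by
    calc ∑ i ∈ Finset.range n, (f n (o i ω) - f₁ n (o i ω))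
        ≤ ∑ i ∈ Finset.range n,
            l n * {x | ρ x ≤ h n}.indicator (fun x => G x ^ 2) (o i ω) :=
          Finset.sum_le_sum fun i _ => (hrem n _).trans
            (mul_le_mul_of_nonneg_left (hf2 n _) hl0.le)
      _ ≤ l n * (c * (n * φ (h n))) := by
          rw [← Finset.mul_sum]
          exact mul_le_mul_of_nonneg_left h3 hl0.le
      _ = _ := by rw [mul_left_comm, hlN]
  have hsum0 : 0 ≤ ∑ i ∈ Finset.range n, (f n (o i ω) - f₁ n (o i ω)) :=
    Finset.sum_nonneg fun i _ => sub_nonneg.2 (hf₁le n _)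
  have hmean : n * ∫ x, (f n x - f₁ n x) ∂μ ≤ C * √(n * φ (h n) * Real.log n) := by
    calc n * ∫ x, (f n x - f₁ n x) ∂μ ≤ n * ∫ x, l n * f n x ^ 2 ∂μ := by
          gcongr
          exacts [(hint n).sub (hint₁ n), (hint2 n).const_mul _, hrem n]
      _ ≤ n * (l n * (C * φ (h n))) := by
          rw [integral_const_mul]
          gcongr
          exact hval2 n
      _ = C * (l n * (n * φ (h n))) := by ring
      _ = _ := by rw [hlN]
  have hmean0 : 0 ≤ n * ∫ x, (f n x - f₁ n x) ∂μ :=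
    mul_nonneg hn0.le (integral_nonneg fun x => sub_nonneg.2 (hf₁le n x))
  rw [integral_sub (hint n) (hint₁ n)] at hmean hmean0
  rw [Finset.sum_sub_distrib] at hsum hsum0
  rw [abs_le] at h4 ⊢
  constructor <;> nlinarith

end Shrinking

/-! ### Integrals against a continuous distribution function -/

section Cdf

variable {ν : Measure ℝ} [IsProbabilityMeasure ν]

lemma measure_Ioc_eq_cdf (ν : Measure ℝ) [IsProbabilityMeasure ν] (x y : ℝ) :
    ν (Set.Ioc x y) = ENNReal.ofReal (cdf ν y - cdf ν x) := by
  conv_lhs => rw [← measure_cdf ν]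
  exact StieltjesFunction.measure_Ioc _ _ _

/-- Where the distribution function of `ν` is continuous, it transports `ν` to Lebesgue measure. -/
lemma map_cdf_restrict_Ioc {x y : ℝ} (hxy : x ≤ y)
    (hc : ∀ t, x < t → ContinuousAt (cdf ν) t) :
    (ν.restrict (Set.Ioc x y)).map (cdf ν) = volume.restrict (Set.Ioc (cdf ν x) (cdf ν y)) := by
  have hmono := monotone_cdf ν
  have hle := hmono hxy
  refine Measure.ext_of_Iic _ _ fun s => ?_
  have hm : MeasurableSet (cdf ν ⁻¹' Set.Iic s) := hmono.measurable measurableSet_Iic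
  rw [Measure.map_apply hmono.measurable measurableSet_Iic, Measure.restrict_apply hm,
    Measure.restrict_apply measurableSet_Iic]
  rcases lt_or_ge s (cdf ν x) with h1 | h1
  · rw [show cdf ν ⁻¹' Set.Iic s ∩ Set.Ioc x y = ∅ from ?_,
      show Set.Iic s ∩ Set.Ioc (cdf ν x) (cdf ν y) = ∅ from ?_]
    · simp
    · ext u
      simp only [Set.mem_inter_iff, Set.mem_Iic, Set.mem_Ioc, Set.mem_empty_iff_false, iff_false]
      intro h; linarith [h.1, h.2.1]
    · ext t
      simp only [Set.mem_inter_iff, Set.mem_preimage, Set.mem_Iic, Set.mem_Ioc,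
        Set.mem_empty_iff_false, iff_false]
      intro h
      linarith [h.1, hmono h.2.1.le]
  rcases le_or_gt (cdf ν y) s with h2 | h2
  · rw [show cdf ν ⁻¹' Set.Iic s ∩ Set.Ioc x y = Set.Ioc x y from
      Set.inter_eq_right.2 fun t ht => (hmono ht.2).trans h2,
      show Set.Iic s ∩ Set.Ioc (cdf ν x) (cdf ν y) = Set.Ioc (cdf ν x) (cdf ν y) from
      Set.inter_eq_right.2 fun t ht => ht.2.trans h2, measure_Ioc_eq_cdf, Real.volume_Ioc]
  · have hcont : ContinuousOn (cdf ν) (Set.Icc x y) := by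
      intro t ht
      rcases eq_or_lt_of_le ht.1 with rfl | h
      · exact ((cdf ν).right_continuous x).mono Set.Icc_subset_Ici_self
      · exact (hc t h).continuousWithinAt
    obtain ⟨z, hz, hzs⟩ := intermediate_value_Icc hxy hcont ⟨h1, h2.le⟩
    rw [show Set.Iic s ∩ Set.Ioc (cdf ν x) (cdf ν y) = Set.Ioc (cdf ν x) s from ?_,
      Real.volume_Ioc]
    · refine le_antisymm ?_ ?_
      · have h3 : ν (cdf ν ⁻¹' Set.Iic s) ≤ ENNReal.ofReal s := by
          have := measure_sublevel_le (ν := ν) hmono zero_le_one (fun t => by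
            rw [one_mul, ofReal_cdf]) s
          rwa [one_mul] at this
        have h4 : ν (cdf ν ⁻¹' Set.Iic s ∩ Set.Ioc x y) + ν (Set.Iic x) ≤ ENNReal.ofReal s := by
          rw [← measure_union _ measurableSet_Iic]
          · refine (measure_mono ?_).trans h3
            rintro t (ht | ht)
            · exact ht.1
            · exact (hmono ht).trans h1
          · rw [Set.disjoint_left]
            exact fun t ht ht' => absurd ht.2.1 (not_lt.2 ht')
        rw [← ofReal_cdf] at h4
        rw [ENNReal.ofReal_sub _ (cdf_nonneg ν x)]
        exact ENNReal.le_sub_of_add_le_right ENNReal.ofReal_ne_top h4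
      · rw [← hzs, ← measure_Ioc_eq_cdf]
        exact measure_mono fun t ht => ⟨hzs ▸ hmono ht.2, ht.1, ht.2.trans hz.2⟩
    · ext u
      simp only [Set.mem_inter_iff, Set.mem_Iic, Set.mem_Ioc]
      constructor
      · exact fun h => ⟨h.2.1, h.1⟩
      · exact fun h => ⟨h.2, h.1, h.2.trans h2.le⟩

lemma lintegral_Ioc_comp_cdf {x y : ℝ} (hxy : x ≤ y) (hc : ∀ t, x < t → ContinuousAt (cdf ν) t)
    {g : ℝ → ℝ≥0∞} (hg : Measurable g) :
    ∫⁻ t in Set.Ioc x y, g (cdf ν t) ∂ν = ∫⁻ u in Set.Ioc (cdf ν x) (cdf ν y), g u := by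
  rw [← map_cdf_restrict_Ioc hxy hc, lintegral_map hg (monotone_cdf ν).measurable]

/-- The reverse-time cumulative hazard of `ν` over `(x, y]`. -/
lemma lintegral_inv_cdf {x y : ℝ} (hxy : x ≤ y) (hc : ∀ t, x < t → ContinuousAt (cdf ν) t)
    (hx : 0 < cdf ν x) :
    ∫⁻ t in Set.Ioc x y, ENNReal.ofReal (cdf ν t)⁻¹ ∂ν
      = ENNReal.ofReal (Real.log (cdf ν y / cdf ν x)) := by
  have hle := monotone_cdf ν hxy
  rw [lintegral_Ioc_comp_cdf hxy hc (g := fun u => ENNReal.ofReal u⁻¹) (by fun_prop),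
    ← integral_inv_of_pos hx (hx.trans_le hle), intervalIntegral.integral_of_le hle,
    ofReal_integral_eq_lintegral_ofReal]
  · have : IntervalIntegrable (fun u : ℝ => u⁻¹) volume (cdf ν x) (cdf ν y) := by
      refine ContinuousOn.intervalIntegrable (ContinuousOn.inv₀ continuousOn_id fun u hu => ?_)
      rw [Set.uIcc_of_le hle] at hu
      exact (hx.trans_le hu.1).ne'
    exact this.1
  · exact (ae_restrict_mem measurableSet_Ioc).mono fun u hu => inv_nonneg.2 (hx.trans hu.1).le

/-- The cumulative hazard of `ν` over `(x, y]`, when `ν` does not charge `(-∞, x]`. -/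
lemma lintegral_inv_one_sub_cdf {x y : ℝ} (hxy : x ≤ y) (hc : Continuous (cdf ν))
    (hx : cdf ν x = 0) (hy : cdf ν y < 1) :
    ∫⁻ t in Set.Ioc x y, ENNReal.ofReal (1 - cdf ν t)⁻¹ ∂ν
      = ENNReal.ofReal (-Real.log (1 - cdf ν y)) := by
  have hle := monotone_cdf ν hxy
  have h1 : ∫ u in (cdf ν x)..(cdf ν y), (1 - u)⁻¹ = -Real.log (1 - cdf ν y) := by
    rw [intervalIntegral.integral_comp_sub_left (fun u => u⁻¹) 1, hx,
      integral_inv_of_pos (by linarith) (by norm_num), sub_zero, one_div, Real.log_inv]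
  rw [lintegral_Ioc_comp_cdf hxy (fun t _ => hc.continuousAt)
    (g := fun u => ENNReal.ofReal (1 - u)⁻¹) (by fun_prop),
    ← h1, intervalIntegral.integral_of_le hle, ofReal_integral_eq_lintegral_ofReal]
  · have : IntervalIntegrable (fun u : ℝ => (1 - u)⁻¹) volume (cdf ν x) (cdf ν y) := by
      refine ContinuousOn.intervalIntegrable (ContinuousOn.inv₀ (by fun_prop) fun u hu => ?_)
      rw [Set.uIcc_of_le hle] at hu
      linarith [hu.2]
    exact this.1
  · refine (ae_restrict_mem measurableSet_Ioc).mono fun u hu => inv_nonneg.2 ?_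
    linarith [hu.2]

end Cdf

/-! ### The law of an observation -/

lemma _root_.ProbabilityTheory.IndepFun.lintegral_comp_prodMk {Ω A B : Type*} [MeasurableSpace Ω]
    [MeasurableSpace A] [MeasurableSpace B] {P : Measure Ω} [IsProbabilityMeasure P] {U : Ω → A}
    {W : Ω → B} (hUW : IndepFun U W P) (hU : Measurable U) (hW : Measurable W)
    {f : A × B → ℝ≥0∞} (hf : Measurable f) :
    ∫⁻ ω, f (U ω, W ω) ∂P = ∫⁻ ω, ∫⁻ ω', f (U ω, W ω') ∂P ∂P := by
  have h := (indepFun_iff_map_prod_eq_prod_map_map hU.aemeasurable hW.aemeasurable).1 hUW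
  have := Measure.isProbabilityMeasure_map (μ := P) hW.aemeasurable
  calc ∫⁻ ω, f (U ω, W ω) ∂P = ∫⁻ z, f z ∂(P.map fun ω => (U ω, W ω)) :=
        (lintegral_map hf (hU.prodMk hW)).symm
    _ = ∫⁻ u, ∫⁻ w, f (u, w) ∂(P.map W) ∂(P.map U) := by
        rw [h, lintegral_prod _ hf.aemeasurable]
    _ = ∫⁻ ω, ∫⁻ w, f (U ω, w) ∂(P.map W) ∂P :=
        lintegral_map hf.lintegral_prod_right' hU
    _ = _ := lintegral_congr fun ω => lintegral_map (hf.comp measurable_prodMk_left) hW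

lemma _root_.ProbabilityTheory.IndepFun.setLIntegral_comp_left {Ω A B : Type*}
    [MeasurableSpace Ω] [MeasurableSpace A] [MeasurableSpace B] {P : Measure Ω}
    [IsProbabilityMeasure P] {U : Ω → A} {W : Ω → B} (hUW : IndepFun U W P) (hU : Measurable U)
    (hW : Measurable W) {g : A → ℝ≥0∞} (hg : Measurable g) {R : Set (A × B)}
    (hR : MeasurableSet R) :
    ∫⁻ ω in {ω | (U ω, W ω) ∈ R}, g (U ω) ∂P
      = ∫⁻ ω, g (U ω) * P {ω' | (U ω, W ω') ∈ R} ∂P := by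
  have h1 := hUW.lintegral_comp_prodMk hU hW ((hg.comp measurable_fst).indicator hR)
  have hset : MeasurableSet {ω | (U ω, W ω) ∈ R} := (hU.prodMk hW) hR
  have hsec : ∀ ω, MeasurableSet {ω' | (U ω, W ω') ∈ R} := fun ω =>
    hW (measurable_prodMk_left (x := U ω) hR)
  rw [← lintegral_indicator hset]
  refine Eq.trans (lintegral_congr fun ω => ?_) (h1.trans (lintegral_congr fun ω => ?_))
  · rfl
  · rw [← lintegral_indicator_const (hsec ω)]
    rfl

/-- If `U` and `V` are independent and `(U, V)` is independent of `W`, then `U` is independent of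
`(V, W)`. -/
lemma indepFun_assoc {Ω A B C : Type*} [MeasurableSpace Ω]
    [MeasurableSpace A] [MeasurableSpace B] [MeasurableSpace C] {P : Measure Ω}
    [IsProbabilityMeasure P] {U : Ω → A} {V : Ω → B} {W : Ω → C} (hUV : IndepFun U V P)
    (hUVW : IndepFun (fun ω => (U ω, V ω)) W P) (hU : Measurable U) (hV : Measurable V)
    (hW : Measurable W) : IndepFun U (fun ω => (V ω, W ω)) P := by
  have h1 := (indepFun_iff_map_prod_eq_prod_map_map hU.aemeasurable hV.aemeasurable).1 hUV
  have h2 := (indepFun_iff_map_prod_eq_prod_map_map (hU.prodMk hV).aemeasurable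
    hW.aemeasurable).1 hUVW
  have h3 := (indepFun_iff_map_prod_eq_prod_map_map hV.aemeasurable hW.aemeasurable).1
    (hUVW.comp measurable_snd measurable_id)
  have := Measure.isProbabilityMeasure_map (μ := P) hU.aemeasurable
  have := Measure.isProbabilityMeasure_map (μ := P) hV.aemeasurable
  have := Measure.isProbabilityMeasure_map (μ := P) hW.aemeasurable
  rw [indepFun_iff_map_prod_eq_prod_map_map hU.aemeasurable (hV.prodMk hW).aemeasurable]
  have h3' : P.map (fun ω => (V ω, W ω)) = (P.map V).prod (P.map W) := h3
  rw [h3', ← Measure.prodAssoc_prod, ← h1, ← h2, Measure.map_map (by fun_prop)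
    ((hU.prodMk hV).prodMk hW)]
  rfl

lemma measurableSet_setOf_and {A : Type*} [MeasurableSpace A] {p q : A → Prop}
    (hp : MeasurableSet {a | p a}) (hq : MeasurableSet {a | q a}) :
    MeasurableSet {a | p a ∧ q a} := hp.inter hq

section Model

variable {F Ω₀ : Type*} [MeasurableSpace F] [MeasurableSpace Ω₀] {P : Measure Ω₀}
  {X : Ω₀ → F} {Y T S : Ω₀ → ℝ}

/-- The law of a record `(χ, Z, T, δ)` given that the subject is retained. -/
noncomputable def observedLaw (P : Measure Ω₀) (X : Ω₀ → F) (Y T S : Ω₀ → ℝ) :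
    Measure (F × ℝ × ℝ × ℕ) :=
  (ProbabilityTheory.cond P (retained Y T S)).map (record X Y T S)

lemma IsModel.measurable_censored (h : IsModel P X Y T S) : Measurable (censored Y S) :=
  h.measurable_Y.min h.measurable_S

lemma IsModel.measurableSet_retained (h : IsModel P X Y T S) :
    MeasurableSet (retained Y T S) :=
  measurableSet_le h.measurable_T h.measurable_censored

lemma IsModel.measurable_record (h : IsModel P X Y T S) : Measurable (record X Y T S) :=
  h.measurable_X.prodMk (h.measurable_censored.prodMk (h.measurable_T.prodMk
    (Measurable.ite (measurableSet_le h.measurable_Y h.measurable_S) measurable_const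
      measurable_const)))

lemma distFun_eq [IsProbabilityMeasure P] (hV : Measurable T) (y : ℝ) :
    distFun P T y = P.real {ω | T ω ≤ y} := by
  have := Measure.isProbabilityMeasure_map (μ := P) hV.aemeasurable
  rw [distFun, cdf_eq_real, map_measureReal_apply hV measurableSet_Iic]
  rfl

lemma ofReal_distFun [IsProbabilityMeasure P] (hV : Measurable T) (y : ℝ) :
    ENNReal.ofReal (distFun P T y) = P {ω | T ω ≤ y} := by
  rw [distFun_eq hV, ofReal_measureReal]

lemma ofReal_one_sub_distFun [IsProbabilityMeasure P] (hV : Measurable T)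
    (hc : Continuous (distFun P T)) (y : ℝ) :
    ENNReal.ofReal (1 - distFun P T y) = P {ω | y ≤ T ω} := by
  have := Measure.isProbabilityMeasure_map (μ := P) hV.aemeasurable
  have h1 : P {ω | y ≤ T ω} = P.map T (Set.Ici y) := (Measure.map_apply hV measurableSet_Ici).symm
  have h2 : P.map T {y} = 0 := by
    rw [← measure_cdf (P.map T), StieltjesFunction.measure_singleton,
      (show Continuous (cdf (P.map T)) from hc).continuousAt.continuousWithinAt.leftLim_eq]
    simp
  have h3 : P.map T (Set.Ici y) = P.map T (Set.Ioi y) := by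
    rw [← Set.Ioi_union_left, measure_union (by simp) (measurableSet_singleton y), h2, add_zero]
  rw [h1, h3, ← Set.compl_Iic, prob_compl_eq_one_sub measurableSet_Iic, ← ofReal_cdf,
    distFun, ENNReal.ofReal_sub _ (cdf_nonneg _ _), ENNReal.ofReal_one]

lemma IsModel.isProbabilityMeasure_observedLaw [IsProbabilityMeasure P] (h : IsModel P X Y T S) :
    IsProbabilityMeasure (observedLaw P X Y T S) := by
  have := cond_isProbabilityMeasure h.pos_retained.ne'
  exact Measure.isProbabilityMeasure_map h.measurable_record.aemeasurable

lemma IsModel.lintegral_observedLaw (h : IsModel P X Y T S) {f : F × ℝ × ℝ × ℕ → ℝ≥0∞}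
    (hf : Measurable f) :
    ∫⁻ o, f o ∂(observedLaw P X Y T S) =
      (P (retained Y T S))⁻¹ * ∫⁻ ω in retained Y T S, f (record X Y T S ω) ∂P := by
  rw [observedLaw, lintegral_map hf h.measurable_record, ProbabilityTheory.cond,
    lintegral_smul_measure, smul_eq_mul]

/-- What holds almost surely for retained subjects holds almost surely for observations. -/
lemma IsModel.ae_observedLaw (h : IsModel P X Y T S) {p : F × ℝ × ℝ × ℕ → Prop}
    (hm : MeasurableSet {o | p o})
    (hp : ∀ᵐ ω ∂P, T ω ≤ censored Y S ω → p (record X Y T S ω)) :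
    ∀ᵐ o ∂(observedLaw P X Y T S), p o := by
  rw [observedLaw, ae_map_iff h.measurable_record.aemeasurable hm, ProbabilityTheory.cond]
  refine Measure.ae_smul_measure ?_ _
  rw [ae_restrict_iff' h.measurableSet_retained]
  exact hp

variable [IsProbabilityMeasure P]

lemma IsModel.indep_T (h : IsModel P X Y T S) :
    IndepFun T (fun ω => (S ω, (X ω, Y ω))) P :=
  indepFun_assoc h.indep_T_S h.indep_TS_XY h.measurable_T h.measurable_S
    (h.measurable_X.prodMk h.measurable_Y)

lemma IsModel.indep_S (h : IsModel P X Y T S) :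
    IndepFun S (fun ω => (T ω, (X ω, Y ω))) P :=
  indepFun_assoc h.indep_T_S.symm (h.indep_TS_XY.comp measurable_swap measurable_id)
    h.measurable_S h.measurable_T (h.measurable_X.prodMk h.measurable_Y)

lemma IsModel.indep_T_censored (h : IsModel P X Y T S) : IndepFun T (censored Y S) P :=
  h.indep_T.comp measurable_id
    (show Measurable fun q : ℝ × (F × ℝ) => min q.2.2 q.1 by fun_prop)

/-- The observed truncation times have the density `t ↦ P(Z ≥ t) / P(Z ≥ T)` with respect to the
law of `T`. -/
lemma IsModel.lintegral_truncation (h : IsModel P X Y T S) {g : ℝ → ℝ≥0∞} (hg : Measurable g) :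
    ∫⁻ o, g o.2.2.1 ∂(observedLaw P X Y T S) =
      (P (retained Y T S))⁻¹ * ∫⁻ ω, g (T ω) * P {ω' | T ω ≤ censored Y S ω'} ∂P := by
  rw [h.lintegral_observedLaw (f := fun o => g o.2.2.1) (by fun_prop)]
  congr 1
  exact h.indep_T_censored.setLIntegral_comp_left h.measurable_T h.measurable_censored hg
    (R := {q : ℝ × ℝ | q.1 ≤ q.2}) (measurableSet_le measurable_fst measurable_snd)

/-- The observed censored responses have the (defective) density
`s ↦ P(T ≤ s) P(Y > s) / P(Z ≥ T)` with respect to the law of `S`. -/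
lemma IsModel.lintegral_censored (h : IsModel P X Y T S) {g : ℝ → ℝ≥0∞} (hg : Measurable g) :
    ∫⁻ o, (if o.2.2.2 = 0 then g o.2.1 else 0) ∂(observedLaw P X Y T S) =
      (P (retained Y T S))⁻¹ *
        ∫⁻ ω, g (S ω) * (P {ω' | T ω' ≤ S ω} * P {ω' | S ω < Y ω'}) ∂P := by
  have hm : Measurable fun o : F × ℝ × ℝ × ℕ => if o.2.2.2 = 0 then g o.2.1 else 0 :=
    Measurable.ite ((by fun_prop : Measurable fun o : F × ℝ × ℝ × ℕ => o.2.2.2)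
      (measurableSet_singleton 0)) (by fun_prop) measurable_const
  rw [h.lintegral_observedLaw hm]
  congr 1
  have hYS : MeasurableSet {ω | S ω < Y ω} := measurableSet_lt h.measurable_S h.measurable_Y
  have hset : MeasurableSet {ω | T ω ≤ S ω ∧ S ω < Y ω} :=
    (measurableSet_le h.measurable_T h.measurable_S).inter hYS
  have h1 := (h.indep_S.comp measurable_id
    (show Measurable fun q : ℝ × (F × ℝ) => (q.1, q.2.2) by fun_prop)).setLIntegral_comp_left
    h.measurable_S (h.measurable_T.prodMk h.measurable_Y) hg
    (R := {q : ℝ × (ℝ × ℝ) | q.2.1 ≤ q.1 ∧ q.1 < q.2.2})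
    (measurableSet_setOf_and (measurableSet_le (by fun_prop) (by fun_prop))
      (measurableSet_lt (by fun_prop) (by fun_prop)))
  have h2 : ∀ s, P {ω' | T ω' ≤ s ∧ s < Y ω'} = P {ω' | T ω' ≤ s} * P {ω' | s < Y ω'} := by
    intro s
    exact (h.indep_T.comp measurable_id (show Measurable fun q : ℝ × (F × ℝ) => q.2.2 by
      fun_prop)).measure_inter_preimage_eq_mul (Set.Iic s) (Set.Ioi s) measurableSet_Iic
      measurableSet_Ioi
  refine Eq.trans ?_ (h1.trans (lintegral_congr fun ω => congrArg _ (h2 (S ω))))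
  rw [← lintegral_indicator h.measurableSet_retained]
  refine Eq.trans ?_ (lintegral_indicator hset _)
  refine lintegral_congr fun ω => ?_
  simp only [Set.indicator_apply, retained, record, censored, uncensored, Set.mem_ofPred_eq]
  rcases le_or_gt (Y ω) (S ω) with hle | hlt
  · simp [hle, not_lt.2 hle]
  · simp [hlt, not_le.2 hlt, min_eq_right hlt.le]

/-- The uncensored observations have the (defective) density `P(T ≤ y) P(S ≥ y) / P(Z ≥ T)` at
`(x, y)` with respect to the law of `(χ, Y)`. Weighting by the reciprocal of `L(y) (1 - G(y))`
therefore restores the law of the population. -/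
lemma IsModel.lintegral_uncensored (h : IsModel P X Y T S) {g : F × ℝ → ℝ≥0∞}
    (hg : Measurable g) :
    ∫⁻ o, (if o.2.2.2 = 1 then g (o.1, o.2.1) else 0) ∂(observedLaw P X Y T S) =
      (P (retained Y T S))⁻¹ *
        ∫⁻ ω, g (X ω, Y ω) * (P {ω' | T ω' ≤ Y ω} * P {ω' | Y ω ≤ S ω'}) ∂P := by
  have hm : Measurable fun o : F × ℝ × ℝ × ℕ => if o.2.2.2 = 1 then g (o.1, o.2.1) else 0 :=
    Measurable.ite ((by fun_prop : Measurable fun o : F × ℝ × ℝ × ℕ => o.2.2.2)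
      (measurableSet_singleton 1)) (by fun_prop) measurable_const
  rw [h.lintegral_observedLaw hm]
  congr 1
  have hset : MeasurableSet {ω | T ω ≤ Y ω ∧ Y ω ≤ S ω} :=
    (measurableSet_le h.measurable_T h.measurable_Y).inter
      (measurableSet_le h.measurable_Y h.measurable_S)
  have h1 := h.indep_TS_XY.symm.setLIntegral_comp_left
    (h.measurable_X.prodMk h.measurable_Y) (h.measurable_T.prodMk h.measurable_S) hg
    (R := {q : (F × ℝ) × (ℝ × ℝ) | q.2.1 ≤ q.1.2 ∧ q.1.2 ≤ q.2.2})
    (measurableSet_setOf_and (measurableSet_le (by fun_prop) (by fun_prop))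
      (measurableSet_le (by fun_prop) (by fun_prop)))
  have h2 : ∀ y, P {ω' | T ω' ≤ y ∧ y ≤ S ω'} = P {ω' | T ω' ≤ y} * P {ω' | y ≤ S ω'} :=
    fun y => h.indep_T_S.measure_inter_preimage_eq_mul (Set.Iic y) (Set.Ici y) measurableSet_Iic
      measurableSet_Ici
  refine Eq.trans ?_ (h1.trans (lintegral_congr fun ω => congrArg _ (h2 (Y ω))))
  rw [← lintegral_indicator h.measurableSet_retained]
  refine Eq.trans ?_ (lintegral_indicator hset _)
  refine lintegral_congr fun ω => ?_
  simp only [Set.indicator_apply, retained, record, censored, uncensored, Set.mem_ofPred_eq]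
  rcases le_or_gt (Y ω) (S ω) with hle | hlt
  · simp [hle]
  · simp [not_le.2 hlt]

/-- The probability that an observed subject is at risk at `t` factorizes. -/
lemma IsModel.observedLaw_atRisk (h : IsModel P X Y T S) (t : ℝ) :
    observedLaw P X Y T S {o | o.2.2.1 ≤ t ∧ t ≤ o.2.1} =
      (P (retained Y T S))⁻¹ * (P {ω | T ω ≤ t} * P {ω | t ≤ censored Y S ω}) := by
  have hm : MeasurableSet {o : F × ℝ × ℝ × ℕ | o.2.2.1 ≤ t ∧ t ≤ o.2.1} :=
    measurableSet_setOf_and (measurableSet_le (by fun_prop) (by fun_prop))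
      (measurableSet_le (by fun_prop) (by fun_prop))
  rw [observedLaw, Measure.map_apply h.measurable_record hm, cond_apply h.measurableSet_retained]
  congr 1
  refine Eq.trans ?_ (h.indep_T_censored.measure_inter_preimage_eq_mul (Set.Iic t) (Set.Ici t)
    measurableSet_Iic measurableSet_Ici)
  congr 1
  ext ω
  exact ⟨fun hω => hω.2, fun hω =>
    ⟨show T ω ≤ censored Y S ω from le_trans (show T ω ≤ t from hω.1) hω.2, hω⟩⟩

lemma IsModel.measure_le_censored (h : IsModel P X Y T S) (t : ℝ) :
    P {ω | t ≤ censored Y S ω} = P {ω | t ≤ Y ω} * P {ω | t ≤ S ω} := by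
  rw [mul_comm]
  refine Eq.trans ?_ ((h.indep_S.comp measurable_id
    (show Measurable fun q : ℝ × (F × ℝ) => q.2.2 by fun_prop)).measure_inter_preimage_eq_mul
      (Set.Ici t) (Set.Ici t) measurableSet_Ici measurableSet_Ici)
  congr 1
  ext ω
  exact (show t ≤ min (Y ω) (S ω) ↔ _ from le_min_iff).trans and_comm

/-- The left endpoint `a` of the law of `Z` is a real number: it is finite because some mass of `T`
lies strictly below it. -/
lemma IsModel.exists_lowerEndpoint (h : IsModel P X Y T S) :
    ∃ a : ℝ, 0 < distFun P T a ∧ (∀ᵐ ω ∂P, a ≤ censored Y S ω) ∧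
      ∀ t, a < t → ContinuousAt (distFun P T) t := by
  set A := lowerEndpoint (distFun P (censored Y S)) with hA
  obtain ⟨_, ⟨y₀, hy₀, rfl⟩, hy₀A⟩ := sInf_lt_iff.1 h.lower_lt
  have hle : ∀ y : ℝ, 0 < distFun P (censored Y S) y → A ≤ y := fun y hy =>
    sInf_le ⟨y, hy, rfl⟩
  have hprob := Measure.isProbabilityMeasure_map (μ := P) h.measurable_censored.aemeasurable
  obtain ⟨y₁, hy₁⟩ := ((tendsto_cdf_atTop (P.map (censored Y S))).eventually
    (lt_mem_nhds zero_lt_one)).exists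
  have htop : A ≠ ⊤ := ((hle y₁ hy₁).trans_lt (EReal.coe_lt_top y₁)).ne
  have hbot : A ≠ ⊥ := ((EReal.bot_lt_coe y₀).trans hy₀A).ne'
  have hcoe : ((A.toReal : ℝ) : EReal) = A := EReal.coe_toReal htop hbot
  refine ⟨A.toReal, ?_, ?_, ?_⟩
  · refine lt_of_lt_of_le hy₀ (monotone_cdf _ ?_)
    rw [← hA, ← hcoe] at hy₀A
    exact (EReal.coe_lt_coe_iff.1 hy₀A).le
  · have hq : ∀ᵐ ω ∂P, ∀ q : ℚ, (q : ℝ) < A.toReal → ¬ censored Y S ω ≤ q := by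
      rw [ae_all_iff]
      intro q
      by_cases hqA : (q : ℝ) < A.toReal
      · have h0 : distFun P (censored Y S) q = 0 := by
          refine le_antisymm (not_lt.1 fun hpos => ?_) (cdf_nonneg _ _)
          have := hle q hpos
          rw [← hcoe, EReal.coe_le_coe_iff] at this
          linarith
        have h1 : P {ω | censored Y S ω ≤ q} = 0 := by
          rw [← ofReal_distFun h.measurable_censored, h0, ENNReal.ofReal_zero]
        filter_upwards [measure_eq_zero_iff_ae_notMem.1 h1] with ω hω _ using hω
      · exact ae_of_all _ fun ω h' => absurd h' hqA
    filter_upwards [hq] with ω hω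
    by_contra! hlt
    obtain ⟨q, hq1, hq2⟩ := exists_rat_btwn hlt
    exact hω q hq2 hq1.le
  · intro t ht
    exact h.continuousAt_T t (by rw [← hA, ← hcoe]; exact EReal.coe_lt_coe_iff.2 ht)

lemma measure_lt_pos_of_lt_upperEndpoint {V : Ω₀ → ℝ} (hV : Measurable V) {b : ℝ}
    (hb : (b : EReal) < upperEndpoint (distFun P V)) : 0 < P {ω | b < V ω} := by
  obtain ⟨_, ⟨y, hy, rfl⟩, hby⟩ := lt_sSup_iff.1 hb
  have h1 : P {ω | V ω ≤ b} < 1 := by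
    rw [← ofReal_distFun hV, ← ENNReal.ofReal_one, ENNReal.ofReal_lt_ofReal_iff one_pos]
    exact (monotone_cdf _ (EReal.coe_lt_coe_iff.1 hby).le).trans_lt hy
  have h2 : {ω | b < V ω} = {ω | V ω ≤ b}ᶜ := by ext ω; simp
  rw [h2, prob_compl_eq_one_sub (measurableSet_le hV measurable_const)]
  exact tsub_pos_of_lt h1

end Model

/-! ### The population counterparts of the product-limit estimators -/

section Hazard

variable {F Ω₀ : Type*} [MeasurableSpace F] [MeasurableSpace Ω₀] {P : Measure Ω₀}
  {X : Ω₀ → F} {Y T S : Ω₀ → ℝ}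

/-- The probability `C(t) = P(T ≤ t ≤ Z | T ≤ Z)` that an observed subject is at risk at `t`. -/
noncomputable def atRisk (P : Measure Ω₀) (Y T S : Ω₀ → ℝ) (t : ℝ) : ℝ :=
  (P.real (retained Y T S))⁻¹ * (distFun P T t * P.real {ω | t ≤ censored Y S ω})

lemma distFun_nonneg (V : Ω₀ → ℝ) (y : ℝ) : 0 ≤ distFun P V y := cdf_nonneg _ _

lemma distFun_le_one (V : Ω₀ → ℝ) (y : ℝ) : distFun P V y ≤ 1 := cdf_le_one _ _

lemma monotone_distFun (V : Ω₀ → ℝ) : Monotone (distFun P V) := monotone_cdf _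

lemma atRisk_nonneg (t : ℝ) : 0 ≤ atRisk P Y T S t := by
  have := distFun_nonneg (P := P) T t
  unfold atRisk
  positivity

variable [IsProbabilityMeasure P]

lemma measurable_atRisk : Measurable (atRisk P Y T S) := by
  refine ((monotone_distFun T).measurable.mul (Antitone.measurable fun s t hst => ?_)).const_mul _
  exact measureReal_mono fun ω hω => hst.trans hω

lemma IsModel.pos_real_retained (h : IsModel P X Y T S) : 0 < P.real (retained Y T S) :=
  ENNReal.toReal_pos h.pos_retained.ne' (measure_ne_top _ _)

lemma IsModel.inv_retained_eq (h : IsModel P X Y T S) :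
    (P (retained Y T S))⁻¹ = ENNReal.ofReal (P.real (retained Y T S))⁻¹ := by
  rw [ENNReal.ofReal_inv_of_pos h.pos_real_retained, ofReal_measureReal]

lemma IsModel.observedLaw_atRisk_eq (h : IsModel P X Y T S) (t : ℝ) :
    observedLaw P X Y T S {o | o.2.2.1 ≤ t ∧ t ≤ o.2.1} = ENNReal.ofReal (atRisk P Y T S t) := by
  rw [h.observedLaw_atRisk, h.inv_retained_eq, ← ofReal_distFun h.measurable_T,
    ← ofReal_measureReal (s := {ω | t ≤ censored Y S ω}), ← ENNReal.ofReal_mul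
    (distFun_nonneg _ _), ← ENNReal.ofReal_mul (inv_nonneg.2 h.pos_real_retained.le)]
  rfl

lemma IsModel.integral_atRisk (h : IsModel P X Y T S) (t : ℝ) :
    ∫ o, (if o.2.2.1 ≤ t ∧ t ≤ o.2.1 then (1 : ℝ) else 0) ∂(observedLaw P X Y T S)
      = atRisk P Y T S t := by
  have hm : MeasurableSet {o : F × ℝ × ℝ × ℕ | o.2.2.1 ≤ t ∧ t ≤ o.2.1} :=
    measurableSet_setOf_and (measurableSet_le (by fun_prop) (by fun_prop))
      (measurableSet_le (by fun_prop) (by fun_prop))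
  rw [show (fun o : F × ℝ × ℝ × ℕ => if o.2.2.1 ≤ t ∧ t ≤ o.2.1 then (1 : ℝ) else 0) =
    {o | o.2.2.1 ≤ t ∧ t ≤ o.2.1}.indicator 1 from by
      ext o; simp [Set.indicator_apply], integral_indicator_one hm, measureReal_def,
      h.observedLaw_atRisk_eq, ENNReal.toReal_ofReal (atRisk_nonneg t)]

lemma IsModel.exists_le_atRisk (h : IsModel P X Y T S) {a b : ℝ} (ha : 0 < distFun P T a)
    (hb : 0 < P {ω | b < censored Y S ω}) :
    ∃ c : ℝ, 0 < c ∧ ∀ t, a ≤ t → t ≤ b → c ≤ atRisk P Y T S t := by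
  have hp := h.pos_real_retained
  have hb' : 0 < P.real {ω | b < censored Y S ω} :=
    ENNReal.toReal_pos hb.ne' (measure_ne_top _ _)
  refine ⟨(P.real (retained Y T S))⁻¹ * (distFun P T a * P.real {ω | b < censored Y S ω}),
    by positivity, fun t hat htb => ?_⟩
  unfold atRisk
  gcongr
  · exact distFun_nonneg _ _
  · exact monotone_distFun T hat
  · exact measure_ne_top _ _
  · exact fun hω => htb.trans hω.le

lemma IsModel.one_sub_distFun_pos (h : IsModel P X Y T S) {t b : ℝ} (htb : t ≤ b)
    (hb : 0 < P {ω | b < censored Y S ω}) : 0 < 1 - distFun P S t := by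
  have h1 : 0 < P {ω | t ≤ S ω} := hb.trans_le (measure_mono fun ω (hω : b < _) =>
    (htb.trans hω.le).trans (min_le_right _ _))
  rw [← ofReal_one_sub_distFun h.measurable_S h.continuous_S] at h1
  exact ENNReal.ofReal_pos.1 h1

/-- The mean of the reverse-time hazard increments of the truncation variable. -/
lemma IsModel.integral_truncation_hazard (h : IsModel P X Y T S) {a b : ℝ}
    (ha : 0 < distFun P T a) (hac : ∀ t, a < t → ContinuousAt (distFun P T) t)
    (hb : 0 < P {ω | b < censored Y S ω}) {y : ℝ} (hay : a ≤ y) (hyb : y ≤ b) :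
    ∫ o, (if y < o.2.2.1 ∧ o.2.2.1 ≤ b then (atRisk P Y T S o.2.2.1)⁻¹ else 0)
      ∂(observedLaw P X Y T S) = Real.log (distFun P T b / distFun P T y) := by
  obtain ⟨c, hc, hcle⟩ := h.exists_le_atRisk ha hb
  have hp := h.pos_real_retained
  have hm := measurable_atRisk (P := P) (Y := Y) (T := T) (S := S)
  have hLy := ha.trans_le (monotone_distFun (P := P) T hay)
  have hprob := Measure.isProbabilityMeasure_map (μ := P) h.measurable_T.aemeasurable
  set g : ℝ → ℝ≥0∞ := (Set.Ioc y b).indicator fun t => ENNReal.ofReal (atRisk P Y T S t)⁻¹ with hg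
  have hgm : Measurable g := (by fun_prop : Measurable fun t =>
    ENNReal.ofReal (atRisk P Y T S t)⁻¹).indicator measurableSet_Ioc
  have hmset : MeasurableSet {o : F × ℝ × ℝ × ℕ | y < o.2.2.1 ∧ o.2.2.1 ≤ b} :=
    measurableSet_setOf_and (measurableSet_lt (by fun_prop) (by fun_prop))
      (measurableSet_le (by fun_prop) (by fun_prop))
  rw [integral_eq_lintegral_of_nonneg_ae]
  rotate_left
  · refine ae_of_all _ fun o => ?_
    have := atRisk_nonneg (P := P) (Y := Y) (T := T) (S := S) o.2.2.1
    dsimp only [Pi.zero_apply]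
    split_ifs <;> positivity
  · exact (Measurable.ite hmset (by fun_prop) measurable_const).aestronglyMeasurable
  have h1 : ∫⁻ o, ENNReal.ofReal (if y < o.2.2.1 ∧ o.2.2.1 ≤ b then
      (atRisk P Y T S o.2.2.1)⁻¹ else 0) ∂(observedLaw P X Y T S)
      = ∫⁻ o, g o.2.2.1 ∂(observedLaw P X Y T S) := by
    refine lintegral_congr fun o => ?_
    simp only [hg, Set.indicator_apply, Set.mem_Ioc]
    split_ifs <;> simp
  have h2 : (P (retained Y T S))⁻¹ * ∫⁻ ω, g (T ω) * P {ω' | T ω ≤ censored Y S ω'} ∂P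
      = ∫⁻ t in Set.Ioc y b, ENNReal.ofReal (cdf (P.map T) t)⁻¹ ∂(P.map T) := by
    rw [← lintegral_const_mul' _ _ (ENNReal.inv_ne_top.2 h.pos_retained.ne'),
      ← lintegral_indicator measurableSet_Ioc, lintegral_map _ h.measurable_T]
    · refine lintegral_congr fun ω => ?_
      by_cases hω : T ω ∈ Set.Ioc y b
      · have h3 := hcle (T ω) (hay.trans hω.1.le) hω.2
        have h4 : 0 < distFun P T (T ω) := hLy.trans_le (monotone_distFun T hω.1.le)
        have h5 : 0 < P.real {ω' | T ω ≤ censored Y S ω'} := by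
          by_contra! h0
          have h0' := le_antisymm h0 measureReal_nonneg
          unfold atRisk at h3
          rw [h0', mul_zero, mul_zero] at h3
          linarith
        rw [hg, Set.indicator_of_mem hω, Set.indicator_of_mem hω, h.inv_retained_eq,
          ← ofReal_measureReal (s := {ω' | T ω ≤ censored Y S ω'}),
          ← ENNReal.ofReal_mul (by linarith [inv_pos.2 (hc.trans_le h3)]),
          ← ENNReal.ofReal_mul (by positivity)]
        congr 1
        change _ = (distFun P T (T ω))⁻¹
        unfold atRisk
        field_simp
      · rw [hg, Set.indicator_of_notMem hω, Set.indicator_of_notMem hω, zero_mul, mul_zero]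
    · exact Measurable.indicator (ENNReal.measurable_ofReal.comp
        (monotone_cdf _).measurable.inv) measurableSet_Ioc
  rw [h1, h.lintegral_truncation hgm, h2, lintegral_inv_cdf hyb
    (fun t ht => hac t (hay.trans_lt ht)) hLy, ENNReal.toReal_ofReal]
  · rfl
  · exact Real.log_nonneg ((one_le_div hLy).2 (monotone_distFun (P := P) T hyb))

/-- Truncation times beyond `b` occur with a density, relative to the law of `T`, that vanishes at
the same rate as the probability of being at risk; this makes the reciprocal of the latter
integrable, whatever happens at the right end of the support. -/
lemma IsModel.lintegral_inv_atRisk_ne_top (h : IsModel P X Y T S) {b : ℝ}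
    (hb : 0 < distFun P T b) :
    ∫⁻ o in {o | b < o.2.2.1},
      (observedLaw P X Y T S {o' | o'.2.2.1 ≤ o.2.2.1 ∧ o.2.2.1 ≤ o'.2.1})⁻¹
      ∂(observedLaw P X Y T S) ≠ ∞ := by
  have hp := h.pos_real_retained
  have hm := measurable_atRisk (P := P) (Y := Y) (T := T) (S := S)
  set g : ℝ → ℝ≥0∞ := (Set.Ioi b).indicator fun t => (ENNReal.ofReal (atRisk P Y T S t))⁻¹ with hg
  have hgm : Measurable g := (by fun_prop : Measurable fun t =>
    (ENNReal.ofReal (atRisk P Y T S t))⁻¹).indicator measurableSet_Ioi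
  have h1 : ∫⁻ o in {o | b < o.2.2.1},
      (observedLaw P X Y T S {o' | o'.2.2.1 ≤ o.2.2.1 ∧ o.2.2.1 ≤ o'.2.1})⁻¹
      ∂(observedLaw P X Y T S) = ∫⁻ o, g o.2.2.1 ∂(observedLaw P X Y T S) := by
    rw [← lintegral_indicator (measurableSet_lt (by fun_prop) (by fun_prop))]
    refine lintegral_congr fun o => ?_
    simp only [hg, Set.indicator_apply, Set.mem_Ioi, Set.mem_ofPred_eq, h.observedLaw_atRisk_eq]
  rw [h1, h.lintegral_truncation hgm,
    ← lintegral_const_mul' _ _ (ENNReal.inv_ne_top.2 h.pos_retained.ne')]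
  refine ne_top_of_le_ne_top (b := ∫⁻ _, ENNReal.ofReal (distFun P T b)⁻¹ ∂P) (by simp)
    (lintegral_mono fun ω => ?_)
  by_cases hω : T ω ∈ Set.Ioi b
  · have hωb : b < T ω := hω
    have h4 : 0 < distFun P T (T ω) := hb.trans_le (monotone_distFun T hωb.le)
    rcases eq_or_lt_of_le (measureReal_nonneg (μ := P) (s := {ω' | T ω ≤ censored Y S ω'}))
      with h0 | h5
    · rw [← ofReal_measureReal (s := {ω' | T ω ≤ censored Y S ω'}), ← h0]
      simp
    · have hpos : 0 < atRisk P Y T S (T ω) := by unfold atRisk; positivity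
      rw [hg, Set.indicator_of_mem hω, h.inv_retained_eq, ← ENNReal.ofReal_inv_of_pos hpos,
        ← ofReal_measureReal (s := {ω' | T ω ≤ censored Y S ω'}),
        ← ENNReal.ofReal_mul (by positivity), ← ENNReal.ofReal_mul (by positivity)]
      apply ENNReal.ofReal_le_ofReal
      have h6 := monotone_distFun (P := P) T hωb.le
      calc (P.real (retained Y T S))⁻¹ *
            ((atRisk P Y T S (T ω))⁻¹ * P.real {ω' | T ω ≤ censored Y S ω'})
          = (distFun P T (T ω))⁻¹ := by unfold atRisk; field_simp
        _ ≤ _ := inv_anti₀ hb h6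
  · rw [hg, Set.indicator_of_notMem hω, zero_mul, mul_zero]
    exact zero_le

/-- The mean of the hazard increments of the censoring variable. -/
lemma IsModel.integral_censoring_hazard (h : IsModel P X Y T S) {a b : ℝ}
    (ha : 0 < distFun P T a) (haZ : ∀ᵐ ω ∂P, a ≤ censored Y S ω)
    (hb : 0 < P {ω | b < censored Y S ω}) {y : ℝ} (hy0 : 0 ≤ y) (hyb : y ≤ b) :
    ∫ o, (if o.2.2.2 = 0 ∧ a ≤ o.2.1 ∧ o.2.1 ≤ y then (atRisk P Y T S o.2.1)⁻¹ else 0)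
      ∂(observedLaw P X Y T S) = -Real.log (1 - distFun P S y) := by
  obtain ⟨c, hc, hcle⟩ := h.exists_le_atRisk ha hb
  have hp := h.pos_real_retained
  have hm := measurable_atRisk (P := P) (Y := Y) (T := T) (S := S)
  have hprob := Measure.isProbabilityMeasure_map (μ := P) h.measurable_S.aemeasurable
  set g : ℝ → ℝ≥0∞ := (Set.Icc a y).indicator fun t => ENNReal.ofReal (atRisk P Y T S t)⁻¹ with hg
  have hgm : Measurable g := (by fun_prop : Measurable fun t =>
    ENNReal.ofReal (atRisk P Y T S t)⁻¹).indicator measurableSet_Icc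
  have hmset : MeasurableSet {o : F × ℝ × ℝ × ℕ | o.2.2.2 = 0 ∧ a ≤ o.2.1 ∧ o.2.1 ≤ y} :=
    measurableSet_setOf_and ((by fun_prop : Measurable fun o : F × ℝ × ℝ × ℕ => o.2.2.2)
      (measurableSet_singleton 0)) (measurableSet_setOf_and
      (measurableSet_le (by fun_prop) (by fun_prop)) (measurableSet_le (by fun_prop) (by fun_prop)))
  rw [integral_eq_lintegral_of_nonneg_ae]
  rotate_left
  · refine ae_of_all _ fun o => ?_
    have := atRisk_nonneg (P := P) (Y := Y) (T := T) (S := S) o.2.1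
    dsimp only [Pi.zero_apply]
    split_ifs <;> positivity
  · exact (Measurable.ite hmset (by fun_prop) measurable_const).aestronglyMeasurable
  have h1 : ∫⁻ o, ENNReal.ofReal (if o.2.2.2 = 0 ∧ a ≤ o.2.1 ∧ o.2.1 ≤ y then
      (atRisk P Y T S o.2.1)⁻¹ else 0) ∂(observedLaw P X Y T S)
      = ∫⁻ o, (if o.2.2.2 = 0 then g o.2.1 else 0) ∂(observedLaw P X Y T S) := by
    refine lintegral_congr fun o => ?_
    simp only [hg, Set.indicator_apply, Set.mem_Icc]
    by_cases h0 : o.2.2.2 = 0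
    · simp only [h0, true_and, if_true]
      split_ifs <;> simp
    · simp [h0]
  have hZpos : ∀ t ≤ b, 0 < P.real {ω' | t ≤ censored Y S ω'} := by
    intro t ht
    have hb' : 0 < P.real {ω | b < censored Y S ω} :=
      ENNReal.toReal_pos hb.ne' (measure_ne_top _ _)
    exact hb'.trans_le (measureReal_mono fun ω (hω : b < _) => ht.trans hω.le)
  have hYlt : ∀ t, P {ω | t < Y ω} = P {ω | t ≤ Y ω} := by
    intro t
    rw [← ofReal_one_sub_distFun h.measurable_Y h.continuous_Y, ENNReal.ofReal_sub _
      (distFun_nonneg _ _), ofReal_distFun h.measurable_Y, ENNReal.ofReal_one,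
      ← prob_compl_eq_one_sub (measurableSet_le h.measurable_Y measurable_const)]
    congr 1
    ext ω
    simp
  have hS1 : ∀ t ≤ b, 0 < 1 - distFun P S t ∧ P.real {ω | t ≤ censored Y S ω} =
      P.real {ω | t < Y ω} * (1 - distFun P S t) := by
    intro t ht
    have h3 : P.real {ω | t ≤ censored Y S ω} =
        P.real {ω | t < Y ω} * (1 - distFun P S t) := by
      rw [measureReal_def, h.measure_le_censored, ENNReal.toReal_mul, ← hYlt,
        ← ofReal_one_sub_distFun h.measurable_S h.continuous_S, ENNReal.toReal_ofReal
        (sub_nonneg.2 (distFun_le_one _ _)), ← measureReal_def]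
    refine ⟨?_, h3⟩
    have h4 := hZpos t ht
    rw [h3] at h4
    exact (pos_iff_pos_of_mul_pos h4).1 (lt_of_le_of_ne measureReal_nonneg
      (left_ne_zero_of_mul h4.ne').symm)
  have hS0 : distFun P S 0 = 0 := by
    rw [distFun_eq h.measurable_S, measureReal_def]
    have : P {ω | S ω ≤ 0} = 0 := by
      rw [measure_eq_zero_iff_ae_notMem]
      filter_upwards [h.pos_S] with ω hω using not_le.2 hω
    rw [this]; rfl
  have h2 : (P (retained Y T S))⁻¹ *
      ∫⁻ ω, g (S ω) * (P {ω' | T ω' ≤ S ω} * P {ω' | S ω < Y ω'}) ∂P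
      = ∫⁻ t in Set.Ioc 0 y, ENNReal.ofReal (1 - cdf (P.map S) t)⁻¹ ∂(P.map S) := by
    rw [← lintegral_const_mul' _ _ (ENNReal.inv_ne_top.2 h.pos_retained.ne'),
      ← lintegral_indicator measurableSet_Ioc, lintegral_map _ h.measurable_S]
    · refine lintegral_congr_ae ?_
      filter_upwards [haZ, h.pos_S] with ω haω hSω
      have haS : a ≤ S ω := haω.trans (min_le_right _ _)
      by_cases hω : S ω ≤ y
      · have hω1 : S ω ∈ Set.Icc a y := ⟨haS, hω⟩
        have hω2 : S ω ∈ Set.Ioc 0 y := ⟨hSω, hω⟩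
        have h3 := hcle (S ω) haS (hω.trans hyb)
        have h4 : 0 < distFun P T (S ω) := ha.trans_le (monotone_distFun T haS)
        obtain ⟨h5, h6⟩ := hS1 (S ω) (hω.trans hyb)
        have h7 : 0 < P.real {ω' | S ω < Y ω'} := by
          have := hZpos (S ω) (hω.trans hyb)
          rw [h6] at this
          exact pos_of_mul_pos_left this h5.le
        rw [hg, Set.indicator_of_mem hω1, Set.indicator_of_mem hω2, h.inv_retained_eq,
          ← ofReal_distFun h.measurable_T, ← ofReal_measureReal (s := {ω' | S ω < Y ω'}),
          ← ENNReal.ofReal_mul h4.le, ← ENNReal.ofReal_mul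
            (by linarith [inv_pos.2 (hc.trans_le h3)]), ← ENNReal.ofReal_mul (by positivity)]
        congr 1
        change _ = (1 - distFun P S (S ω))⁻¹
        unfold atRisk
        rw [h6]
        field_simp
      · rw [hg, Set.indicator_of_notMem (fun h' => hω h'.2),
          Set.indicator_of_notMem (fun h' => hω h'.2), zero_mul, mul_zero]
    · exact Measurable.indicator (ENNReal.measurable_ofReal.comp
        ((monotone_cdf _).measurable.const_sub 1).inv) measurableSet_Ioc
  have hyS := (hS1 y hyb).1
  rw [h1, h.lintegral_censored hgm, h2, lintegral_inv_one_sub_cdf hy0 h.continuous_S hS0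
    (by change distFun P S y < 1; linarith), ENNReal.toReal_ofReal]
  · rfl
  · exact neg_nonneg.2 (Real.log_nonpos hyS.le (by
      have := distFun_nonneg (P := P) S y
      change 1 - distFun P S y ≤ 1
      linarith))

end Hazard

/-! ### Expansion of the product-limit estimators -/

lemma abs_log_prod_add_sum_le {ι : Type*} (s : Finset ι) {x : ι → ℝ} (h0 : ∀ i ∈ s, 0 ≤ x i)
    (h1 : ∀ i ∈ s, x i ≤ 1 / 2) :
    0 < ∏ i ∈ s, (1 - x i) ∧
      |Real.log (∏ i ∈ s, (1 - x i)) + ∑ i ∈ s, x i| ≤ 2 * ∑ i ∈ s, x i ^ 2 := by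
  have hpos : ∀ i ∈ s, 0 < 1 - x i := fun i hi => by linarith [h1 i hi]
  refine ⟨Finset.prod_pos hpos, ?_⟩
  rw [Real.log_prod fun i hi => (hpos i hi).ne', ← Finset.sum_add_distrib, Finset.mul_sum]
  refine (Finset.abs_sum_le_sum_abs _ _).trans (Finset.sum_le_sum fun i hi => ?_)
  have hx : |x i| < 1 := by rw [abs_of_nonneg (h0 i hi)]; linarith [h1 i hi]
  have h2 := Real.abs_log_sub_add_sum_range_le hx 1
  simp only [Finset.range_one, Finset.sum_singleton, zero_add, pow_one, Nat.cast_zero, div_one,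
    abs_of_nonneg (h0 i hi), Nat.reduceAdd] at h2
  rw [add_comm]
  refine h2.trans ?_
  rw [div_le_iff₀ (hpos i hi)]
  nlinarith [mul_nonneg (sq_nonneg (x i)) (sub_nonneg.2 (h1 i hi))]

/-- A product-limit factor over observations whose risk-set proportions `D i` are uniformly close
to values `C i` bounded away from zero. -/
lemma abs_log_prod_one_sub_add_le {n : ℕ} {s : Finset ℕ} (hs : s ⊆ Finset.range n)
    {C D : ℕ → ℝ} {c ε : ℝ} (hc : 0 < c) (hC : ∀ i ∈ s, c ≤ C i) (hD : ∀ i ∈ s, |D i - C i| ≤ ε)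
    (hε0 : 0 ≤ ε) (hε : ε ≤ c / 2) (hn : 4 ≤ n * c) :
    0 < ∏ i ∈ s, (1 - 1 / (n * D i)) ∧
      |Real.log (∏ i ∈ s, (1 - 1 / (n * D i))) + 1 / n * ∑ i ∈ s, (C i)⁻¹|
        ≤ 2 / c ^ 2 * ε + 8 / c ^ 2 * (1 / n) := by
  have hn0 : (0 : ℝ) < n := by
    by_contra! h
    nlinarith
  have hDc : ∀ i ∈ s, c / 2 ≤ D i := fun i hi => by
    linarith [(abs_le.1 (hD i hi)).1, hC i hi]
  have hx0 : ∀ i ∈ s, 0 ≤ 1 / (n * D i) := fun i hi => by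
    have := hDc i hi
    have : 0 < D i := by linarith
    positivity
  have hx1 : ∀ i ∈ s, 1 / (n * D i) ≤ 2 / c * (1 / n) := fun i hi => by
    rw [show 2 / c * (1 / (n : ℝ)) = 1 / (n * (c / 2)) by field_simp]
    have := hDc i hi
    gcongr
  have hhalf : 2 / c * (1 / (n : ℝ)) ≤ 1 / 2 := by
    rw [div_mul_div_comm, div_le_div_iff₀ (by positivity) two_pos]
    nlinarith
  obtain ⟨hpos, hlog⟩ := abs_log_prod_add_sum_le s hx0 fun i hi => (hx1 i hi).trans hhalf
  refine ⟨hpos, ?_⟩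
  have hcard : (s.card : ℝ) ≤ n := by
    have := Finset.card_le_card hs
    rw [Finset.card_range] at this
    exact_mod_cast this
  have hsq : 2 * ∑ i ∈ s, (1 / (n * D i)) ^ 2 ≤ 8 / c ^ 2 * (1 / n) := by
    calc 2 * ∑ i ∈ s, (1 / (n * D i)) ^ 2 ≤ 2 * ∑ _i ∈ s, (2 / c * (1 / (n : ℝ))) ^ 2 := by
          gcongr with i hi
          · exact hx0 i hi
          · exact hx1 i hi
      _ = 2 * (s.card * (2 / c * (1 / (n : ℝ))) ^ 2) := by rw [Finset.sum_const, nsmul_eq_mul]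
      _ ≤ 2 * (n * (2 / c * (1 / (n : ℝ))) ^ 2) := by gcongr
      _ = _ := by field_simp; norm_num
  have hdiff : |1 / n * ∑ i ∈ s, (C i)⁻¹ - ∑ i ∈ s, 1 / (n * D i)| ≤ 2 / c ^ 2 * ε := by
    rw [Finset.mul_sum, ← Finset.sum_sub_distrib]
    calc _ ≤ ∑ i ∈ s, |1 / n * (C i)⁻¹ - 1 / (n * D i)| := Finset.abs_sum_le_sum_abs _ _
      _ ≤ ∑ _i ∈ s, 1 / n * (2 / c ^ 2 * ε) := by
          refine Finset.sum_le_sum fun i hi => ?_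
          have h1 := hC i hi
          have h2 := hDc i hi
          have h3 : 0 < C i := by linarith
          have h4 : 0 < D i := by linarith
          rw [show 1 / (n : ℝ) * (C i)⁻¹ - 1 / (n * D i) = 1 / n * ((D i - C i) / (C i * D i)) by
            field_simp, abs_mul, abs_of_pos (by positivity : (0 : ℝ) < 1 / n), abs_div,
            abs_of_pos (mul_pos h3 h4)]
          gcongr
          calc |D i - C i| / (C i * D i) ≤ ε / (c * (c / 2)) := by
                gcongr
                exact hD i hi
            _ = _ := by field_simp
      _ = s.card * (1 / n * (2 / c ^ 2 * ε)) := by rw [Finset.sum_const, nsmul_eq_mul]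
      _ ≤ n * (1 / n * (2 / c ^ 2 * ε)) := by gcongr
      _ = _ := by field_simp
  calc _ = |(Real.log (∏ i ∈ s, (1 - 1 / (n * D i))) + ∑ i ∈ s, 1 / (n * D i)) +
        (1 / n * ∑ i ∈ s, (C i)⁻¹ - ∑ i ∈ s, 1 / (n * D i))| := by congr 1; ring
    _ ≤ _ := (abs_add_le _ _).trans (by linarith)

/-- The Lynden-Bell product at `y` is the product over the truncation times in `(y, b]` times a
factor that does not depend on `y`. -/
lemma lyndenBell_eq_prod_mul (n : ℕ) (Z T : ℕ → ℝ) {y b : ℝ} (hyb : y ≤ b) :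
    lyndenBell n Z T y = (∏ i ∈ (Finset.range n).filter (fun i => y < T i ∧ T i ≤ b),
      (1 - 1 / ((n : ℝ) * empC n Z T (T i)))) * lyndenBell n Z T b := by
  unfold lyndenBell
  rw [← Finset.prod_union]
  · congr 1
    ext i
    simp only [Finset.mem_filter, Finset.mem_union]
    constructor
    · rintro ⟨h1, h2⟩
      rcases le_or_gt (T i) b with h | h
      · exact Or.inl ⟨h1, h2, h⟩
      · exact Or.inr ⟨h1, h⟩
    · rintro (h | h)
      · exact ⟨h.1, h.2.1⟩
      · exact ⟨h.1, hyb.trans_lt h.2⟩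
  · rw [Finset.disjoint_left]
    intro i h1 h2
    exact absurd (Finset.mem_filter.1 h2).2 (not_lt.2 (Finset.mem_filter.1 h1).2.2)

lemma one_sub_tjwG_eq_prod (n : ℕ) (Z T : ℕ → ℝ) (δ : ℕ → ℕ) (y : ℝ) :
    1 - tjwG n Z T δ y = ∏ i ∈ (Finset.range n).filter (fun i => δ i = 0 ∧ Z i ≤ y),
      (1 - 1 / ((n : ℝ) * empC n Z T (Z i))) := by
  unfold tjwG
  rw [sub_sub_cancel, Finset.prod_filter, Finset.prod_filter]
  refine Finset.prod_congr rfl fun i _ => ?_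
  by_cases h : δ i = 0
  · simp [h]
  · rw [show 1 - δ i = 0 by omega]
    simp [h]

/-- The Lynden-Bell product does not vanish when each of its factors has at least two subjects at
risk. -/
lemma lyndenBell_ne_zero {n : ℕ} {Z T : ℕ → ℝ} {b : ℝ} (hTZ : ∀ i, T i ≤ Z i)
    (hcov : ∀ i < n, b < T i → ∃ j < n, j ≠ i ∧ T j ≤ T i ∧ T i ≤ Z j) :
    lyndenBell n Z T b ≠ 0 := by
  classical
  unfold lyndenBell
  refine Finset.prod_ne_zero_iff.2 fun i hi => ?_
  obtain ⟨hin, hbi⟩ := Finset.mem_filter.1 hi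
  have hin' := Finset.mem_range.1 hin
  obtain ⟨j, hj, hji, h1, h2⟩ := hcov i hin' hbi
  have hn : (n : ℝ) ≠ 0 := by
    have : 0 < n := by omega
    positivity
  have hsub : ({i, j} : Finset ℕ) ⊆ Finset.range n := by
    intro k hk
    rcases Finset.mem_insert.1 hk with rfl | hk
    · exact hin
    · rw [Finset.mem_singleton.1 hk]; exact Finset.mem_range.2 hj
  have h3 : (2 : ℝ) ≤ n * empC n Z T (T i) := by
    unfold empC
    rw [← mul_assoc, mul_one_div_cancel hn, one_mul]
    refine le_trans ?_ (Finset.sum_le_sum_of_subset_of_nonneg hsub fun k _ _ => by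
      split_ifs <;> norm_num)
    rw [Finset.sum_pair hji.symm, if_pos ⟨le_rfl, hTZ i⟩, if_pos ⟨h1, h2⟩]
    norm_num
  have h4 : 1 / (n * empC n Z T (T i)) ≤ 1 / 2 := by gcongr
  exact (by linarith : (0 : ℝ) < 1 - 1 / (n * empC n Z T (T i))).ne'

/-! ### Almost sure rate of the estimated weights -/

section Weights

variable {F Ω₀ Ω : Type*} [MeasurableSpace F] [MeasurableSpace Ω₀] [MeasurableSpace Ω]
  {P : Measure Ω₀} [IsProbabilityMeasure P] {X : Ω₀ → F} {Y T S : Ω₀ → ℝ}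
  {Q : Measure Ω} [IsProbabilityMeasure Q] {o : ℕ → Ω → F × ℝ × ℝ × ℕ}

/-- Almost surely there are eventually no holes beyond `b`: every truncation time there is covered
by a second subject at risk, so that no factor of the Lynden-Bell product is zero. -/
lemma IsModel.ae_eventually_lyndenBell_ne_zero (h : IsModel P X Y T S)
    (ho : IsIID Q (observedLaw P X Y T S) o) {b : ℝ} (hb : 0 < distFun P T b) :
    ∀ᵐ ω ∂Q, ∀ᶠ n in atTop,
      lyndenBell n (fun i => (o i ω).2.1) (fun i => (o i ω).2.2.1) b ≠ 0 := by
  have := h.isProbabilityMeasure_observedLaw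
  have hTZ : ∀ᵐ o ∂(observedLaw P X Y T S), o.2.2.1 ≤ o.2.1 :=
    h.ae_observedLaw (measurableSet_le (by fun_prop) (by fun_prop)) (ae_of_all _ fun ω hω => hω)
  have hcov := ho.ae_eventually_covered
    (V := {q | q.2.2.2.1 ≤ q.1.2.2.1 ∧ q.1.2.2.1 ≤ q.2.2.1}) (A := {o | b < o.2.2.1})
    (measurableSet_setOf_and (measurableSet_le (by fun_prop) (by fun_prop))
      (measurableSet_le (by fun_prop) (by fun_prop)))
    (measurableSet_lt (by fun_prop) (by fun_prop)) (h.lintegral_inv_atRisk_ne_top hb)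
  filter_upwards [ho.ae_forall hTZ, hcov] with ω h1 h2
  filter_upwards [h2] with n hn
  exact lyndenBell_ne_zero h1 hn

/-- Up to a factor that does not depend on the evaluation point, the product of the two
product-limit estimators is within a relative error `O(√(log n / n))` of `L(y) (1 - G(y))`, for the
evaluation points `y = Z_j` in `[a, b]`. The factor is the ratio of the Lynden-Bell estimator at
`b` to its target; there is no control over it beyond its not vanishing. -/
lemma IsModel.ae_eventually_weights (h : IsModel P X Y T S)
    (ho : IsIID Q (observedLaw P X Y T S) o) {a b : ℝ} (ha : 0 < distFun P T a)
    (haZ : ∀ᵐ ω ∂P, a ≤ censored Y S ω) (hac : ∀ t, a < t → ContinuousAt (distFun P T) t)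
    (hb : 0 < P {ω | b < censored Y S ω}) (hab : a ≤ b) :
    ∃ c : ℝ, ∀ᵐ ω ∂Q, ∀ᶠ n : ℕ in atTop, ∃ s : ℝ, s ≠ 0 ∧ ∀ j < n, (o j ω).2.1 ≤ b →
      ∃ θ : ℝ, |θ| ≤ c * √(Real.log n / n) ∧
        lyndenBell n (fun i => (o i ω).2.1) (fun i => (o i ω).2.2.1) (o j ω).2.1 *
          (1 - tjwG n (fun i => (o i ω).2.1) (fun i => (o i ω).2.2.1)
            (fun i => (o i ω).2.2.2) (o j ω).2.1) =
        s * (distFun P T (o j ω).2.1 * (1 - distFun P S (o j ω).2.1)) * Real.exp θ := by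
  have hμ := h.isProbabilityMeasure_observedLaw
  obtain ⟨c₀, hc₀, hrisk⟩ := h.exists_le_atRisk ha hb
  have hLb := ha.trans_le (monotone_distFun (P := P) T hab)
  have hm := measurable_atRisk (P := P) (Y := Y) (T := T) (S := S)
  have hinv : ∀ t, a ≤ t → t ≤ b → |(atRisk P Y T S t)⁻¹| ≤ c₀⁻¹ := by
    intro t h1 h2
    have := hrisk t h1 h2
    rw [abs_of_nonneg (inv_nonneg.2 (hc₀.le.trans this))]
    exact inv_anti₀ hc₀ this
  have hc₀' : (0 : ℝ) ≤ c₀⁻¹ := by positivity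
  -- empirical proportions at risk, at the truncation times and at the censored responses
  obtain ⟨c₁, h₁⟩ := ho.ae_eventually_kernel_average (M := 1)
    (g := fun o o' => if o'.2.2.1 ≤ o.2.2.1 ∧ o.2.2.1 ≤ o'.2.1 then (1 : ℝ) else 0)
    (Measurable.ite (measurableSet_setOf_and (measurableSet_le (by fun_prop) (by fun_prop))
      (measurableSet_le (by fun_prop) (by fun_prop))) measurable_const measurable_const)
    (fun o o' => by split_ifs <;> simp)
  obtain ⟨c₂, h₂⟩ := ho.ae_eventually_kernel_average (M := 1)
    (g := fun o o' => if o'.2.2.1 ≤ o.2.1 ∧ o.2.1 ≤ o'.2.1 then (1 : ℝ) else 0)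
    (Measurable.ite (measurableSet_setOf_and (measurableSet_le (by fun_prop) (by fun_prop))
      (measurableSet_le (by fun_prop) (by fun_prop))) measurable_const measurable_const)
    (fun o o' => by split_ifs <;> simp)
  -- cumulative hazards of truncation and of censoring, with the true risk-set proportions
  obtain ⟨c₃, h₃⟩ := ho.ae_eventually_kernel_average (M := c₀⁻¹)
    (g := fun o o' => if a ≤ o.2.1 ∧ o.2.1 < o'.2.2.1 ∧ o'.2.2.1 ≤ b then
      (atRisk P Y T S o'.2.2.1)⁻¹ else 0)
    (Measurable.ite (measurableSet_setOf_and (measurableSet_le (by fun_prop) (by fun_prop))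
      (measurableSet_setOf_and (measurableSet_lt (by fun_prop) (by fun_prop))
      (measurableSet_le (by fun_prop) (by fun_prop)))) (by fun_prop) measurable_const)
    (fun o o' => by
      split_ifs with h'
      · exact hinv _ (h'.1.trans h'.2.1.le) h'.2.2
      · simpa using hc₀.le)
  obtain ⟨c₄, h₄⟩ := ho.ae_eventually_kernel_average (M := c₀⁻¹)
    (g := fun o o' => if o.2.1 ≤ b ∧ o'.2.2.2 = 0 ∧ a ≤ o'.2.1 ∧ o'.2.1 ≤ o.2.1 then
      (atRisk P Y T S o'.2.1)⁻¹ else 0)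
    (Measurable.ite (measurableSet_setOf_and (measurableSet_le (by fun_prop) (by fun_prop))
      (measurableSet_setOf_and ((by fun_prop : Measurable
          fun q : (F × ℝ × ℝ × ℕ) × (F × ℝ × ℝ × ℕ) => q.2.2.2.2) (measurableSet_singleton 0))
      (measurableSet_setOf_and (measurableSet_le (by fun_prop) (by fun_prop))
      (measurableSet_le (by fun_prop) (by fun_prop))))) (by fun_prop) measurable_const)
    (fun o o' => by
      split_ifs with h'
      · exact hinv _ h'.2.2.1 (h'.2.2.2.trans h'.1)
      · simpa using hc₀.le)
  have hZ : ∀ᵐ o ∂(observedLaw P X Y T S), a ≤ o.2.1 ∧ 0 < o.2.1 := by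
    refine h.ae_observedLaw (measurableSet_setOf_and (measurableSet_le (by fun_prop)
      (by fun_prop)) (measurableSet_lt (by fun_prop) (by fun_prop))) ?_
    filter_upwards [haZ, h.pos_Y, h.pos_S] with ω h1 h2 h3 _ using ⟨h1, lt_min h2 h3⟩
  set e₁ := max |c₁| |c₂| with he₁
  refine ⟨(4 * e₁ + 16) / c₀ ^ 2 + |c₃| + |c₄|, ?_⟩
  have hsmall : ∀ᶠ n : ℕ in atTop, e₁ * √(Real.log n / n) ≤ c₀ / 2 := by
    have : Tendsto (fun n : ℕ => e₁ * √(Real.log n / n)) atTop (𝓝 (e₁ * √0)) :=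
      ((Real.continuous_sqrt.tendsto _).comp tendsto_log_div_self).const_mul _
    exact this.eventually (Iic_mem_nhds (by simpa using by positivity))
  have hlarge : ∀ᶠ n : ℕ in atTop, 4 ≤ (n : ℝ) * c₀ :=
    (tendsto_natCast_atTop_atTop.atTop_mul_const hc₀).eventually_ge_atTop 4
  filter_upwards [h₁, h₂, h₃, h₄, ho.ae_forall hZ, h.ae_eventually_lyndenBell_ne_zero ho hLb]
    with ω h₁ h₂ h₃ h₄ hZω hne
  filter_upwards [h₁, h₂, h₃, h₄, hne, hsmall, hlarge, eventually_one_le_log,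
    eventually_ge_atTop 1] with n h₁ h₂ h₃ h₄ hne hsmall hlarge hlog hn1
  have hn0 : (0 : ℝ) < n := by exact_mod_cast hn1
  set Z : ℕ → ℝ := fun i => (o i ω).2.1 with hZdef
  set T' : ℕ → ℝ := fun i => (o i ω).2.2.1 with hT'
  set δ : ℕ → ℕ := fun i => (o i ω).2.2.2 with hδ
  set r := √(Real.log n / n) with hr
  have hr0 : 0 ≤ r := Real.sqrt_nonneg _
  have hr1 : 1 / (n : ℝ) ≤ r := by
    refine Real.le_sqrt_of_sq_le ?_
    rw [div_pow, one_pow, div_le_div_iff₀ (by positivity) hn0]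
    have : (1 : ℝ) ≤ n := by exact_mod_cast hn1
    nlinarith [mul_le_mul hlog this zero_le_one (by linarith)]
  have hscale : ∀ (c A B : ℝ), |A - n * B| ≤ c * √(n * Real.log n) → |1 / n * A - B| ≤ |c| * r := by
    intro c A B hAB
    have h1 : √(n * Real.log n) = n * r := by
      rw [hr, show (n : ℝ) * Real.log n = n ^ 2 * (Real.log n / n) by field_simp,
        Real.sqrt_mul (by positivity), Real.sqrt_sq hn0.le]
    rw [show 1 / (n : ℝ) * A - B = 1 / n * (A - n * B) by field_simp, abs_mul,
      abs_of_pos (by positivity : (0 : ℝ) < 1 / n)]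
    calc 1 / (n : ℝ) * |A - n * B| ≤ 1 / n * (|c| * (n * r)) := by
          gcongr
          rw [← h1]
          exact hAB.trans (by gcongr; exact le_abs_self c)
      _ = |c| * r := by field_simp
  have hT : ∀ i < n, |empC n Z T' (T' i) - atRisk P Y T S (T' i)| ≤ e₁ * r := by
    intro i hi
    refine (hscale c₁ _ _ ?_).trans (mul_le_mul_of_nonneg_right (le_max_left _ _) hr0)
    have := h₁ i hi
    rw [h.integral_atRisk] at this
    exact this
  have hZr : ∀ i < n, |empC n Z T' (Z i) - atRisk P Y T S (Z i)| ≤ e₁ * r := by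
    intro i hi
    refine (hscale c₂ _ _ ?_).trans (mul_le_mul_of_nonneg_right (le_max_right _ _) hr0)
    have := h₂ i hi
    rw [h.integral_atRisk] at this
    exact this
  have he₁r : 0 ≤ e₁ * r := by positivity
  refine ⟨lyndenBell n Z T' b / distFun P T b, div_ne_zero hne hLb.ne', fun j hj hjb => ?_⟩
  have hja : a ≤ Z j := (hZω j).1
  have hLj : 0 < distFun P T (Z j) := ha.trans_le (monotone_distFun T hja)
  obtain ⟨hp1, hl1⟩ := abs_log_prod_one_sub_add_le (n := n)
    (s := (Finset.range n).filter (fun i => Z j < T' i ∧ T' i ≤ b)) (Finset.filter_subset _ _)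
    (C := fun i => atRisk P Y T S (T' i)) (D := fun i => empC n Z T' (T' i)) hc₀
    (fun i hi => hrisk _ (hja.trans (Finset.mem_filter.1 hi).2.1.le) (Finset.mem_filter.1 hi).2.2)
    (fun i hi => hT i (Finset.mem_range.1 (Finset.mem_filter.1 hi).1)) he₁r hsmall hlarge
  obtain ⟨hp2, hl2⟩ := abs_log_prod_one_sub_add_le (n := n)
    (s := (Finset.range n).filter (fun i => δ i = 0 ∧ Z i ≤ Z j)) (Finset.filter_subset _ _)
    (C := fun i => atRisk P Y T S (Z i)) (D := fun i => empC n Z T' (Z i)) hc₀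
    (fun i hi => hrisk _ (hZω i).1 ((Finset.mem_filter.1 hi).2.2.trans hjb))
    (fun i hi => hZr i (Finset.mem_range.1 (Finset.mem_filter.1 hi).1)) he₁r hsmall hlarge
  have hm3 : |1 / n * ∑ i ∈ (Finset.range n).filter (fun i => Z j < T' i ∧ T' i ≤ b),
      (atRisk P Y T S (T' i))⁻¹ - Real.log (distFun P T b / distFun P T (Z j))| ≤ |c₃| * r := by
    refine hscale c₃ _ _ ?_
    have := h₃ j hj
    simp only [show a ≤ (o j ω).2.1 from hja, true_and] at this
    rw [h.integral_truncation_hazard ha hac hb hja hjb] at this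
    rw [Finset.sum_filter]
    exact this
  have hm4 : |1 / n * ∑ i ∈ (Finset.range n).filter (fun i => δ i = 0 ∧ Z i ≤ Z j),
      (atRisk P Y T S (Z i))⁻¹ - -Real.log (1 - distFun P S (Z j))| ≤ |c₄| * r := by
    refine hscale c₄ _ _ ?_
    have := h₄ j hj
    simp only [hjb, true_and] at this
    rw [h.integral_censoring_hazard ha haZ hb (hZω j).2.le hjb] at this
    simp only [(hZω _).1, true_and] at this
    rw [Finset.sum_filter]
    exact this
  have hS1 : 0 < 1 - distFun P S (Z j) := h.one_sub_distFun_pos hjb hb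
  set p₁ := ∏ i ∈ (Finset.range n).filter (fun i => Z j < T' i ∧ T' i ≤ b),
    (1 - 1 / ((n : ℝ) * empC n Z T' (T' i))) with hp₁
  set p₂ := ∏ i ∈ (Finset.range n).filter (fun i => δ i = 0 ∧ Z i ≤ Z j),
    (1 - 1 / ((n : ℝ) * empC n Z T' (Z i))) with hp₂
  refine ⟨Real.log p₁ + Real.log (distFun P T b / distFun P T (Z j)) +
    (Real.log p₂ - Real.log (1 - distFun P S (Z j))), ?_, ?_⟩
  · have hn8 : 8 / c₀ ^ 2 * (1 / (n : ℝ)) ≤ 8 / c₀ ^ 2 * r := by gcongr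
    have hfin : ((4 * e₁ + 16) / c₀ ^ 2 + |c₃| + |c₄|) * r =
      2 * (2 / c₀ ^ 2 * (e₁ * r)) + 2 * (8 / c₀ ^ 2 * r) + |c₃| * r + |c₄| * r := by
      field_simp; ring
    rw [hfin]
    rw [abs_le] at hl1 hl2 hm3 hm4 ⊢
    constructor <;> linarith [hl1.1, hl2.1, hm3.1, hm4.1, hl1.2, hl2.2, hm3.2, hm4.2]
  · rw [lyndenBell_eq_prod_mul n Z T' hjb, one_sub_tjwG_eq_prod, ← hp₁, ← hp₂, Real.exp_add,
      Real.exp_sub, Real.exp_add, Real.exp_log hp1, Real.exp_log hp2, Real.exp_log hS1,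
      Real.exp_log (div_pos hLb hLj)]
    have : distFun P T (o j ω).2.1 = distFun P T (Z j) := rfl
    have : distFun P S (o j ω).2.1 = distFun P S (Z j) := rfl
    simp only [hZdef] at *
    field_simp

end Weights

/-! ### Inverse moments near the point of estimation -/

section Moments

variable {F Ω₀ : Type*} [MeasurableSpace F] [MeasurableSpace Ω₀] {P : Measure Ω₀}
  {X : Ω₀ → F} {Y : Ω₀ → ℝ}

lemma IsCondInvMoment.lintegral_mul {m : ℕ} {g : F → ℝ≥0∞} (hg : IsCondInvMoment P X Y m g)
    (hX : Measurable X) (hY : Measurable Y) {f : F → ℝ≥0∞} (hf : Measurable f) :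
    ∫⁻ ω, f (X ω) * ENNReal.ofReal ((Y ω)⁻¹ ^ m) ∂P = ∫⁻ x, f x * g x ∂(P.map X) := by
  have hYm : Measurable fun ω => ENNReal.ofReal ((Y ω)⁻¹ ^ m) := by fun_prop
  have h1 : (P.withDensity fun ω => ENNReal.ofReal ((Y ω)⁻¹ ^ m)).map X =
      (P.map X).withDensity g := by
    ext B hB
    rw [Measure.map_apply hX hB, withDensity_apply _ (hX hB), withDensity_apply _ hB, hg.2 B hB]
  calc ∫⁻ ω, f (X ω) * ENNReal.ofReal ((Y ω)⁻¹ ^ m) ∂P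
      = ∫⁻ ω, f (X ω) ∂(P.withDensity fun ω => ENNReal.ofReal ((Y ω)⁻¹ ^ m)) := by
        have hfX : Measurable fun ω => f (X ω) := hf.comp hX
        rw [lintegral_withDensity_eq_lintegral_mul _ hYm hfX]
        exact lintegral_congr fun ω => mul_comm _ _
    _ = ∫⁻ x, f x ∂((P.map X).withDensity g) := by rw [← h1, lintegral_map hf hX]
    _ = _ := by
        rw [lintegral_withDensity_eq_lintegral_mul _ hg.1 hf]
        exact lintegral_congr fun ω => mul_comm _ _

lemma IsCondInvMoment.setLIntegral_le {m : ℕ} {g : F → ℝ≥0∞} (hg : IsCondInvMoment P X Y m g)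
    (hX : Measurable X) {B : Set F} (hB : MeasurableSet B) {c : ℝ≥0} (hc : ∀ x ∈ B, g x ≤ c) :
    ∫⁻ ω in X ⁻¹' B, ENNReal.ofReal ((Y ω)⁻¹ ^ m) ∂P ≤ c * P (X ⁻¹' B) := by
  rw [hg.2 B hB]
  refine (setLIntegral_mono' hB hc).trans_eq ?_
  rw [setLIntegral_const, Measure.map_apply hX hB]

end Moments

section Local

variable {F Ω₀ : Type*} [PseudoMetricSpace F] [MeasurableSpace F]
  [MeasurableSpace Ω₀] {P : Measure Ω₀} {X : Ω₀ → F} {Y : Ω₀ → ℝ}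
  {x₀ : F}

/-- A conditional moment of order `-ℓ` is at least `b ^ (-ℓ)` at a continuity point where the
response is locally bounded by `b`. -/
lemma IsCondInvMoment.inv_pow_le [OpensMeasurableSpace F] [IsProbabilityMeasure P] {ℓ : ℕ}
    {r : F → ℝ} (hr : IsCondInvMoment P X Y ℓ fun x => ENNReal.ofReal (r x)) (hX : Measurable X)
    (hY0 : ∀ᵐ ω ∂P, 0 < Y ω) {s₀ b : ℝ} (hs₀ : 0 < s₀)
    (hYb : ∀ᵐ ω ∂P, dist x₀ (X ω) ≤ s₀ → Y ω ≤ b)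
    (hφ : ∀ ρ : ℝ, 0 < ρ → 0 < smallBall P X x₀ ρ) {k c : ℝ} (hk : 0 < k)
    (hc : ∀ x, dist x₀ x ≤ s₀ → |r x - r x₀| ≤ c * dist x₀ x ^ k) (hc0 : 0 ≤ c) :
    b⁻¹ ^ ℓ ≤ r x₀ := by
  -- the values of `r` away from `x₀` enter through `ENNReal.ofReal`, hence the positive part
  have key : ∀ s ∈ Set.Ioc 0 s₀, b⁻¹ ^ ℓ ≤ max (r x₀ + c * s ^ k) 0 := by
    intro s hs
    set B := Metric.closedBall x₀ s with hB
    have hBm : MeasurableSet B := Metric.isClosed_closedBall.measurableSet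
    have hBs : ∀ x ∈ B, dist x₀ x ≤ s := fun x hx => by rw [dist_comm]; exact hx
    have hP : P (X ⁻¹' B) ≠ 0 := fun h0 => by
      have := hφ s hs.1
      rw [smallBall, measureReal_def, h0] at this
      simp at this
    have h1 : ENNReal.ofReal (b⁻¹ ^ ℓ) * P (X ⁻¹' B) ≤
        ENNReal.ofReal (r x₀ + c * s ^ k) * P (X ⁻¹' B) := by
      calc ENNReal.ofReal (b⁻¹ ^ ℓ) * P (X ⁻¹' B)
          = ∫⁻ _ in X ⁻¹' B, ENNReal.ofReal (b⁻¹ ^ ℓ) ∂P := by rw [setLIntegral_const]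
        _ ≤ ∫⁻ ω in X ⁻¹' B, ENNReal.ofReal ((Y ω)⁻¹ ^ ℓ) ∂P := by
            refine setLIntegral_mono_ae' (hX hBm) ?_
            filter_upwards [hY0, hYb] with ω h1 h2 h3
            have h4 := h2 ((hBs _ h3).trans hs.2)
            refine ENNReal.ofReal_le_ofReal (pow_le_pow_left₀ ?_ (inv_anti₀ h1 h4) _)
            exact inv_nonneg.2 (h1.le.trans h4)
        _ = ∫⁻ x in B, ENNReal.ofReal (r x) ∂(P.map X) := hr.2 B hBm
        _ ≤ ∫⁻ _ in B, ENNReal.ofReal (r x₀ + c * s ^ k) ∂(P.map X) := by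
            refine setLIntegral_mono' hBm fun x hx => ENNReal.ofReal_le_ofReal ?_
            have h5 := (abs_le.1 (hc x ((hBs x hx).trans hs.2))).2
            have h6 : dist x₀ x ^ k ≤ s ^ k := Real.rpow_le_rpow dist_nonneg (hBs x hx) hk.le
            nlinarith
        _ = _ := by rw [setLIntegral_const, Measure.map_apply hX hBm]
    have h2 := (ENNReal.mul_le_mul_iff_left hP (measure_ne_top _ _)).1 h1
    rw [← ENNReal.ofReal_toReal (a := ENNReal.ofReal (r x₀ + c * s ^ k)) ENNReal.ofReal_ne_top,
      ENNReal.ofReal_le_ofReal_iff ENNReal.toReal_nonneg, ENNReal.toReal_ofReal'] at h2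
    exact h2
  -- `b` is positive, since the ball has positive probability
  have hb : 0 < b := by
    by_contra! hb
    have := hφ s₀ hs₀
    rw [smallBall, measureReal_def] at this
    have h0 : P (X ⁻¹' Metric.closedBall x₀ s₀) = 0 := by
      rw [measure_eq_zero_iff_ae_notMem]
      filter_upwards [hY0, hYb] with ω h1 h2 h3
      have h4 : dist (X ω) x₀ ≤ s₀ := h3
      rw [dist_comm] at h4
      linarith [h2 h4]
    rw [h0] at this
    simp at this
  have hlim : Tendsto (fun s : ℝ => max (r x₀ + c * s ^ k) 0) (𝓝[>] 0) (𝓝 (max (r x₀) 0)) := by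
    have h1 : Tendsto (fun s : ℝ => s ^ k) (𝓝[>] 0) (𝓝 (0 ^ k)) :=
      ((Real.continuousAt_rpow_const 0 k (Or.inr hk.le)).tendsto).mono_left nhdsWithin_le_nhds
    rw [Real.zero_rpow hk.ne'] at h1
    have h2 := ((h1.const_mul c).const_add (r x₀)).max (tendsto_const_nhds (x := (0 : ℝ)))
    simpa using h2
  have h3 : b⁻¹ ^ ℓ ≤ max (r x₀) 0 := by
    refine ge_of_tendsto hlim ?_
    filter_upwards [Ioc_mem_nhdsGT hs₀] with s hs using key s hs
  have h4 : 0 < b⁻¹ ^ ℓ := by positivity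
  rcases le_max_iff.1 h3 with h5 | h5
  · exact h5
  · linarith

/-- The kernel bias: Hölder continuity of the conditional moment on the support of the kernel. -/
lemma IsCondInvMoment.abs_toReal_sub_le {ℓ : ℕ} {r : F → ℝ}
    (hr : IsCondInvMoment P X Y ℓ fun x => ENNReal.ofReal (r x)) (hX : Measurable X)
    (hY : Measurable Y) (hr0 : 0 ≤ r x₀) {k c : ℝ} (hk : 0 < k) (hc0 : 0 ≤ c)
    {h : ℝ} (hh : 0 ≤ h)
    (hc : ∀ x, dist x₀ x ≤ h → |r x - r x₀| ≤ c * dist x₀ x ^ k)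
    {κ : F → ℝ} (hκm : Measurable κ) (hκ0 : ∀ x, 0 ≤ κ x) (hκ : ∀ x, h < dist x₀ x → κ x = 0)
    (hκi : Integrable (fun ω => κ (X ω)) P) :
    |(∫⁻ ω, ENNReal.ofReal (κ (X ω)) * ENNReal.ofReal ((Y ω)⁻¹ ^ ℓ) ∂P).toReal
      - r x₀ * ∫ ω, κ (X ω) ∂P| ≤ c * h ^ k * ∫ ω, κ (X ω) ∂P := by
  have hκX := ofReal_integral_eq_lintegral_ofReal hκi (ae_of_all _ fun ω => hκ0 _)
  have hI0 : 0 ≤ ∫ ω, κ (X ω) ∂P := integral_nonneg fun ω => hκ0 _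
  have hm : Measurable fun x => ENNReal.ofReal (κ x) := by fun_prop
  rw [hr.lintegral_mul hX hY hm]
  have hpt : ∀ x, κ x ≠ 0 → |r x - r x₀| ≤ c * h ^ k := by
    intro x hx
    have h1 : dist x₀ x ≤ h := by
      by_contra! h2
      exact hx (hκ x h2)
    exact (hc x h1).trans (mul_le_mul_of_nonneg_left
      (Real.rpow_le_rpow dist_nonneg h1 hk.le) hc0)
  have hup : ∫⁻ x, ENNReal.ofReal (κ x) * ENNReal.ofReal (r x) ∂(P.map X) ≤
      ENNReal.ofReal ((r x₀ + c * h ^ k) * ∫ ω, κ (X ω) ∂P) := by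
    calc _ ≤ ∫⁻ x, ENNReal.ofReal (κ x) * ENNReal.ofReal (r x₀ + c * h ^ k) ∂(P.map X) := by
          refine lintegral_mono fun x => ?_
          by_cases hx : κ x = 0
          · simp [hx]
          · have := (abs_le.1 (hpt x hx)).2
            gcongr
            linarith
      _ = _ := by
          rw [lintegral_mul_const _ hm, lintegral_map hm hX, ← hκX, mul_comm (r x₀ + c * h ^ k),
            ENNReal.ofReal_mul hI0]
  have hlow : ENNReal.ofReal ((r x₀ - c * h ^ k) * ∫ ω, κ (X ω) ∂P) ≤
      ∫⁻ x, ENNReal.ofReal (κ x) * ENNReal.ofReal (r x) ∂(P.map X) := by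
    calc _ = ∫⁻ x, ENNReal.ofReal (κ x) * ENNReal.ofReal (r x₀ - c * h ^ k) ∂(P.map X) := by
          rw [lintegral_mul_const _ hm, lintegral_map hm hX, ← hκX, mul_comm (r x₀ - c * h ^ k),
            ENNReal.ofReal_mul hI0]
      _ ≤ _ := by
          refine lintegral_mono fun x => ?_
          by_cases hx : κ x = 0
          · simp [hx]
          · have := (abs_le.1 (hpt x hx)).1
            gcongr
            linarith
  have hfin := ne_top_of_le_ne_top ENNReal.ofReal_ne_top hup
  have h1 := (ENNReal.ofReal_le_iff_le_toReal hfin).1 hlow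
  have hch : 0 ≤ r x₀ + c * h ^ k := by positivity
  have h2 := ENNReal.toReal_le_of_le_ofReal (mul_nonneg hch hI0) hup
  rw [abs_le]
  constructor <;> linarith

end Local

/-! ### Kernel sums with the true weights -/

section Oracle

variable {F Ω₀ Ω : Type*} [PseudoMetricSpace F] [MeasurableSpace F] [OpensMeasurableSpace F]
  [MeasurableSpace Ω₀] [MeasurableSpace Ω]
  {P : Measure Ω₀} {X : Ω₀ → F} {Y T S : Ω₀ → ℝ}
  {Q : Measure Ω} [IsProbabilityMeasure Q] {o : ℕ → Ω → F × ℝ × ℝ × ℕ}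

open Classical in
/-- The contribution `δ K(d(x₀, χ) / h) Z^{-ℓ} / (L(Z) (1 - G(Z)))` of an observation to the kernel
sum in which the product-limit estimators are replaced by their targets. It is cut to the ball of
radius `s₀` around `x₀` and to responses in `[a, b]`, where `L` and `1 - G` are bounded away from
zero; for `h ≤ s₀` this changes nothing almost surely. -/
noncomputable def oracleTerm (P : Measure Ω₀) (T S : Ω₀ → ℝ) (x₀ : F) (s₀ a b : ℝ) (K : ℝ → ℝ)
    (ℓ : ℕ) (h : ℝ) (o : F × ℝ × ℝ × ℕ) : ℝ :=
  if o.2.2.2 = 1 ∧ dist x₀ o.1 ≤ s₀ ∧ a ≤ o.2.1 ∧ 0 < o.2.1 ∧ o.2.1 ≤ b then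
    K (dist x₀ o.1 / h) * o.2.1⁻¹ ^ ℓ / (distFun P T o.2.1 * (1 - distFun P S o.2.1)) else 0

lemma measurable_oracleTerm {x₀ : F} {s₀ a b : ℝ} {K : ℝ → ℝ} (hK : Measurable K) (ℓ : ℕ) (h : ℝ) :
    Measurable (oracleTerm P T S x₀ s₀ a b K ℓ h) := by
  have hd : Measurable fun o : F × ℝ × ℝ × ℕ => dist x₀ o.1 :=
    (continuous_const.dist continuous_id).measurable.comp measurable_fst
  have hL := (monotone_distFun (P := P) T).measurable
  have hG := (monotone_distFun (P := P) S).measurable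
  refine Measurable.ite ?_ ?_ measurable_const
  · refine measurableSet_setOf_and ((by fun_prop : Measurable fun o : F × ℝ × ℝ × ℕ => o.2.2.2)
      (measurableSet_singleton 1)) (measurableSet_setOf_and (measurableSet_le hd measurable_const)
      (measurableSet_setOf_and (measurableSet_le (by fun_prop) (by fun_prop))
      (measurableSet_setOf_and (measurableSet_lt (by fun_prop) (by fun_prop))
      (measurableSet_le (by fun_prop) (by fun_prop)))))
  · fun_prop

variable [IsProbabilityMeasure P]

/-- The weights undo the effect of truncation and censoring: up to the factor `1 / P(Z ≥ T)`, an
oracle term has mean `E[K(d(x₀, χ) / h) Y^{-ℓ}]`. -/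
lemma IsModel.integral_oracleTerm (h : IsModel P X Y T S) {x₀ : F} {s₀ a b : ℝ}
    (ha : 0 < distFun P T a) (haZ : ∀ᵐ ω ∂P, a ≤ censored Y S ω)
    (hb : 0 < P {ω | b < censored Y S ω}) (hYb : ∀ᵐ ω ∂P, dist x₀ (X ω) ≤ s₀ → Y ω ≤ b)
    {K : ℝ → ℝ} (hK : Measurable K) (hK0 : ∀ u, 0 ≤ K u) (hK1 : ∀ u, 1 < u → K u = 0) (ℓ : ℕ)
    {η : ℝ} (hη : 0 < η) (hηs : η ≤ s₀) :
    ∫ o, oracleTerm P T S x₀ s₀ a b K ℓ η o ∂(observedLaw P X Y T S) =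
      (P.real (retained Y T S))⁻¹ * (∫⁻ ω, ENNReal.ofReal (K (dist x₀ (X ω) / η)) *
        ENNReal.ofReal ((Y ω)⁻¹ ^ ℓ) ∂P).toReal := by
  classical
  have hd : Measurable fun q : F × ℝ => dist x₀ q.1 :=
    (continuous_const.dist continuous_id).measurable.comp measurable_fst
  have hL := (monotone_distFun (P := P) T).measurable
  have hG := (monotone_distFun (P := P) S).measurable
  set g : F × ℝ → ℝ≥0∞ := fun q => if dist x₀ q.1 ≤ s₀ ∧ a ≤ q.2 ∧ 0 < q.2 ∧ q.2 ≤ b then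
    ENNReal.ofReal (K (dist x₀ q.1 / η) * q.2⁻¹ ^ ℓ / (distFun P T q.2 * (1 - distFun P S q.2)))
    else 0 with hg
  have hgm : Measurable g := by
    refine Measurable.ite (measurableSet_setOf_and (measurableSet_le hd measurable_const)
      (measurableSet_setOf_and (measurableSet_le (by fun_prop) (by fun_prop))
      (measurableSet_setOf_and (measurableSet_lt (by fun_prop) (by fun_prop))
      (measurableSet_le (by fun_prop) (by fun_prop))))) ?_ measurable_const
    fun_prop
  have hnonneg : ∀ o, 0 ≤ oracleTerm P T S x₀ s₀ a b K ℓ η o := by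
    intro o
    unfold oracleTerm
    split_ifs with hc
    · have h1 := distFun_nonneg (P := P) T o.2.1
      have h2 := sub_nonneg.2 (distFun_le_one (P := P) S o.2.1)
      have h3 := hK0 (dist x₀ o.1 / η)
      have h4 := hc.2.2.2.1.le
      positivity
    · exact le_rfl
  rw [integral_eq_lintegral_of_nonneg_ae (ae_of_all _ hnonneg)
    (measurable_oracleTerm hK ℓ η).aestronglyMeasurable]
  have h1 : ∫⁻ o, ENNReal.ofReal (oracleTerm P T S x₀ s₀ a b K ℓ η o) ∂(observedLaw P X Y T S) =
      ∫⁻ o, (if o.2.2.2 = 1 then g (o.1, o.2.1) else 0) ∂(observedLaw P X Y T S) := by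
    refine lintegral_congr fun o => ?_
    simp only [oracleTerm, hg]
    by_cases h0 : o.2.2.2 = 1
    · simp only [h0, true_and, if_true]
      split_ifs <;> simp
    · simp [h0]
  rw [h1, h.lintegral_uncensored hgm, ENNReal.toReal_mul, ENNReal.toReal_inv, ← measureReal_def]
  congr 2
  refine lintegral_congr_ae ?_
  filter_upwards [haZ, h.pos_Y, hYb] with ω h2 h3 h4
  have haY : a ≤ Y ω := h2.trans (min_le_left _ _)
  by_cases h5 : dist x₀ (X ω) ≤ s₀
  · have hYb' := h4 h5
    have h6 : 0 < distFun P T (Y ω) := ha.trans_le (monotone_distFun T haY)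
    have h7 : 0 < 1 - distFun P S (Y ω) := h.one_sub_distFun_pos hYb' hb
    have h8 := hK0 (dist x₀ (X ω) / η)
    simp only [hg]
    rw [if_pos ⟨h5, haY, h3, hYb'⟩, ← ofReal_distFun h.measurable_T,
      ← ofReal_one_sub_distFun h.measurable_S h.continuous_S, ← ENNReal.ofReal_mul h6.le,
      ← ENNReal.ofReal_mul (by positivity), ← ENNReal.ofReal_mul h8]
    congr 1
    field_simp
  · simp only [hg]
    rw [if_neg fun h' => h5 h'.1, zero_mul, hK1 _ ((one_lt_div hη).2
      (hηs.trans_lt (not_le.1 h5))), ENNReal.ofReal_zero, zero_mul]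

open Classical in
/-- An envelope, free of the bandwidth, of the oracle terms. -/
noncomputable def oracleEnvelope (x₀ : F) (s₀ a b w : ℝ) (ℓ : ℕ) (o : F × ℝ × ℝ × ℕ) : ℝ :=
  if o.2.2.2 = 1 ∧ dist x₀ o.1 ≤ s₀ ∧ a ≤ o.2.1 ∧ 0 < o.2.1 ∧ o.2.1 ≤ b then
    w * o.2.1⁻¹ ^ ℓ else 0

lemma measurable_oracleEnvelope {x₀ : F} {s₀ a b w : ℝ} (ℓ : ℕ) :
    Measurable (oracleEnvelope x₀ s₀ a b w ℓ) := by
  have hd : Measurable fun o : F × ℝ × ℝ × ℕ => dist x₀ o.1 :=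
    (continuous_const.dist continuous_id).measurable.comp measurable_fst
  refine Measurable.ite ?_ (by fun_prop) measurable_const
  refine measurableSet_setOf_and ((by fun_prop : Measurable fun o : F × ℝ × ℝ × ℕ => o.2.2.2)
    (measurableSet_singleton 1)) (measurableSet_setOf_and (measurableSet_le hd measurable_const)
    (measurableSet_setOf_and (measurableSet_le (by fun_prop) (by fun_prop))
    (measurableSet_setOf_and (measurableSet_lt (by fun_prop) (by fun_prop))
    (measurableSet_le (by fun_prop) (by fun_prop)))))

/-- The moments of the envelope on small balls are of the order of the small-ball probability,
because the conditional moments of `Y⁻¹` are bounded near `x₀`. -/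
lemma IsModel.lintegral_oracleEnvelope_le (h : IsModel P X Y T S) {x₀ : F} {s₀ a b w : ℝ}
    (hw : 0 ≤ w) (ℓ m : ℕ) (hm : 1 ≤ m) {g : F → ℝ≥0∞} {c : ℝ≥0}
    (hg : IsCondInvMoment P X Y (ℓ * m) g) (hgc : ∀ x, dist x₀ x ≤ s₀ → g x ≤ c) (s : ℝ) :
    ∫⁻ o in {o | dist x₀ o.1 ≤ s}, ENNReal.ofReal (oracleEnvelope x₀ s₀ a b w ℓ o ^ m)
      ∂(observedLaw P X Y T S) ≤
      ENNReal.ofReal ((P.real (retained Y T S))⁻¹ * (w ^ m * c) * smallBall P X x₀ s) := by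
  classical
  have hd : Measurable fun q : F × ℝ => dist x₀ q.1 :=
    (continuous_const.dist continuous_id).measurable.comp measurable_fst
  have hd' : Measurable fun o : F × ℝ × ℝ × ℕ => dist x₀ o.1 :=
    (continuous_const.dist continuous_id).measurable.comp measurable_fst
  set f : F × ℝ → ℝ≥0∞ := fun q => if dist x₀ q.1 ≤ s ∧ dist x₀ q.1 ≤ s₀ then
    ENNReal.ofReal (w ^ m) * ENNReal.ofReal (q.2⁻¹ ^ (ℓ * m)) else 0 with hf
  have hfm : Measurable f := by
    refine Measurable.ite (measurableSet_setOf_and (measurableSet_le hd measurable_const)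
      (measurableSet_le hd measurable_const)) ?_ measurable_const
    fun_prop
  have h1 : ∫⁻ o in {o | dist x₀ o.1 ≤ s}, ENNReal.ofReal (oracleEnvelope x₀ s₀ a b w ℓ o ^ m)
      ∂(observedLaw P X Y T S) ≤
      ∫⁻ o, (if o.2.2.2 = 1 then f (o.1, o.2.1) else 0) ∂(observedLaw P X Y T S) := by
    rw [← lintegral_indicator (measurableSet_le hd' measurable_const)]
    refine lintegral_mono fun o => ?_
    simp only [Set.indicator_apply, Set.mem_ofPred_eq, oracleEnvelope]
    by_cases h2 : dist x₀ o.1 ≤ s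
    · rw [if_pos h2]
      split_ifs with h3 h4
      · simp only [hf]
        rw [if_pos ⟨h2, h3.2.1⟩, mul_pow, ← pow_mul, ENNReal.ofReal_mul (by positivity)]
      · exact absurd h3.1 h4
      · simp [zero_pow (by omega : m ≠ 0)]
      · simp [zero_pow (by omega : m ≠ 0)]
    · rw [if_neg h2]
      exact zero_le
  set B := Metric.closedBall x₀ (min s s₀) with hB
  have hBm : MeasurableSet B := Metric.isClosed_closedBall.measurableSet
  refine h1.trans ?_
  rw [h.lintegral_uncensored hfm]
  calc _ ≤ (P (retained Y T S))⁻¹ * ∫⁻ ω in X ⁻¹' B,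
        ENNReal.ofReal (w ^ m) * ENNReal.ofReal ((Y ω)⁻¹ ^ (ℓ * m)) ∂P := by
        rw [← lintegral_indicator (h.measurable_X hBm)]
        gcongr with ω
        refine (mul_le_of_le_one_right' (mul_le_one' prob_le_one prob_le_one)).trans ?_
        simp only [hf]
        split_ifs with h2
        · rw [Set.indicator_of_mem]
          change dist (X ω) x₀ ≤ _
          rw [dist_comm]
          exact le_min h2.1 h2.2
        · exact zero_le
    _ ≤ (P (retained Y T S))⁻¹ * (ENNReal.ofReal (w ^ m) * (c * P (X ⁻¹' B))) := by
        rw [lintegral_const_mul' _ _ ENNReal.ofReal_ne_top]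
        gcongr
        refine hg.setLIntegral_le h.measurable_X hBm fun x hx => hgc x ?_
        rw [dist_comm]
        exact (show dist x x₀ ≤ _ from hx).trans (min_le_right _ _)
    _ ≤ (P (retained Y T S))⁻¹ * (ENNReal.ofReal (w ^ m) *
          (c * P (X ⁻¹' Metric.closedBall x₀ s))) := by
        gcongr
        exact Metric.closedBall_subset_closedBall (min_le_left _ _)
    _ = _ := by
        have hp := h.pos_real_retained
        rw [h.inv_retained_eq, ← ofReal_measureReal (s := X ⁻¹' Metric.closedBall x₀ s),
          ← ENNReal.ofReal_coe_nnreal, ← ENNReal.ofReal_mul (by positivity),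
          ← ENNReal.ofReal_mul (by positivity), ← ENNReal.ofReal_mul (by positivity)]
        congr 1
        rw [smallBall]
        ring

end Oracle

section OracleRate

variable {F Ω₀ Ω : Type*} [PseudoMetricSpace F] [MeasurableSpace F] [OpensMeasurableSpace F]
  [MeasurableSpace Ω₀] {P : Measure Ω₀} [IsProbabilityMeasure P] {X : Ω₀ → F}

/-- The kernel dominates a multiple of the indicator of the ball of radius `η`, so its mass is at
least of the order of the small-ball probability. -/
lemma mul_smallBall_le_integral_kernel (hX : Measurable X) (x₀ : F) {K : ℝ → ℝ}
    (hK : Measurable K) {c₁ c₂ : ℝ} (hc₁ : 0 ≤ c₁)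
    (hK1 : ∀ u, c₁ * (Set.Icc (0 : ℝ) 1).indicator 1 u ≤ K u) (hKle : ∀ u, K u ≤ c₂)
    {η : ℝ} (hη : 0 < η) :
    Integrable (fun ω => K (dist x₀ (X ω) / η)) P ∧
      c₁ * smallBall P X x₀ η ≤ ∫ ω, K (dist x₀ (X ω) / η) ∂P := by
  have hK0 : ∀ u, 0 ≤ K u := fun u => (mul_nonneg hc₁
    (Set.indicator_nonneg (fun _ _ => zero_le_one) u)).trans (hK1 u)
  have hKm : Measurable fun x : F => K (dist x₀ x / η) :=
    hK.comp ((continuous_const.dist continuous_id).measurable.div_const _)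
  have hKi : Integrable (fun ω => K (dist x₀ (X ω) / η)) P :=
    Integrable.of_bound (hKm.comp hX).aestronglyMeasurable c₂ (ae_of_all _ fun ω => by
      rw [Real.norm_eq_abs, abs_of_nonneg (hK0 _)]
      exact hKle _)
  refine ⟨hKi, ?_⟩
  have hBm : MeasurableSet (X ⁻¹' Metric.closedBall x₀ η) :=
    hX Metric.isClosed_closedBall.measurableSet
  have h1 : ∫ ω, (X ⁻¹' Metric.closedBall x₀ η).indicator (fun _ => c₁) ω ∂P =
      c₁ * smallBall P X x₀ η := by
    rw [integral_indicator_const _ hBm, smul_eq_mul, mul_comm, smallBall]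
  rw [← h1]
  refine integral_mono ((integrable_const c₁).indicator hBm) hKi fun ω => ?_
  by_cases hω : ω ∈ X ⁻¹' Metric.closedBall x₀ η
  · rw [Set.indicator_of_mem hω]
    have hu : dist x₀ (X ω) / η ∈ Set.Icc (0 : ℝ) 1 :=
      ⟨div_nonneg dist_nonneg hη.le, (div_le_one hη).2 (Metric.mem_closedBall'.1 hω)⟩
    have h2 := hK1 (dist x₀ (X ω) / η)
    rwa [Set.indicator_of_mem hu, Pi.one_apply, mul_one] at h2
  · rw [Set.indicator_of_notMem hω]
    exact hK0 _

variable {Ω : Type*} [MeasurableSpace Ω] {Y T S : Ω₀ → ℝ}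
  {Q : Measure Ω} [IsProbabilityMeasure Q] {o : ℕ → Ω → F × ℝ × ℝ × ℕ}

/-- The oracle kernel sums, relative to the total kernel mass, estimate the conditional inverse
moments with the rate of the bias plus that of the fluctuations. -/
lemma IsModel.ae_eventually_oracle_sum (h : IsModel P X Y T S)
    (ho : IsIID Q (observedLaw P X Y T S) o) {x₀ : F} {s₀ a b : ℝ} (hs₀ : 0 < s₀)
    (ha : 0 < distFun P T a) (haZ : ∀ᵐ ω ∂P, a ≤ censored Y S ω)
    (hb : 0 < P {ω | b < censored Y S ω}) (hYb : ∀ᵐ ω ∂P, dist x₀ (X ω) ≤ s₀ → Y ω ≤ b)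
    (hφ : ∀ ρ : ℝ, 0 < ρ → 0 < smallBall P X x₀ ρ)
    {ℓ : ℕ} (hℓ : 1 ≤ ℓ) {r : F → ℝ}
    (hr : IsCondInvMoment P X Y ℓ fun x => ENNReal.ofReal (r x)) (hr0 : 0 ≤ r x₀)
    {k c : ℝ} (hk : 0 < k) (hc0 : 0 ≤ c)
    (hc : ∀ x, dist x₀ x ≤ s₀ → |r x - r x₀| ≤ c * dist x₀ x ^ k)
    {K : ℝ → ℝ} (hK : Measurable K) {c₁ c₂ : ℝ} (hc₁ : 0 < c₁)
    (hK1 : ∀ u, c₁ * (Set.Icc (0 : ℝ) 1).indicator 1 u ≤ K u)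
    (hK2 : ∀ u, K u ≤ c₂ * (Set.Icc (0 : ℝ) 1).indicator 1 u)
    {η : ℕ → ℝ} (hη : ∀ n, 0 < η n) (hηlim : Tendsto η atTop (𝓝 0))
    (hrate : Tendsto (fun n : ℕ => Real.log n / (n * smallBall P X x₀ (η n))) atTop (𝓝 0))
    (hmom : ∀ m : ℕ, 2 ≤ m → ∃ (g : F → ℝ≥0∞) (C : ℝ≥0),
      IsCondInvMoment P X Y m g ∧ ∀ x, dist x₀ x ≤ s₀ → g x ≤ C) :
    ∃ C : ℝ, ∀ᵐ ω ∂Q, ∀ᶠ n : ℕ in atTop,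
      |(∑ i ∈ Finset.range n, oracleTerm P T S x₀ s₀ a b K ℓ (η n) (o i ω)) /
        (n * ((P.real (retained Y T S))⁻¹ * ∫ ω, K (dist x₀ (X ω) / η n) ∂P)) - r x₀| ≤
        C * (η n ^ k + √(Real.log n / (n * smallBall P X x₀ (η n)))) := by
  have hμ := h.isProbabilityMeasure_observedLaw
  have hp := h.pos_real_retained
  have hK0 : ∀ u, 0 ≤ K u := fun u => (mul_nonneg hc₁.le
    (Set.indicator_nonneg (fun _ _ => zero_le_one) u)).trans (hK1 u)
  have hKle : ∀ u, K u ≤ c₂ := by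
    intro u
    refine (hK2 u).trans ?_
    have hc₂ : 0 ≤ c₂ := by simpa using (hK0 0).trans (hK2 0)
    exact mul_le_of_le_one_right hc₂ (Set.indicator_le_self' (fun _ _ => zero_le_one) u)
  have hc₂ : 0 ≤ c₂ := (hK0 0).trans (hKle 0)
  have hKout : ∀ u, 1 < u → K u = 0 := by
    intro u hu
    refine le_antisymm ?_ (hK0 u)
    have := hK2 u
    rwa [Set.indicator_of_notMem (fun h' => absurd h'.2 (not_le.2 hu)), mul_zero] at this
  have hGb := h.one_sub_distFun_pos le_rfl hb
  set w := c₂ / (distFun P T a * (1 - distFun P S b)) with hw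
  have hw0 : 0 ≤ w := by positivity
  have hd : Measurable fun x : F => dist x₀ x :=
    (continuous_const.dist continuous_id).measurable
  have hφmono : Monotone (smallBall P X x₀) := fun s t hst =>
    measureReal_mono (Set.preimage_mono (Metric.closedBall_subset_closedBall hst))
  -- moments of orders 2 and 16 of the envelope
  obtain ⟨g₂, C₂, hg₂, hgc₂⟩ := hmom (ℓ * 2) (by omega)
  obtain ⟨g₁₆, C₁₆, hg₁₆, hgc₁₆⟩ := hmom (ℓ * 16) (by omega)
  set B := max ((P.real (retained Y T S))⁻¹ * (w ^ 2 * C₂))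
    ((P.real (retained Y T S))⁻¹ * (w ^ 16 * C₁₆)) with hB
  have hB0 : 0 ≤ B := le_max_of_le_left (by positivity)
  have hterm0 : ∀ n q, 0 ≤ oracleTerm P T S x₀ s₀ a b K ℓ (η n) q := by
    intro n q
    unfold oracleTerm
    split_ifs with hq
    · have h1 := distFun_nonneg (P := P) T q.2.1
      have h2 := sub_nonneg.2 (distFun_le_one (P := P) S q.2.1)
      have h3 := hK0 (dist x₀ q.1 / η n)
      have h4 := hq.2.2.2.1.le
      positivity
    · exact le_rfl
  have henv : ∀ n q, oracleTerm P T S x₀ s₀ a b K ℓ (η n) q ≤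
      {q : F × ℝ × ℝ × ℕ | dist x₀ q.1 ≤ η n}.indicator (oracleEnvelope x₀ s₀ a b w ℓ) q := by
    intro n q
    unfold oracleTerm oracleEnvelope
    by_cases hball : q ∈ {q : F × ℝ × ℝ × ℕ | dist x₀ q.1 ≤ η n}
    · rw [Set.indicator_of_mem hball]
      split_ifs with hq
      · have h1 := monotone_distFun (P := P) T hq.2.2.1
        have h2 := monotone_distFun (P := P) S hq.2.2.2.2
        have h3 := hq.2.2.2.1.le
        have h4 := distFun_nonneg (P := P) T q.2.1
        rw [hw, div_mul_eq_mul_div]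
        gcongr
        exact hKle _
      · exact le_rfl
    · have hout : ¬ dist x₀ q.1 ≤ η n := hball
      rw [Set.indicator_of_notMem hball, hKout _ ((one_lt_div (hη n)).2 (not_le.1 hout))]
      simp
  obtain ⟨C, hC⟩ := ho.ae_eventually_abs_sum_sub_le
    (fun n => measurable_oracleTerm hK ℓ (η n)) hterm0 (G := oracleEnvelope x₀ s₀ a b w ℓ)
    (ρ := fun q => dist x₀ q.1)
    (measurable_oracleEnvelope ℓ) (hd.comp measurable_fst) hφmono (fun s => measureReal_le_one) hB0
    (fun s => (h.lintegral_oracleEnvelope_le hw0 ℓ 2 (by norm_num) hg₂ hgc₂ s).trans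
      (ENNReal.ofReal_le_ofReal (mul_le_mul_of_nonneg_right (le_max_left _ _) measureReal_nonneg)))
    (fun s => (h.lintegral_oracleEnvelope_le hw0 ℓ 16 (by norm_num) hg₁₆ hgc₁₆ s).trans
      (ENNReal.ofReal_le_ofReal (mul_le_mul_of_nonneg_right (le_max_right _ _)
        measureReal_nonneg)))
    henv (fun n => hφ _ (hη n)) hrate
  refine ⟨max c (|C| * (P.real (retained Y T S) * c₁⁻¹)), ?_⟩
  have hηs : ∀ᶠ n in atTop, η n ≤ s₀ := hηlim.eventually (Iic_mem_nhds hs₀)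
  filter_upwards [hC] with ω hC
  filter_upwards [hC, hηs, eventually_one_le_log, eventually_ge_atTop 1] with n hC hηs hlog hn1
  have hn0 : (0 : ℝ) < n := by exact_mod_cast hn1
  set φ := smallBall P X x₀ (η n) with hφdef
  have hφ0 : 0 < φ := hφ _ (hη n)
  set κ := ∫ ω, K (dist x₀ (X ω) / η n) ∂P with hκ
  have hKm : Measurable fun x : F => K (dist x₀ x / η n) := hK.comp (hd.div_const _)
  obtain ⟨hKi, hκφ⟩ := mul_smallBall_le_integral_kernel (P := P) h.measurable_X x₀ hK hc₁.le hK1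
    hKle (hη n)
  have hκ0 : 0 < κ := (mul_pos hc₁ hφ0).trans_le hκφ
  have hmean := h.integral_oracleTerm ha haZ hb hYb hK hK0 hKout ℓ (hη n) hηs
  have hbias := hr.abs_toReal_sub_le h.measurable_X h.measurable_Y hr0 hk hc0 (hη n).le
    (fun x hx => hc x (hx.trans hηs)) hKm (fun x => hK0 _)
    (fun x hx => hKout _ ((one_lt_div (hη n)).2 hx)) hKi
  set I := (∫⁻ ω, ENNReal.ofReal (K (dist x₀ (X ω) / η n)) *
        ENNReal.ofReal ((Y ω)⁻¹ ^ ℓ) ∂P).toReal with hI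
  rw [hmean] at hC
  set D := ∑ i ∈ Finset.range n, oracleTerm P T S x₀ s₀ a b K ℓ (η n) (o i ω) with hD
  set p := P.real (retained Y T S) with hpdef
  set ρ := √(Real.log n / (n * φ)) with hρ
  have hρ0 : 0 ≤ ρ := Real.sqrt_nonneg _
  have hM : 0 < n * (p⁻¹ * κ) := by positivity
  have hsqrt : √(n * φ * Real.log n) = n * φ * ρ := by
    rw [hρ, show (n : ℝ) * φ * Real.log n = (n * φ) ^ 2 * (Real.log n / (n * φ)) by field_simp,
      Real.sqrt_mul (by positivity), Real.sqrt_sq (by positivity)]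
  rw [hsqrt] at hC
  have h1 : |D - n * (p⁻¹ * κ) * r x₀| ≤ |C| * (n * φ * ρ) + n * p⁻¹ * (c * η n ^ k * κ) := by
    calc |D - n * (p⁻¹ * κ) * r x₀|
        = |(D - n * (p⁻¹ * I)) + n * p⁻¹ * (I - r x₀ * κ)| := by congr 1; ring
      _ ≤ |D - n * (p⁻¹ * I)| + |n * p⁻¹ * (I - r x₀ * κ)| := abs_add_le _ _
      _ ≤ _ := by
          rw [abs_mul, abs_of_pos (by positivity : 0 < (n : ℝ) * p⁻¹)]
          gcongr
          exact hC.trans (mul_le_mul_of_nonneg_right (le_abs_self C) (by positivity))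
  rw [show D / (n * (p⁻¹ * κ)) - r x₀ = (D - n * (p⁻¹ * κ) * r x₀) / (n * (p⁻¹ * κ)) by
    field_simp, abs_div, abs_of_pos hM, div_le_iff₀ hM]
  refine h1.trans ?_
  have h2 : |C| * (n * φ * ρ) ≤ |C| * (p * c₁⁻¹) * ρ * (n * (p⁻¹ * κ)) := by
    rw [show |C| * (p * c₁⁻¹) * ρ * (n * (p⁻¹ * κ)) = |C| * (n * (c₁⁻¹ * κ) * ρ) by field_simp]
    gcongr
    rw [inv_mul_eq_div, le_div_iff₀ hc₁, mul_comm]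
    exact hκφ
  have hηk : 0 ≤ η n ^ k := Real.rpow_nonneg (hη n).le _
  calc |C| * (n * φ * ρ) + n * p⁻¹ * (c * η n ^ k * κ)
      ≤ |C| * (p * c₁⁻¹) * ρ * (n * (p⁻¹ * κ)) + c * η n ^ k * (n * (p⁻¹ * κ)) := by
        refine add_le_add h2 (le_of_eq (by ring))
    _ ≤ max c (|C| * (p * c₁⁻¹)) * ρ * (n * (p⁻¹ * κ)) +
        max c (|C| * (p * c₁⁻¹)) * η n ^ k * (n * (p⁻¹ * κ)) := by
        gcongr
        · exact le_max_right _ _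
        · exact le_max_left _ _
    _ = _ := by ring

end OracleRate

/-! ### Perturbation of sums and ratios -/

lemma abs_div_sub_div_le {A₁ A₂ r₁ r₂ E : ℝ} (hr₂ : 0 < r₂) (h1 : |A₁ - r₁| ≤ E)
    (h2 : |A₂ - r₂| ≤ E) (hE : E ≤ r₂ / 2) :
    |A₁ / A₂ - r₁ / r₂| ≤ 2 * (r₂ + |r₁|) / r₂ ^ 2 * E := by
  have hA₂ : r₂ / 2 ≤ A₂ := by linarith [(abs_le.1 h2).1]
  have hA₂0 : 0 < A₂ := by linarith
  have hE0 : 0 ≤ E := (abs_nonneg _).trans h1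
  have h3 : |(A₁ - r₁) * r₂ - r₁ * (A₂ - r₂)| ≤ (r₂ + |r₁|) * E := by
    refine (abs_sub _ _).trans ?_
    rw [abs_mul, abs_mul, abs_of_pos hr₂]
    nlinarith [mul_le_mul_of_nonneg_right h1 hr₂.le,
      mul_le_mul_of_nonneg_left h2 (abs_nonneg r₁)]
  rw [show A₁ / A₂ - r₁ / r₂ = ((A₁ - r₁) * r₂ - r₁ * (A₂ - r₂)) / (A₂ * r₂) by
    field_simp; ring, abs_div, abs_of_pos (mul_pos hA₂0 hr₂)]
  calc |(A₁ - r₁) * r₂ - r₁ * (A₂ - r₂)| / (A₂ * r₂) ≤ (r₂ + |r₁|) * E / (r₂ / 2 * r₂) := by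
        gcongr
    _ = _ := by field_simp

lemma abs_sum_mul_exp_sub_le {ι : Type*} (s : Finset ι) {f θ : ι → ℝ}
    (hf : ∀ i ∈ s, 0 ≤ f i) {η : ℝ} (hη : η ≤ 1) (hθ : ∀ i ∈ s, |θ i| ≤ η) :
    |∑ i ∈ s, f i * Real.exp (-θ i) - ∑ i ∈ s, f i| ≤ 2 * η * ∑ i ∈ s, f i := by
  rw [← Finset.sum_sub_distrib, Finset.mul_sum]
  refine (Finset.abs_sum_le_sum_abs _ _).trans (Finset.sum_le_sum fun i hi => ?_)
  have h1 : |(-θ i)| ≤ 1 := by rw [abs_neg]; exact (hθ i hi).trans hη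
  have h2 := Real.abs_exp_sub_one_le h1
  rw [abs_neg] at h2
  rw [show f i * Real.exp (-θ i) - f i = f i * (Real.exp (-θ i) - 1) by ring, abs_mul,
    abs_of_nonneg (hf i hi), mul_comm]
  exact mul_le_mul_of_nonneg_right (h2.trans (by linarith [hθ i hi])) (hf i hi)

/-- Weights that are exact up to factors `exp θ` with `θ` small only change the relative error of a
sum of nonnegative terms by a multiple of the size of `θ`. -/
lemma abs_perturbed_sum_div_sub_le {n : ℕ} {f θ : ℕ → ℝ} {m r C c R η : ℝ} (hm : 0 < m)
    (hf : ∀ j, 0 ≤ f j) (hη1 : η ≤ 1) (hθ : ∀ j ∈ Finset.range n, |θ j| ≤ η)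
    (hηR : η ≤ c * R) (hc : 0 ≤ c) (hR0 : 0 ≤ R) (hR1 : R ≤ 1) (hC : 0 ≤ C)
    (h : |(∑ j ∈ Finset.range n, f j) / m - r| ≤ C * R) :
    |(∑ j ∈ Finset.range n, f j * Real.exp (-θ j)) / m - r| ≤ (2 * c * (|r| + C) + C) * R := by
  have h1 := abs_sum_mul_exp_sub_le (Finset.range n) (f := f) (fun i _ => hf i) hη1 hθ
  set D := ∑ j ∈ Finset.range n, f j with hD
  set E := ∑ j ∈ Finset.range n, f j * Real.exp (-θ j) with hE
  have hD0 : 0 ≤ D / m := div_nonneg (Finset.sum_nonneg fun i _ => hf i) hm.le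
  have h2 : D / m ≤ |r| + C := by
    have := (abs_le.1 h).2
    have := le_abs_self r
    have := mul_le_of_le_one_right hC hR1
    linarith
  have h3 : |E / m - D / m| ≤ 2 * (c * R) * (|r| + C) := by
    rw [← sub_div, abs_div, abs_of_pos hm, div_le_iff₀ hm]
    refine h1.trans ?_
    calc 2 * η * D = 2 * η * (D / m) * m := by field_simp
      _ ≤ 2 * (c * R) * (|r| + C) * m := by gcongr
  calc |E / m - r| = |(E / m - D / m) + (D / m - r)| := by congr 1; ring
    _ ≤ 2 * (c * R) * (|r| + C) + C * R := (abs_add_le _ _).trans (add_le_add h3 h)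
    _ = _ := by ring

/-! ### The estimator -/

section Final

variable {F Ω₀ Ω : Type*} [PseudoMetricSpace F] [MeasurableSpace Ω₀] [MeasurableSpace Ω]
  {P : Measure Ω₀} {X : Ω₀ → F} {Y T S : Ω₀ → ℝ}
  {Q : Measure Ω} {o : ℕ → Ω → F × ℝ × ℝ × ℕ}

/-- Up to the scale `s` common to all weights, the kernel sum with estimated weights is the oracle
sum with each term perturbed by a factor close to one. -/
lemma weightedSum_eq_sum_oracleTerm {x₀ : F} {s₀ a b : ℝ} {K : ℝ → ℝ}
    (hK1 : ∀ u, 1 < u → K u = 0) (ℓ : ℕ) {η : ℝ} (hη : 0 < η) (hηs : η ≤ s₀) {n : ℕ}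
    {q : ℕ → F × ℝ × ℝ × ℕ}
    (hδ : ∀ j, (q j).2.2.2 = 0 ∨ (q j).2.2.2 = 1) (ha : ∀ j, a ≤ (q j).2.1)
    (h0 : ∀ j, 0 < (q j).2.1)
    (hb : ∀ j, (q j).2.2.2 = 1 → dist x₀ (q j).1 ≤ s₀ → (q j).2.1 ≤ b)
    {s : ℝ} {θ : ℕ → ℝ}
    (hw : ∀ j < n, (q j).2.1 ≤ b →
      lyndenBell n (fun i => (q i).2.1) (fun i => (q i).2.2.1) (q j).2.1 *
        (1 - tjwG n (fun i => (q i).2.1) (fun i => (q i).2.2.1)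
          (fun i => (q i).2.2.2) (q j).2.1) =
      s * (distFun P T (q j).2.1 * (1 - distFun P S (q j).2.1)) * Real.exp (θ j)) :
    weightedSum K η x₀ ℓ n (fun i => (q i).1) (fun i => (q i).2.1) (fun i => (q i).2.2.1)
        (fun i => (q i).2.2.2) =
      s⁻¹ * ∑ j ∈ Finset.range n, oracleTerm P T S x₀ s₀ a b K ℓ η (q j) * Real.exp (-θ j) := by
  rw [weightedSum, Finset.mul_sum]
  refine Finset.sum_congr rfl fun j hj => ?_
  rcases hδ j with h1 | h1
  · simp [h1, oracleTerm]
  by_cases h2 : dist x₀ (q j).1 ≤ s₀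
  · have h3 := hb j h1 h2
    rw [hw j (Finset.mem_range.1 hj) h3, oracleTerm, if_pos ⟨h1, h2, ha j, h0 j, h3⟩, h1,
      Nat.cast_one, one_mul, Real.exp_neg, div_eq_mul_inv, div_eq_mul_inv, mul_inv, mul_inv s]
    ring
  · have h3 : K (dist x₀ (q j).1 / η) = 0 :=
      hK1 _ ((one_lt_div hη).2 (hηs.trans_lt (not_le.1 h2)))
    simp [h3, oracleTerm]

/-- An observed sample may be replaced by a sequence of genuinely measurable records. -/
lemma IsObservedSample.exists_isIID [MeasurableSpace F] [OpensMeasurableSpace F]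
    (ho : IsObservedSample P X Y T S Q o) :
    ∃ o' : ℕ → Ω → F × ℝ × ℝ × ℕ, IsIID Q (observedLaw P X Y T S) o' ∧
      ∀ᵐ ω ∂Q, ∀ i, o i ω = o' i ω := by
  have hm := fun i => (ho.identDistrib i).aemeasurable_fst
  refine ⟨fun i => (hm i).mk (o i), ⟨fun i => (hm i).measurable_mk, ?_, fun i => ?_⟩,
    ae_all_iff.2 fun i => (hm i).ae_eq_mk⟩
  · exact ho.indep.congr fun i => (hm i).ae_eq_mk
  · rw [← Measure.map_congr (hm i).ae_eq_mk, (ho.identDistrib i).map_eq, observedLaw]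

end Final

section Rate

variable {F Ω₀ Ω : Type*} [PseudoMetricSpace F] [MeasurableSpace F] [OpensMeasurableSpace F]
  [MeasurableSpace Ω₀] [MeasurableSpace Ω]
  {P : Measure Ω₀} {X : Ω₀ → F} {Y T S : Ω₀ → ℝ}
  {Q : Measure Ω} {o : ℕ → Ω → F × ℝ × ℝ × ℕ}

/-- The almost sure properties of the records that make the truncation of the oracle terms
harmless. -/
lemma IsModel.ae_record (h : IsModel P X Y T S) (ho : IsIID Q (observedLaw P X Y T S) o)
    {x₀ : F} {s₀ a b : ℝ} (haZ : ∀ᵐ ω ∂P, a ≤ censored Y S ω)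
    (hYb : ∀ᵐ ω ∂P, dist x₀ (X ω) ≤ s₀ → Y ω ≤ b) :
    ∀ᵐ ω ∂Q, ∀ j, ((o j ω).2.2.2 = 0 ∨ (o j ω).2.2.2 = 1) ∧ a ≤ (o j ω).2.1 ∧
      0 < (o j ω).2.1 ∧
      ((o j ω).2.2.2 = 1 → dist x₀ (o j ω).1 ≤ s₀ → (o j ω).2.1 ≤ b) := by
  have hd : Measurable fun o : F × ℝ × ℝ × ℕ => dist x₀ o.1 :=
    (continuous_const.dist continuous_id).measurable.comp measurable_fst
  have hδ : Measurable fun o : F × ℝ × ℝ × ℕ => o.2.2.2 := by fun_prop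
  have hz : Measurable fun o : F × ℝ × ℝ × ℕ => o.2.1 := by fun_prop
  have h1 := h.ae_observedLaw (p := fun q => q.2.2.2 = 0 ∨ q.2.2.2 = 1)
    (hδ (MeasurableSet.of_discrete (s := {0, 1}))) (ae_of_all _ fun ω _ => by
      unfold record uncensored
      dsimp only
      split_ifs <;> simp)
  have h2 := h.ae_observedLaw (p := fun q => a ≤ q.2.1) (measurableSet_le measurable_const hz)
    (haZ.mono fun ω hω _ => hω)
  have h3 := h.ae_observedLaw (p := fun q => 0 < q.2.1) (measurableSet_lt measurable_const hz)
    (by filter_upwards [h.pos_Y, h.pos_S] with ω hY hS _ using lt_min hY hS)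
  have h4 := h.ae_observedLaw (p := fun q => dist x₀ q.1 ≤ s₀ → q.2.1 ≤ b)
    (by
      have : {q : F × ℝ × ℝ × ℕ | dist x₀ q.1 ≤ s₀ → q.2.1 ≤ b} =
          {q : F × ℝ × ℝ × ℕ | dist x₀ q.1 ≤ s₀}ᶜ ∪ {q : F × ℝ × ℝ × ℕ | q.2.1 ≤ b} := by
        ext q
        exact imp_iff_not_or
      rw [this]
      exact (measurableSet_le hd measurable_const).compl.union
        (measurableSet_le hz measurable_const))
    (hYb.mono fun ω hω _ hx => (min_le_left _ _).trans (hω hx))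
  refine ho.ae_forall (p := fun q => (q.2.2.2 = 0 ∨ q.2.2.2 = 1) ∧ a ≤ q.2.1 ∧ 0 < q.2.1 ∧
    (q.2.2.2 = 1 → dist x₀ q.1 ≤ s₀ → q.2.1 ≤ b)) ?_
  filter_upwards [h1, h2, h3, h4] with q h1 h2 h3 h4 using ⟨h1, h2, h3, fun _ => h4⟩

variable [IsProbabilityMeasure P] [IsProbabilityMeasure Q]

/-- The rate for a sequence of measurable records, with the neighbourhood a closed ball. -/
lemma IsModel.ae_eventually_estimator (h : IsModel P X Y T S)
    (ho : IsIID Q (observedLaw P X Y T S) o) {x₀ : F} {s₀ b : ℝ} (hs₀ : 0 < s₀) (hb0 : 0 < b)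
    (hb : 0 < P {ω | b < censored Y S ω}) (hYb : ∀ᵐ ω ∂P, dist x₀ (X ω) ≤ s₀ → Y ω ≤ b)
    (hφ : ∀ ρ : ℝ, 0 < ρ → 0 < smallBall P X x₀ ρ)
    {r₁ r₂ : F → ℝ} (hr₁ : IsCondInvMoment P X Y 1 fun x => ENNReal.ofReal (r₁ x))
    (hr₂ : IsCondInvMoment P X Y 2 fun x => ENNReal.ofReal (r₂ x))
    {k₁ k₂ c : ℝ} (hk₁ : 0 < k₁) (hk₂ : 0 < k₂) (hc0 : 0 ≤ c)
    (hH₁ : ∀ x, dist x₀ x ≤ s₀ → |r₁ x - r₁ x₀| ≤ c * dist x₀ x ^ k₁)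
    (hH₂ : ∀ x, dist x₀ x ≤ s₀ → |r₂ x - r₂ x₀| ≤ c * dist x₀ x ^ k₂)
    {K : ℝ → ℝ} (hK : Measurable K) {c₁ c₂ : ℝ} (hc₁ : 0 < c₁)
    (hK1 : ∀ u, c₁ * (Set.Icc (0 : ℝ) 1).indicator 1 u ≤ K u)
    (hK2 : ∀ u, K u ≤ c₂ * (Set.Icc (0 : ℝ) 1).indicator 1 u)
    {η : ℕ → ℝ} (hη : ∀ n, 0 < η n) (hηlim : Tendsto η atTop (𝓝 0))
    (hrate : Tendsto (fun n : ℕ => Real.log n / (n * smallBall P X x₀ (η n))) atTop (𝓝 0))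
    (hmom : ∀ m : ℕ, 2 ≤ m → ∃ (g : F → ℝ≥0∞) (C : ℝ≥0),
      IsCondInvMoment P X Y m g ∧ ∀ x, dist x₀ x ≤ s₀ → g x ≤ C) :
    ∃ C : ℝ, ∀ᵐ ω ∂Q, ∀ᶠ n : ℕ in atTop,
      |estimator K (η n) x₀ n (fun i => o i ω) - r₁ x₀ / r₂ x₀| ≤
        C * (η n ^ k₁ + η n ^ k₂ + √(Real.log n / (n * smallBall P X x₀ (η n)))) := by
  obtain ⟨a, ha, haZ, hac⟩ := h.exists_lowerEndpoint
  have hab : a ≤ b := by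
    have hpos : P {ω | dist x₀ (X ω) ≤ s₀} ≠ 0 := by
      intro h0
      refine (hφ s₀ hs₀).ne' ?_
      rw [smallBall, measureReal_def, show X ⁻¹' Metric.closedBall x₀ s₀ =
        {ω | dist x₀ (X ω) ≤ s₀} by ext ω; exact Metric.mem_closedBall', h0, ENNReal.toReal_zero]
    obtain ⟨ω, hω, h1, h2⟩ := ((frequently_ae_iff.2 hpos).and_eventually (haZ.and hYb)).exists
    exact h1.trans ((min_le_left _ _).trans (h2 hω))
  have hr₁0 : 0 ≤ r₁ x₀ := le_trans (by positivity)
    (hr₁.inv_pow_le h.measurable_X h.pos_Y hs₀ hYb hφ hk₁ hH₁ hc0)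
  have hr₂0 : 0 < r₂ x₀ := lt_of_lt_of_le (by positivity)
    (hr₂.inv_pow_le h.measurable_X h.pos_Y hs₀ hYb hφ hk₂ hH₂ hc0)
  have hK0 : ∀ u, 0 ≤ K u := fun u => (mul_nonneg hc₁.le
    (Set.indicator_nonneg (fun _ _ => zero_le_one) u)).trans (hK1 u)
  have hKle : ∀ u, K u ≤ |c₂| := by
    intro u
    refine (hK2 u).trans ((mul_le_mul_of_nonneg_right (le_abs_self c₂)
      (Set.indicator_nonneg (fun _ _ => zero_le_one) u)).trans ?_)
    exact mul_le_of_le_one_right (abs_nonneg _)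
      (Set.indicator_le_self' (fun _ _ => zero_le_one) u)
  have hKout : ∀ u, 1 < u → K u = 0 := by
    intro u hu
    refine le_antisymm ?_ (hK0 u)
    have := hK2 u
    rwa [Set.indicator_of_notMem (fun h' => absurd h'.2 (not_le.2 hu)), mul_zero] at this
  obtain ⟨C₁, hC₁⟩ := h.ae_eventually_oracle_sum ho hs₀ ha haZ hb hYb hφ le_rfl hr₁ hr₁0 hk₁ hc0
    hH₁ hK hc₁ hK1 hK2 hη hηlim hrate hmom
  obtain ⟨C₂, hC₂⟩ := h.ae_eventually_oracle_sum ho hs₀ ha haZ hb hYb hφ one_le_two hr₂ hr₂0.le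
    hk₂ hc0 hH₂ hK hc₁ hK1 hK2 hη hηlim hrate hmom
  obtain ⟨c₃, hc₃⟩ := h.ae_eventually_weights ho ha haZ hac hb hab
  set C := max |C₁| |C₂| with hC
  have hC0 : 0 ≤ C := (abs_nonneg _).trans (le_max_left _ _)
  set B₁ := 2 * |c₃| * (|r₁ x₀| + C) + C with hB₁
  set B₂ := 2 * |c₃| * (|r₂ x₀| + C) + C with hB₂
  have hB₁0 : 0 ≤ B₁ := by positivity
  have hB₂0 : 0 ≤ B₂ := by positivity
  set R : ℕ → ℝ := fun n =>
    η n ^ k₁ + η n ^ k₂ + √(Real.log n / (n * smallBall P X x₀ (η n))) with hR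
  have hRlim : Tendsto R atTop (𝓝 0) := by
    have h1 := hηlim.rpow_const (p := k₁) (Or.inr hk₁.le)
    have h2 := hηlim.rpow_const (p := k₂) (Or.inr hk₂.le)
    have h3 := hrate.sqrt
    rw [Real.zero_rpow hk₁.ne'] at h1
    rw [Real.zero_rpow hk₂.ne'] at h2
    rw [Real.sqrt_zero] at h3
    simpa using (h1.add h2).add h3
  have hsmall : ∀ᶠ n in atTop, (B₁ + B₂) * R n ≤ r₂ x₀ / 2 := by
    have := hRlim.const_mul (B₁ + B₂)
    rw [mul_zero] at this
    exact this.eventually (Iic_mem_nhds (by positivity))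
  have hsmall' : ∀ᶠ n in atTop, |c₃| * R n ≤ 1 := by
    have := hRlim.const_mul |c₃|
    rw [mul_zero] at this
    exact this.eventually (Iic_mem_nhds one_pos)
  refine ⟨2 * (r₂ x₀ + |r₁ x₀|) / r₂ x₀ ^ 2 * (B₁ + B₂), ?_⟩
  filter_upwards [hC₁, hC₂, hc₃, h.ae_record ho haZ hYb] with ω hC₁ hC₂ hc₃ hrec
  filter_upwards [hC₁, hC₂, hc₃, hsmall, hsmall', hηlim.eventually (Iic_mem_nhds hs₀),
    hRlim.eventually (Iic_mem_nhds one_pos), eventually_one_le_log, eventually_ge_atTop 1]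
    with n hC₁ hC₂ ⟨s, hs, hw⟩ hsmall hsmall' hηs hR1 hlog hn1
  have hn0 : (0 : ℝ) < n := by exact_mod_cast hn1
  have hφn := hφ _ (hη n)
  have hρR : √(Real.log n / n) ≤ R n := by
    have h1 : √(Real.log n / n) ≤ √(Real.log n / (n * smallBall P X x₀ (η n))) := by
      refine Real.sqrt_le_sqrt (div_le_div_of_nonneg_left (by linarith) (by positivity) ?_)
      exact mul_le_of_le_one_right hn0.le measureReal_le_one
    have h2 := Real.rpow_nonneg (hη n).le k₁
    have h3 := Real.rpow_nonneg (hη n).le k₂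
    simp only [hR]
    linarith
  have hR0 : 0 ≤ R n := (Real.sqrt_nonneg _).trans hρR
  have hchoose : ∀ j, ∃ θ : ℝ, j < n → (o j ω).2.1 ≤ b →
      |θ| ≤ c₃ * √(Real.log n / n) ∧
        lyndenBell n (fun i => (o i ω).2.1) (fun i => (o i ω).2.2.1) (o j ω).2.1 *
          (1 - tjwG n (fun i => (o i ω).2.1) (fun i => (o i ω).2.2.1)
            (fun i => (o i ω).2.2.2) (o j ω).2.1) =
        s * (distFun P T (o j ω).2.1 * (1 - distFun P S (o j ω).2.1)) * Real.exp θ := by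
    intro j
    by_cases hj : j < n ∧ (o j ω).2.1 ≤ b
    · obtain ⟨θ, hθ⟩ := hw j hj.1 hj.2
      exact ⟨θ, fun _ _ => hθ⟩
    · exact ⟨0, fun h1 h2 => absurd ⟨h1, h2⟩ hj⟩
  choose θ' hθ' using hchoose
  -- Observations beyond `b` carry no weight, so their exponents may be set to zero.
  set θ : ℕ → ℝ := fun j => if (o j ω).2.1 ≤ b then θ' j else 0 with hθ
  have hθle : ∀ j ∈ Finset.range n, |θ j| ≤ |c₃| * R n := by
    intro j hj
    simp only [hθ]
    split_ifs with hjb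
    · refine (hθ' j (Finset.mem_range.1 hj) hjb).1.trans ?_
      exact mul_le_mul (le_abs_self _) hρR (Real.sqrt_nonneg _) (abs_nonneg _)
    · rw [abs_zero]
      positivity
  have hsum := fun ℓ => weightedSum_eq_sum_oracleTerm (P := P) (T := T) (S := S) hKout ℓ (hη n)
    hηs (q := fun i => o i ω) (s := s) (fun j => (hrec j).1) (fun j => (hrec j).2.1)
    (fun j => (hrec j).2.2.1) (fun j => (hrec j).2.2.2) (θ := θ) fun j hj hjb => by
      rw [(hθ' j hj hjb).2]
      simp only [hθ, if_pos hjb]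
  have hterm0 : ∀ ℓ j, 0 ≤ oracleTerm P T S x₀ s₀ a b K ℓ (η n) (o j ω) := by
    intro ℓ j
    unfold oracleTerm
    split_ifs with hq
    · have h1 := distFun_nonneg (P := P) T (o j ω).2.1
      have h2 := sub_nonneg.2 (distFun_le_one (P := P) S (o j ω).2.1)
      have h3 := hK0 (dist x₀ (o j ω).1 / η n)
      have h4 := hq.2.2.2.1.le
      positivity
    · exact le_rfl
  -- the sums of orders 1 and 2 are compared after division by the same total kernel mass `m`
  set m := n * ((P.real (retained Y T S))⁻¹ * ∫ ω, K (dist x₀ (X ω) / η n) ∂P) with hm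
  have hmpos : 0 < m := by
    have h1 := (mul_smallBall_le_integral_kernel (P := P) h.measurable_X x₀ hK hc₁.le hK1 hKle
      (hη n)).2
    exact mul_pos hn0 (mul_pos (inv_pos.2 h.pos_real_retained) ((mul_pos hc₁ hφn).trans_le h1))
  have hA : ∀ ℓ : ℕ, ∀ k C' r : ℝ, |C'| ≤ C → η n ^ k +
      √(Real.log n / (n * smallBall P X x₀ (η n))) ≤ R n →
      |(∑ i ∈ Finset.range n, oracleTerm P T S x₀ s₀ a b K ℓ (η n) (o i ω)) / m - r| ≤
        C' * (η n ^ k + √(Real.log n / (n * smallBall P X x₀ (η n)))) →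
      |(∑ i ∈ Finset.range n, oracleTerm P T S x₀ s₀ a b K ℓ (η n) (o i ω) *
        Real.exp (-θ i)) / m - r| ≤ (2 * |c₃| * (|r| + C) + C) * R n := by
    intro ℓ k C' r hC' hkR hle
    refine abs_perturbed_sum_div_sub_le hmpos (hterm0 ℓ) hsmall' hθle le_rfl (abs_nonneg _) hR0
      hR1 hC0 (hle.trans ?_)
    have := Real.rpow_nonneg (hη n).le k
    exact mul_le_mul ((le_abs_self _).trans hC') hkR (by positivity) hC0
  have hk₁0 := Real.rpow_nonneg (hη n).le k₁
  have hk₂0 := Real.rpow_nonneg (hη n).le k₂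
  have hA₁ := hA 1 k₁ C₁ (r₁ x₀) (le_max_left _ _) (by simp only [hR]; linarith) hC₁
  have hA₂ := hA 2 k₂ C₂ (r₂ x₀) (le_max_right _ _) (by simp only [hR]; linarith) hC₂
  have hmain := abs_div_sub_div_le hr₂0
    (hA₁.trans (mul_le_mul_of_nonneg_right (le_add_of_nonneg_right hB₂0) hR0))
    (hA₂.trans (mul_le_mul_of_nonneg_right (le_add_of_nonneg_left hB₁0) hR0)) hsmall
  rw [div_div_div_cancel_right₀ hmpos.ne'] at hmain
  -- the unknown scale `s` of the weights cancels in the ratio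
  rw [estimator, hsum 1, hsum 2, mul_div_mul_left _ _ (inv_ne_zero hs), mul_assoc]
  exact hmain

end Rate

end LTRC

theorem theorem1
    {F Ω₀ Ω : Type*} [PseudoMetricSpace F] [MeasurableSpace F] [OpensMeasurableSpace F]
    [MeasurableSpace Ω₀] [MeasurableSpace Ω]
    -- the population and the observed sample
    (P : Measure Ω₀) [IsProbabilityMeasure P] (X : Ω₀ → F) (Y T S : Ω₀ → ℝ)
    (hmodel : LTRC.IsModel P X Y T S)
    (Q : Measure Ω) [IsProbabilityMeasure Q] (obs : ℕ → Ω → F × ℝ × ℝ × ℕ)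
    (hobs : LTRC.IsObservedSample P X Y T S Q obs)
    -- the point, its neighbourhood, and the bound of the response there
    (x₀ : F) (N : Set F) (hN : N ∈ 𝓝 x₀)
    (b : ℝ) (hb : 0 < b)
    (hbH : (b : EReal) < LTRC.upperEndpoint (LTRC.distFun P (LTRC.censored Y S)))
    (hYb : ∀ᵐ ω ∂P, X ω ∈ N → Y ω ≤ b)
    -- small-ball probabilities
    (hφ_pos : ∀ ρ : ℝ, 0 < ρ → 0 < LTRC.smallBall P X x₀ ρ)
    (hφ_lim : Tendsto (LTRC.smallBall P X x₀) (𝓝[>] 0) (𝓝 0))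
    -- Hölder continuous conditional moments of orders -1 and -2
    (r₁ r₂ : F → ℝ)
    (hr₁ : LTRC.IsCondInvMoment P X Y 1 (fun x => ENNReal.ofReal (r₁ x)))
    (hr₂ : LTRC.IsCondInvMoment P X Y 2 (fun x => ENNReal.ofReal (r₂ x)))
    (k₁ k₂ : ℝ) (hk₁ : 0 < k₁) (hk₂ : 0 < k₂)
    (hHolder₁ : ∃ c : ℝ, ∀ x ∈ N, ∀ y ∈ N, |r₁ x - r₁ y| ≤ c * dist x y ^ k₁)
    (hHolder₂ : ∃ c : ℝ, ∀ x ∈ N, ∀ y ∈ N, |r₂ x - r₂ y| ≤ c * dist x y ^ k₂)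
    -- the kernel
    (K : ℝ → ℝ) (hK_meas : Measurable K)
    (hK : ∃ c c' : ℝ, 0 < c ∧ ∀ u : ℝ,
      c * (Set.Icc (0 : ℝ) 1).indicator 1 u ≤ K u ∧ K u ≤ c' * (Set.Icc (0 : ℝ) 1).indicator 1 u)
    -- the bandwidth
    (h : ℕ → ℝ) (hh_pos : ∀ n, 0 < h n) (hh_lim : Tendsto h atTop (𝓝 0))
    (hh_rate : Tendsto (fun n : ℕ => Real.log n / (n * LTRC.smallBall P X x₀ (h n))) atTop (𝓝 0))
    -- locally bounded conditional moments of all orders -m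
    (hmom : ∀ m : ℕ, 2 ≤ m → ∃ (g : F → ℝ≥0∞) (c : ℝ≥0),
      LTRC.IsCondInvMoment P X Y m g ∧ ∀ x ∈ N, g x ≤ c) :
    ∃ c : ℝ, ∀ᵐ ω ∂Q, ∀ᶠ n : ℕ in atTop,
      |LTRC.estimator K (h n) x₀ n (fun i => obs i ω) - r₁ x₀ / r₂ x₀| ≤
        c * (h n ^ k₁ + h n ^ k₂ +
          √(Real.log n / (n * LTRC.smallBall P X x₀ (h n)))) := by
  obtain ⟨c₁, hc₁⟩ := hHolder₁
  obtain ⟨c₂, hc₂⟩ := hHolder₂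
  obtain ⟨d₁, d₂, hd₁, hd⟩ := hK
  obtain ⟨s₀, hs₀, hsN⟩ := Metric.nhds_basis_closedBall.mem_iff.1 hN
  have hmem : ∀ x, dist x₀ x ≤ s₀ → x ∈ N := fun x hx => hsN (Metric.mem_closedBall'.2 hx)
  have hx₀ := mem_of_mem_nhds hN
  have hholder : ∀ (r : F → ℝ) (c k : ℝ),
      (∀ x ∈ N, ∀ y ∈ N, |r x - r y| ≤ c * dist x y ^ k) → c ≤ max |c₁| |c₂| →
      ∀ x, dist x₀ x ≤ s₀ → |r x - r x₀| ≤ max |c₁| |c₂| * dist x₀ x ^ k := by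
    intro r c k hr hc x hx
    rw [dist_comm]
    exact (hr x (hmem x hx) x₀ hx₀).trans
      (mul_le_mul_of_nonneg_right hc (Real.rpow_nonneg dist_nonneg _))
  obtain ⟨o, ho, hoeq⟩ := hobs.exists_isIID
  obtain ⟨C, hC⟩ := hmodel.ae_eventually_estimator ho hs₀ hb
    (LTRC.measure_lt_pos_of_lt_upperEndpoint hmodel.measurable_censored hbH)
    (hYb.mono fun ω hω hx => hω (hmem _ hx)) hφ_pos hr₁ hr₂ hk₁ hk₂
    ((abs_nonneg c₁).trans (le_max_left _ |c₂|))
    (hholder r₁ c₁ k₁ hc₁ ((le_abs_self _).trans (le_max_left _ _)))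
    (hholder r₂ c₂ k₂ hc₂ ((le_abs_self _).trans (le_max_right _ _)))
    hK_meas hd₁ (fun u => (hd u).1) (fun u => (hd u).2) hh_pos hh_lim hh_rate
    fun m hm => by
      obtain ⟨g, C, hg, hgC⟩ := hmom m hm
      exact ⟨g, C, hg, fun x hx => hgC x (hmem x hx)⟩
  refine ⟨C, ?_⟩
  filter_upwards [hC, hoeq] with ω hC hoeq
  simpa only [hoeq] using hC
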